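/- Notation. Let $\widehat{\mathbb C}=\mathbb C\cup\{\infty\}$ be the Riemann sphere, $\mathbb Z_+=\{1,2,\dots\}$, and let $H$ be the set of complex sequences $A=(A_j)_{j\in\mathbb Z_+}$ such that the power series $\exp\big(\sum_{j\ge1}A_jw^{j+1}\frac{d}{dw}\big)w$ converges absolutely in a neighbourhood of $0$. A sphere of type $(m,n)$ is a sphere with $m$ ordered outgoing (negatively oriented) punctures $p_{-m},\dots,p_{-1}$ and $n$ ordered incoming (positively oriented) punctures $p_1,\dots,p_n$, all distinct, together with an injective analytic local coordinate vanishing at each puncture; two such are conformally equivalent if a biholomorphism carries the punctures to the punctures in order and intertwines the germs of the local coordinates. For $n\ge 1$ the moduli space $K^*(n)$ of spheres of type $(n,1)$ is identified with the set of tuples $(z_{-n+1}^{-1},\dots,z_{-1}^{-1};A^{(-n)},(a_0^{(-n+1)},A^{(-n+1)}),\dots,(a_0^{(-1)},A^{(-1)}),(a_0^{(1)},A^{(1)}))$ with distinct $z_i\in\mathbb C^\times$, $a_0^{(i)}\in\mathbb C^\times$ and $A^{(i)}\in H$, and $K^*(0)$ with the set of $((1,A^{(1)}))$ with $A^{(1)}\in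 H$, $A^{(1)}_1=0$. Such a tuple stands for the class of $\widehat{\mathbb C}$ with outgoing punctures $\infty,z_{-n+1}^{-1},\dots,z_{-1}^{-1}$ (none if $n=0$), the incoming puncture $0$, local coordinate $\exp\big(\sum_jA_j^{(1)}w^{j+1}\frac{d}{dw}\big)(a_0^{(1)})^{w\frac{d}{dw}}w$ at $0$ (with $a_0^{(1)}=1$ if $n=0$), $\exp\big(-\sum_jA_j^{(-n)}w^{-j+1}\frac{d}{dw}\big)\frac1w$ at $\infty$, and $\exp\big(-\sum_jA_j^{(i)}x^{-j+1}\frac{d}{dx}\big)(a_0^{(i)})^{-x\frac{d}{dx}}\frac1x\Big|_{x=(w^{-1}-z_i)^{-1}}$ at $z_i^{-1}$. The identity element of $K^*(1)$ is $(\mathbf 0,(1,\mathbf 0))$. Sewing. $Q_1\,{}_1\infty_{-j}\,Q_2$ denotes the sewing of the first incoming tube of $Q_1$, with local coordinate $\Phi$, to the $-j$-th outgoing tube of $Q_2$, with local coordinate $\Psi$. It exists if there are $0<r_2<r_1$ such that (possibly after analytic extension of the injective maps $\Phi,\Psi$) the closed disc $\overline B^{r_1}$ lies in the image of $\Phi$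 and $\overline B^{1/r_2}$ in the image of $\Psi$, and $\Phi^{-1}(\overline B^{r_1})$, $\Psi^{-1}(\overline B^{1/r_2})$ contain no punctures other than the two being sewn. The result is obtained by removing $\Phi^{-1}(\overline B^{r_2})$ and $\Psi^{-1}(\overline B^{1/r_1})$, identifying $p$ and $q$ when $r_2<|\Phi(p)|<r_1$ and $\Psi(q)=1/\Phi(p)$, and keeping the remaining punctures and local coordinates; the outgoing punctures of $Q_1$ take the place of the sewn puncture of $Q_2$ in the ordering of outgoing punctures, and the incoming punctures of $Q_2$ take the place of the sewn puncture of $Q_1$ in the ordering of incoming punctures. A function $F:K^*(1)\to\mathbb C$ is meromorphic if $F(A^{(-1)},(a_0^{(1)},A^{(1)}))$ is a polynomial in the variables $A^{(-1)}_k$, $A^{(1)}_k$ ($k\in\mathbb Z_+$) and $a_0^{(1)}$ divided by a power $(a_0^{(1)})^r$, $r\in\mathbb N$. Lemma. Let $z\in\mathbb C^\times$. For all $\varepsilon\in\mathbb C$ sufficiently close to $0$ the sewing $$Q(\varepsilon)=((1,(0,-\varepsilon,0,0,\dots)))\;{}_1\infty_{-1}\;(z^{-1};\mathbf 0,(1,\mathbf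 0),(1,\mathbf 0))\in K^*(1)$$ exists and is well defined. For every meromorphic function $F$ on $K^*(1)$ the function $\varepsilon\mapsto F(Q(\varepsilon))$ is complex differentiable at $0$, only finitely many of the partial derivatives $\frac{\partial F}{\partial A_k^{(\pm1)}}$ at the identity element $(\mathbf 0,(1,\mathbf 0))$ are nonzero, and $\mathcal L_I(z)F:=\frac{d}{d\varepsilon}F(Q(\varepsilon))\big|_{\varepsilon=0}$ is given by $$\mathcal L_I(z)F=\sum_{k\in\mathbb Z_+}-z^{-k-2}\,\frac{\partial F}{\partial A_k^{(-1)}}\;-\;z^{-2}\,\frac{\partial F}{\partial a_0^{(1)}}\;+\;\sum_{k\in\mathbb Z_+}-z^{k-2}\,\frac{\partial F}{\partial A_k^{(1)}},$$ where all partial derivatives are evaluated at the identity element. -/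

import Mathlib

open scoped Topology Manifold

noncomputable section

namespace VOC

/-! ### The Riemann sphere -/

/-- The Riemann sphere `ℂ ∪ {∞}`. -/
abbrev Sphere : Type := OnePoint ℂ

/-- The coordinate `w` on the sphere (with the dummy value `0` at `∞`). -/
def toC (p : Sphere) : ℂ := p.elim 0 id

@[simp] lemma toC_coe (w : ℂ) : toC (w : Sphere) = w := rfl

@[simp] lemma toC_infty : toC (OnePoint.infty : Sphere) = 0 := rfl

open Classical in
/-- The inversion `w ↦ 1 / w` of the sphere, which exchanges `0` and `∞`. -/
def invS (p : Sphere) : Sphere :=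
  p.elim ((0 : ℂ) : Sphere) fun w => if w = 0 then OnePoint.infty else ((w⁻¹ : ℂ) : Sphere)

@[simp] lemma invS_infty : invS (OnePoint.infty : Sphere) = ((0 : ℂ) : Sphere) := rfl

@[simp] lemma invS_zero : invS ((0 : ℂ) : Sphere) = OnePoint.infty := by
  simp [invS]

lemma invS_coe {w : ℂ} (hw : w ≠ 0) : invS (w : Sphere) = ((w⁻¹ : ℂ) : Sphere) := by
  simp [invS, hw]

@[simp] lemma invS_invS (p : Sphere) : invS (invS p) = p := by
  induction p using OnePoint.rec with
  | infty => simp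
  | coe w =>
    by_cases hw : w = 0
    · subst hw; simp
    · rw [invS_coe hw, invS_coe (inv_ne_zero hw), inv_inv]

lemma tendsto_coe_cobounded :
    Filter.Tendsto (fun w : ℂ => (w : Sphere)) (Bornology.cobounded ℂ)
      (𝓝 (OnePoint.infty : Sphere)) := by
  rw [Metric.cobounded_eq_cocompact, ← Filter.coclosedCompact_eq_cocompact]
  exact OnePoint.tendsto_coe_infty

lemma continuous_invS : Continuous invS := by
  rw [continuous_iff_continuousAt]
  intro p
  induction p using OnePoint.rec with
  | infty =>
    rw [OnePoint.continuousAt_infty', Filter.coclosedCompact_eq_cocompact,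
      ← Metric.cobounded_eq_cocompact, invS_infty]
    have h : Filter.Tendsto (fun w : ℂ => ((w⁻¹ : ℂ) : Sphere)) (Bornology.cobounded ℂ)
        (𝓝 ((0 : ℂ) : Sphere)) :=
      (OnePoint.continuous_coe.tendsto (0 : ℂ)).comp Filter.tendsto_inv₀_cobounded
    refine h.congr' ?_
    filter_upwards [Bornology.eventually_ne_cobounded (0 : ℂ)] with w hw
    simp [invS_coe hw]
  | coe w =>
    rw [OnePoint.continuousAt_coe]
    by_cases hw : w = 0
    · subst hw
      rw [continuousAt_iff_punctured_nhds]
      have h : Filter.Tendsto (fun w : ℂ => ((w⁻¹ : ℂ) : Sphere)) (𝓝[≠] (0 : ℂ))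
          (𝓝 (OnePoint.infty : Sphere)) :=
        tendsto_coe_cobounded.comp Filter.tendsto_inv₀_nhdsNE_zero
      simp only [Function.comp_apply, invS_zero]
      refine h.congr' ?_
      filter_upwards [self_mem_nhdsWithin] with w hw
      exact (invS_coe hw).symm
    · have h : ContinuousAt (fun w : ℂ => ((w⁻¹ : ℂ) : Sphere)) w :=
        OnePoint.continuous_coe.continuousAt.comp (continuousAt_inv₀ hw)
      refine h.congr ?_
      filter_upwards [isOpen_ne.mem_nhds hw] with u hu
      exact (invS_coe hu).symm

/-- The inversion `w ↦ 1 / w` as a homeomorphism of the sphere. -/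
def invHomeo : Sphere ≃ₜ Sphere where
  toFun := invS
  invFun := invS
  left_inv := invS_invS
  right_inv := invS_invS
  continuous_toFun := continuous_invS
  continuous_invFun := continuous_invS

/-- The chart `w` on the complement of `∞`. -/
def finChart : OpenPartialHomeomorph Sphere ℂ where
  toFun := toC
  invFun := fun w => (w : Sphere)
  source := {OnePoint.infty}ᶜ
  target := Set.univ
  map_source' := fun _ _ => Set.mem_univ _
  map_target' := fun w _ => OnePoint.coe_ne_infty w
  left_inv' := by
    intro p hp
    induction p using OnePoint.rec with
    | infty => exact absurd rfl hp
    | coe w => rfl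
  right_inv' := fun w _ => rfl
  open_source := isOpen_compl_singleton
  open_target := isOpen_univ
  continuousOn_toFun := by
    intro p hp
    induction p using OnePoint.rec with
    | infty => exact absurd rfl hp
    | coe w =>
      refine ContinuousAt.continuousWithinAt ?_
      rw [OnePoint.continuousAt_coe]
      exact continuousAt_id
  continuousOn_invFun := OnePoint.continuous_coe.continuousOn

/-- The chart `1 / w` on the complement of `0`. -/
def invChart : OpenPartialHomeomorph Sphere ℂ :=
  invHomeo.transOpenPartialHomeomorph finChart

lemma finChart_apply (p : Sphere) : finChart p = toC p := rfl

lemma finChart_symm_apply (w : ℂ) : finChart.symm w = (w : Sphere) := rfl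

lemma invChart_apply (p : Sphere) : invChart p = toC (invS p) := rfl

lemma invChart_symm_apply (w : ℂ) : invChart.symm w = invS (w : Sphere) := rfl

lemma finChart_source : finChart.source = {OnePoint.infty}ᶜ := rfl

lemma invChart_source : invChart.source = invS ⁻¹' {OnePoint.infty}ᶜ := rfl

open Classical in
/-- The standard complex structure of the Riemann sphere: the charts are `w` and `1 / w`. -/
instance : ChartedSpace ℂ Sphere where
  atlas := {finChart, invChart}
  chartAt p := if p = OnePoint.infty then invChart else finChart
  mem_chart_source p := by
    by_cases hp : p = OnePoint.infty
    · subst hp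
      simp [invChart, finChart, invHomeo]
    · simp [hp, finChart]
  chart_mem_atlas p := by
    by_cases hp : p = OnePoint.infty <;> simp [hp]

instance : IsManifold 𝓘(ℂ, ℂ) (⊤ : WithTop ℕ∞) Sphere := by
  refine isManifold_of_contDiffOn 𝓘(ℂ, ℂ) _ Sphere ?_
  have hid : ∀ s : Set ℂ, ContDiffOn ℂ (⊤ : WithTop ℕ∞) (fun w : ℂ => w) s :=
    fun s => contDiffOn_id
  have hinv : ∀ s : Set ℂ, (0 : ℂ) ∉ s →
      ContDiffOn ℂ (⊤ : WithTop ℕ∞) (fun w : ℂ => w⁻¹) s :=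
    fun s hs => contDiffOn_id.inv fun w hw h => hs (h ▸ hw)
  rintro e e' (rfl | rfl) (rfl | rfl)
  · refine (hid _).congr fun w hw => ?_
    simp [finChart_apply, finChart_symm_apply]
  · have h0 : (0 : ℂ) ∉ (𝓘(ℂ, ℂ)).symm ⁻¹' (finChart.symm.trans invChart).source ∩
        Set.range 𝓘(ℂ, ℂ) := by
      simp [finChart_symm_apply, invChart_source]
    refine (hinv _ h0).congr fun w hw => ?_
    have hw0 : w ≠ 0 := fun h => h0 (h ▸ hw)
    simp [finChart_symm_apply, invChart_apply, invS_coe hw0]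
  · have h0 : (0 : ℂ) ∉ (𝓘(ℂ, ℂ)).symm ⁻¹' (invChart.symm.trans finChart).source ∩
        Set.range 𝓘(ℂ, ℂ) := by
      simp [invChart_symm_apply, finChart_source]
    refine (hinv _ h0).congr fun w hw => ?_
    have hw0 : w ≠ 0 := fun h => h0 (h ▸ hw)
    simp [invChart_symm_apply, finChart_apply, invS_coe hw0]
  · refine (hid _).congr fun w hw => ?_
    simp [invChart_symm_apply, invChart_apply]

/-! ### Local coordinates in exponential form -/

/-- The power series `∑_{j ≥ 1} A_j x ^ (j + 1)`. -/
def vf (A : ℕ+ → ℂ) : PowerSeries ℂ :=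
  PowerSeries.X ^ 2 * PowerSeries.mk fun m => A m.succPNat

/-- The operator `∑_{j ≥ 1} A_j x ^ (j + 1) d/dx` on formal power series. -/
def vfOp (A : ℕ+ → ℂ) (f : PowerSeries ℂ) : PowerSeries ℂ :=
  vf A * PowerSeries.derivative ℂ f

lemma X_pow_dvd_vfOp_iterate (A : ℕ+ → ℂ) (f : PowerSeries ℂ) (n : ℕ) :
    (PowerSeries.X : PowerSeries ℂ) ^ n ∣ (vfOp A)^[n] f := by
  induction n with
  | zero => simp
  | succ n ih =>
    obtain ⟨g, hg⟩ := ih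
    rw [Function.iterate_succ_apply', hg, vfOp, vf]
    rcases n with _ | n
    · simp only [pow_zero, one_mul, zero_add, pow_one]
      exact Dvd.intro _ (by rw [pow_two, mul_assoc, mul_assoc])
    · rw [Derivation.leibniz, Derivation.leibniz_pow]
      refine ⟨(PowerSeries.mk fun m => A m.succPNat) *
        (PowerSeries.X * PowerSeries.derivative ℂ g +
          g * (((n + 1 : ℕ) : PowerSeries ℂ) * PowerSeries.derivative ℂ PowerSeries.X)), ?_⟩
      simp only [smul_eq_mul, nsmul_eq_mul, Nat.add_sub_cancel]
      ring

/-- The iterates of the operator raise the order, so that every coefficient of the exponential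
series is a finite sum. -/
lemma coeff_vfOp_iterate (A : ℕ+ → ℂ) (f : PowerSeries ℂ) {k n : ℕ} (h : k < n) :
    PowerSeries.coeff k ((vfOp A)^[n] f) = 0 :=
  PowerSeries.X_pow_dvd_iff.mp (X_pow_dvd_vfOp_iterate A f n) k h

/-- `exp (∑_{j ≥ 1} A_j x ^ (j + 1) d/dx) f`.  The terms with `n > k` of the exponential series do
not contribute to the `k`-th coefficient (see `coeff_vfOp_iterate`). -/
def expVf (A : ℕ+ → ℂ) (f : PowerSeries ℂ) : PowerSeries ℂ :=
  PowerSeries.mk fun k =>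
    ∑ n ∈ Finset.range (k + 1), PowerSeries.coeff k ((vfOp A)^[n] f) / (n.factorial : ℂ)

/-- `exp (∑_{j ≥ 1} A_j x ^ (j + 1) d/dx) a ^ (x d/dx) x`, where `a ^ (x d/dx)` is the
rescaling `f(x) ↦ f(a x)`. -/
def localSeries (a : ℂ) (A : ℕ+ → ℂ) : PowerSeries ℂ :=
  expVf A (PowerSeries.rescale a PowerSeries.X)

/-- The power series converges absolutely in a neighbourhood of `0`. -/
def AbsConv (f : PowerSeries ℂ) : Prop :=
  ∃ r : ℝ, 0 < r ∧ ∀ x : ℂ, ‖x‖ < r → Summable fun k : ℕ => ‖PowerSeries.coeff k f * x ^ k‖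

/-- The function defined by a power series near `0`. -/
def seriesFun (f : PowerSeries ℂ) (x : ℂ) : ℂ := ∑' k : ℕ, PowerSeries.coeff k f * x ^ k

/-- The set `H` of sequences `A` such that `exp (∑_{j ≥ 1} A_j x ^ (j + 1) d/dx) x` converges
absolutely in a neighbourhood of `0`. -/
def H : Type := {A : ℕ+ → ℂ // AbsConv (expVf A PowerSeries.X)}

lemma vf_single (k : ℕ+) (t : ℂ) :
    vf (Pi.single k t) = PowerSeries.C t * PowerSeries.X ^ ((k : ℕ) + 1) := by
  have h : (PowerSeries.mk fun m : ℕ => (Pi.single k t : ℕ+ → ℂ) m.succPNat) =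
      PowerSeries.C t * PowerSeries.X ^ ((k : ℕ) - 1) := by
    ext m
    have hk := k.pos
    have h1 : m.succPNat = k ↔ m = (k : ℕ) - 1 := by
      rw [← PNat.coe_inj, Nat.succPNat_coe]; omega
    by_cases hm : m = (k : ℕ) - 1
    · rw [PowerSeries.coeff_mk, h1.mpr hm, PowerSeries.coeff_C_mul, PowerSeries.coeff_X_pow]
      simp [hm]
    · rw [PowerSeries.coeff_mk, Pi.single_eq_of_ne (mt h1.mp hm), PowerSeries.coeff_C_mul,
        PowerSeries.coeff_X_pow]
      simp [hm]
  rw [vf, h, mul_left_comm, ← pow_add]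
  congr 2
  have := k.pos
  omega

lemma vfOp_single_iterate (k : ℕ+) (t : ℂ) (n : ℕ) :
    (vfOp (Pi.single k t))^[n] PowerSeries.X =
      PowerSeries.C (t ^ n * ∏ i ∈ Finset.range n, (1 + (i : ℂ) * (k : ℕ))) *
        PowerSeries.X ^ (n * (k : ℕ) + 1) := by
  induction n with
  | zero => simp
  | succ n ih =>
    rw [Function.iterate_succ_apply', ih, vfOp, vf_single, Derivation.leibniz,
      Derivation.leibniz_pow, Finset.prod_range_succ, pow_succ t n]
    have h0 : PowerSeries.derivative ℂ (PowerSeries.C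
        (t ^ n * ∏ i ∈ Finset.range n, (1 + (i : ℂ) * (k : ℕ)))) = 0 :=
      PowerSeries.derivative_C
    have h1 : PowerSeries.derivative ℂ (PowerSeries.X : PowerSeries ℂ) = 1 := by simp
    rw [h0, h1]
    have h2 : ((n * (k : ℕ) + 1 : ℕ) : PowerSeries ℂ) =
        PowerSeries.C (1 + (n : ℂ) * (k : ℕ)) := by
      push_cast [map_add, map_mul]
      simp [add_comm]
    generalize ∏ i ∈ Finset.range n, (1 + (i : ℂ) * (k : ℕ)) = P
    simp only [smul_eq_mul, nsmul_eq_mul, Nat.add_sub_cancel, mul_zero, add_zero, mul_one, h2,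
      map_mul]
    ring

lemma absConv_single (k : ℕ+) (t : ℂ) : AbsConv (expVf (Pi.single k t) PowerSeries.X) := by
  have hk : (1 : ℝ) ≤ (k : ℕ) := by exact_mod_cast k.pos
  set c : ℝ := (k : ℕ) * (‖t‖ + 1) with hc
  have hc1 : 1 ≤ c := by nlinarith [norm_nonneg t]
  have hterm : ∀ m n : ℕ, ‖PowerSeries.coeff m ((vfOp (Pi.single k t))^[n] PowerSeries.X) /
      (n.factorial : ℂ)‖ ≤ if m = n * (k : ℕ) + 1 then c ^ m else 0 := by
    intro m n
    rw [vfOp_single_iterate, PowerSeries.coeff_C_mul, PowerSeries.coeff_X_pow]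
    split_ifs with hm
    · have hprod : ‖∏ i ∈ Finset.range n, (1 + (i : ℂ) * (k : ℕ))‖ ≤
          (k : ℕ) ^ n * (n.factorial : ℝ) := by
        clear hm
        induction n with
        | zero => simp
        | succ n ih =>
          rw [Finset.prod_range_succ, norm_mul, pow_succ, Nat.factorial_succ]
          have h1 : ‖(1 + (n : ℂ) * (k : ℕ))‖ ≤ (k : ℕ) * ((n : ℝ) + 1) := by
            have h2 : (1 + (n : ℂ) * (k : ℕ)) = ((1 + n * (k : ℕ) : ℕ) : ℂ) := by push_cast; ring
            rw [h2, Complex.norm_natCast]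
            push_cast
            nlinarith
          calc _ ≤ ((k : ℕ) ^ n * (n.factorial : ℝ)) * ((k : ℕ) * ((n : ℝ) + 1)) := by gcongr
            _ = _ := by push_cast; ring
      have hfac : (0 : ℝ) < n.factorial := by exact_mod_cast n.factorial_pos
      rw [mul_one, norm_div, norm_mul, norm_pow, Complex.norm_natCast, div_le_iff₀ hfac]
      have h3 : ((k : ℕ) * ‖t‖) ^ n ≤ c ^ m := by
        calc ((k : ℕ) * ‖t‖) ^ n ≤ c ^ n := by
              gcongr
              rw [hc]
              gcongr
              linarith
          _ ≤ c ^ m := by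
              apply pow_le_pow_right₀ hc1
              have := k.pos
              rw [hm]
              nlinarith
      calc _ ≤ ‖t‖ ^ n * ((k : ℕ) ^ n * (n.factorial : ℝ)) := by gcongr
        _ = ((k : ℕ) * ‖t‖) ^ n * n.factorial := by rw [mul_pow]; ring
        _ ≤ c ^ m * n.factorial := by gcongr
    · simp
  have hcoeff : ∀ m : ℕ, ‖PowerSeries.coeff m (expVf (Pi.single k t) PowerSeries.X)‖ ≤ c ^ m := by
    intro m
    rw [expVf, PowerSeries.coeff_mk]
    refine (norm_sum_le _ _).trans ((Finset.sum_le_sum fun n _ => hterm m n).trans ?_)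
    by_cases h : ∃ n₀ : ℕ, m = n₀ * (k : ℕ) + 1
    · obtain ⟨n₀, hn₀⟩ := h
      have huniq : ∀ n : ℕ, (m = n * (k : ℕ) + 1) ↔ n = n₀ := by
        intro n
        constructor
        · intro h
          exact Nat.eq_of_mul_eq_mul_right k.pos (by omega)
        · rintro rfl
          exact hn₀
      simp only [huniq, Finset.sum_ite_eq']
      split_ifs
      · exact le_rfl
      · positivity
    · push Not at h
      simp only [h, if_false, Finset.sum_const_zero]
      positivity
  refine ⟨c⁻¹, by positivity, fun x hx => ?_⟩
  have hx1 : c * ‖x‖ < 1 := by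
    calc c * ‖x‖ < c * c⁻¹ := by gcongr
      _ = 1 := mul_inv_cancel₀ (by positivity)
  refine Summable.of_nonneg_of_le (fun m => norm_nonneg _) (fun m => ?_)
    (summable_geometric_of_lt_one (by positivity) hx1)
  rw [norm_mul, norm_pow, mul_pow]
  gcongr
  exact hcoeff m

/-- The sequence whose only possibly nonzero entry is `t`, in position `k`. -/
def H.single (k : ℕ+) (t : ℂ) : H := ⟨Pi.single k t, absConv_single k t⟩

/-- The zero sequence. -/
instance : Zero H := ⟨⟨0, by simpa using absConv_single 1 0⟩⟩

/-! ### Spheres with tubes and their sewing -/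

/-- A tube: a puncture of the sphere together with a local analytic coordinate chart that vanishes
there. -/
structure Tube where
  pt : Sphere
  nbhd : Set Sphere
  coord : Sphere → ℂ
  isOpen_nbhd : IsOpen nbhd
  pt_mem : pt ∈ nbhd
  injOn_coord : Set.InjOn coord nbhd
  holo_coord : MDifferentiableOn 𝓘(ℂ, ℂ) 𝓘(ℂ, ℂ) coord nbhd
  coord_pt : coord pt = 0

/-- The preimage of the closed disc of radius `r` under the local coordinate map. -/
def Tube.disc (t : Tube) (r : ℝ) : Set Sphere := {p | p ∈ t.nbhd ∧ ‖t.coord p‖ ≤ r}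

/-- A sphere with tubes.  The tubes at the negatively oriented (outgoing) punctures
`p_{-m}, …, p_{-1}` and those at the positively oriented (incoming) punctures `p_1, …, p_n` are
listed in this order; all punctures are distinct. -/
structure Worldsheet where
  out : List Tube
  inn : List Tube
  distinct : ((out ++ inn).map Tube.pt).Nodup

/-- `F` carries the tube `t` to the tube `t'`: it maps puncture to puncture and intertwines the
local coordinate maps in some neighbourhood of the puncture. -/
def TubeMap (F : Sphere → Sphere) (t t' : Tube) : Prop :=
  F t.pt = t'.pt ∧ ∀ᶠ p in 𝓝 t.pt, t'.coord (F p) = t.coord p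

/-- `R` is, up to conformal equivalence, the sewing of the `i`-th incoming tube `t` of `S` with the
`-j`-th outgoing tube `s` of `T`.  The sewn surface is obtained from `S` without the disc
`|t.coord| ≤ r₂` and `T` without the disc `|s.coord| ≤ 1 / r₁` by identifying `p` with `q`
whenever `|t.coord p| ≤ r₁`, `|s.coord q| ≤ 1 / r₂` and `s.coord q = 1 / t.coord p`.
An analytic isomorphism from it to the sphere is a pair of injective analytic maps `F`, `G`
on the two pieces which together are onto and which identify exactly these points. -/
def Worldsheet.IsSewing (i j : ℕ) (S T R : Worldsheet) : Prop :=
  ∃ (I₁ I₂ O₁ O₂ : List Tube) (t s : Tube),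
    S.inn = I₁ ++ t :: I₂ ∧ I₁.length + 1 = i ∧
    T.out = O₁ ++ s :: O₂ ∧ O₂.length + 1 = j ∧
    ∃ r₁ r₂ : ℝ, 0 < r₂ ∧ r₂ < r₁ ∧
      Metric.closedBall 0 r₁ ⊆ t.coord '' t.nbhd ∧
      Metric.closedBall 0 r₂⁻¹ ⊆ s.coord '' s.nbhd ∧
      (∀ x ∈ S.out ++ (I₁ ++ I₂), x.pt ∉ t.disc r₁) ∧
      (∀ x ∈ (O₁ ++ O₂) ++ T.inn, x.pt ∉ s.disc r₂⁻¹) ∧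
      ∃ F G : Sphere → Sphere,
        MDifferentiableOn 𝓘(ℂ, ℂ) 𝓘(ℂ, ℂ) F (t.disc r₂)ᶜ ∧
        MDifferentiableOn 𝓘(ℂ, ℂ) 𝓘(ℂ, ℂ) G (s.disc r₁⁻¹)ᶜ ∧
        Set.InjOn F (t.disc r₂)ᶜ ∧
        Set.InjOn G (s.disc r₁⁻¹)ᶜ ∧
        F '' (t.disc r₂)ᶜ ∪ G '' (s.disc r₁⁻¹)ᶜ = Set.univ ∧
        (∀ p ∈ (t.disc r₂)ᶜ, ∀ q ∈ (s.disc r₁⁻¹)ᶜ,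
          F p = G q ↔
            p ∈ t.disc r₁ ∧ q ∈ s.disc r₂⁻¹ ∧ s.coord q = (t.coord p)⁻¹) ∧
        List.Forall₂ (fun x t' => TubeMap x.1 x.2 t')
          (O₁.map (Prod.mk G) ++ S.out.map (Prod.mk F) ++ O₂.map (Prod.mk G)) R.out ∧
        List.Forall₂ (fun x t' => TubeMap x.1 x.2 t')
          (I₁.map (Prod.mk F) ++ T.inn.map (Prod.mk G) ++ I₂.map (Prod.mk F)) R.inn

/-! ### The moduli spaces `K*(n)` -/

/-- An element `(z_{-n}⁻¹, …, z_{-1}⁻¹; A^{(-n-1)}, (a^{(-n)}, A^{(-n)}), …, (a^{(-1)}, A^{(-1)}),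
(a^{(1)}, A^{(1)}))` of `K*(n + 1)`; the fields `z` and `out` list the data of the outgoing
punctures other than `∞` in this order. -/
structure KStarSucc (n : ℕ) where
  z : Fin n → ℂˣ
  z_injective : Function.Injective z
  outInfty : H
  out : Fin n → ℂˣ × H
  inn : ℂˣ × H

/-- The moduli space `K*(n)` of spheres with `n` outgoing tubes and one incoming tube. -/
def KStarSpace : ℕ → Type
  | 0 => {A : H // A.1 1 = 0}
  | n + 1 => KStarSucc n

/-- The data `(z, a, A)` of the outgoing punctures `1 / z`, in order.  The first puncture is
`∞ = 1 / 0` and has `a = 1`. -/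
def KStarSpace.outData : {n : ℕ} → KStarSpace n → List (ℂ × ℂ × H)
  | 0, _ => []
  | _ + 1, (Q : KStarSucc _) =>
      (0, 1, Q.outInfty) :: List.ofFn fun i => ((Q.z i : ℂ), ((Q.out i).1 : ℂ), (Q.out i).2)

/-- The data `(a, A)` of the incoming puncture `0`. -/
def KStarSpace.inData : {n : ℕ} → KStarSpace n → ℂ × H
  | 0, (A : {A : H // A.1 1 = 0}) => (1, A.1)
  | _ + 1, (Q : KStarSucc _) => ((Q.inn.1 : ℂ), Q.inn.2)

/-- The tube is centred at `1 / z` and its local coordinate map is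
`exp (-∑ A_j x ^ (-j + 1) d/dx) a ^ (-x d/dx) (1 / x)` at `x = (1 / w - z)⁻¹`.  In the variable
`y = 1 / x` one has `-x ^ (-j + 1) d/dx = y ^ (j + 1) d/dy` and `-x d/dx = y d/dy`. -/
def Tube.IsOut (t : Tube) (c : ℂ × ℂ × H) : Prop :=
  t.pt = invS (c.1 : Sphere) ∧
    ∀ᶠ p in 𝓝 t.pt, t.coord p = seriesFun (localSeries c.2.1 c.2.2.1) (toC (invS p) - c.1)

/-- The tube is centred at `0` and its local coordinate map is
`exp (∑ A_j w ^ (j + 1) d/dw) a ^ (w d/dw) w`. -/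
def Tube.IsIn (t : Tube) (c : ℂ × H) : Prop :=
  t.pt = ((0 : ℂ) : Sphere) ∧
    ∀ᶠ p in 𝓝 t.pt, t.coord p = seriesFun (localSeries c.1 c.2.1) (toC p)

/-- `S` is a canonical representative of the class `Q`.  Only the germs of the local coordinate
maps are prescribed, so the coordinate neighbourhoods may be as large as the maps extend. -/
def KStarSpace.Represents {n : ℕ} (Q : KStarSpace n) (S : Worldsheet) : Prop :=
  List.Forall₂ Tube.IsOut S.out Q.outData ∧ List.Forall₂ Tube.IsIn S.inn [Q.inData]

/-- The first incoming tube of `Q₁` can be sewn with the `-j`-th outgoing tube of `Q₂`, and the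
result is `Q₃`. -/
def KStarSpace.IsSewing {l m n : ℕ} (j : ℕ) (Q₁ : KStarSpace l) (Q₂ : KStarSpace m) (Q₃ : KStarSpace n) : Prop :=
  ∃ S T R : Worldsheet, Q₁.Represents S ∧ Q₂.Represents T ∧ Q₃.Represents R ∧
    Worldsheet.IsSewing 1 j S T R

/-- The element `(A, (a, B))` of `K*(1)`. -/
def KStarSpace.mk₁ (A : H) (a : ℂˣ) (B : H) : KStarSpace 1 :=
  (⟨Fin.elim0, fun i => i.elim0, A, Fin.elim0, (a, B)⟩ : KStarSucc 0)

instance : Nonempty (KStarSpace 1) := ⟨KStarSpace.mk₁ 0 1 0⟩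

/-- The partial operation `Q₁ ₁∞_{-j} Q₂` (an arbitrary element if the sewing does not exist). -/
def KStarSpace.sew {l m n : ℕ} [Nonempty (KStarSpace n)] (j : ℕ) (Q₁ : KStarSpace l) (Q₂ : KStarSpace m) : KStarSpace n :=
  Classical.epsilon fun Q₃ => KStarSpace.IsSewing j Q₁ Q₂ Q₃

/-- The element `((1, (0, -ε, 0, 0, …)))` of `K*(0)`. -/
def omegaElt (ε : ℂ) : KStarSpace 0 :=
  (⟨H.single 2 (-ε), Pi.single_eq_of_ne (by decide : (1 : ℕ+) ≠ 2) (-ε)⟩ : {A : H // A.1 1 = 0})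

/-- The element `(z⁻¹; 0, (1, 0), (1, 0))` of `K*(2)`. -/
def pantsElt (z : ℂˣ) : KStarSpace 2 :=
  (⟨fun _ => z, fun _ _ _ => Subsingleton.elim _ _, 0, fun _ => (1, 0), (1, 0)⟩ : KStarSucc 1)

/-! ### Meromorphic functions on `K*(1)`, tangent vectors and the functional -/

/-- Meromorphic functions on `K*(1)`: polynomials in `A_j^{(-1)}`, `a_0^{(1)}` and `A_j^{(1)}`
divided by a power of `a_0^{(1)}`. -/
def IsMero (F : KStarSpace 1 → ℂ) : Prop :=
  ∃ (P : MvPolynomial (ℕ+ ⊕ Unit ⊕ ℕ+) ℂ) (r : ℕ), ∀ (A : H) (a : ℂˣ) (B : H),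
    F (KStarSpace.mk₁ A a B) =
      MvPolynomial.eval (Sum.elim A.1 (Sum.elim (fun _ => (a : ℂ)) B.1)) P / (a : ℂ) ^ r

/-- `∂F / ∂A_k^{(-1)}` at the identity element `(0, (1, 0))`. -/
def dOut (k : ℕ+) (F : KStarSpace 1 → ℂ) : ℂ :=
  deriv (fun t : ℂ => F (KStarSpace.mk₁ (H.single k t) 1 0)) 0

open Classical in
/-- A nonzero complex number as a unit (with the dummy value `1` at `0`). -/
def toUnit (a : ℂ) : ℂˣ := if h : a = 0 then 1 else Units.mk0 a h

/-- `∂F / ∂α_0^{(1)}` at the identity element `(0, (1, 0))`. -/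
def dScale (F : KStarSpace 1 → ℂ) : ℂ :=
  deriv (fun a : ℂ => F (KStarSpace.mk₁ 0 (toUnit a) 0)) 1

/-- `∂F / ∂A_k^{(1)}` at the identity element `(0, (1, 0))`. -/
def dIn (k : ℕ+) (F : KStarSpace 1 → ℂ) : ℂ :=
  deriv (fun t : ℂ => F (KStarSpace.mk₁ 0 1 (H.single k t))) 0

/-- The linear functional
`L_I(z) F = d/dε F(((1, (0, -ε, 0, …))) ₁∞_{-1} (z⁻¹; 0, (1, 0), (1, 0)))` at `ε = 0`. -/
def LI (z : ℂˣ) (F : KStarSpace 1 → ℂ) : ℂ :=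
  deriv (fun ε : ℂ => F (KStarSpace.sew 1 (omegaElt ε) (pantsElt z))) 0

end VOC

end

open VOC

noncomputable section

namespace VOC
open PowerSeries Filter

/-! ### The formal exponential -/

/-! The sewing is computed exactly, and the result is then differentiated.

Use the coordinate 1/w throughout: u on the sphere with one tube, y on the sphere with three. The
vector field -ε w³ d/dw integrates to the coordinate w/√(1 + 2εw²) (`seriesFun_single_two`), which
is 1/W with W² = u² + 2ε and W ~ u at infinity. The coordinate at 1/z is y - z, so sewing identifies
y with z + W(u). Representatives prescribe only germs of coordinates. By the identity theorem the
germs already determine the discs cut out and the coordinates on them (`disc_of_coord_inv_sub`,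
`disc_of_coord_sqrt`).

Now let a sewing onto a normalised sphere be given. In the coordinate 1/w of the target, the map of
the first piece is a function of u, and through the gluing it continues to an entire function N. It
satisfies N(u)/u → a, because the coordinate at the incoming puncture has derivative a. It vanishes
at the point u₀ with W(u₀) = -z, which corresponds to the outgoing puncture y = 0. By Liouville,
N(u) = a(u - u₀). Derivative 1 of the coordinate at ∞ forces u₀ = -za, and u₀² = z² - 2ε then gives
a = √(1 - 2ε/z²). This determines both remaining coordinates (`KStarSpace.IsSewing.coordinates`):
h(Y) = z + W(Y/a - za) at ∞ and k(w) = 1/(z + W(1/(aw) - za)) at 0. Uniqueness follows, since the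
exponential series determines its sequence (`expVf_X_injective`). Existence for small ε follows by
using the same formulas as definitions (`exists_isSewing`).

Squaring removes the root. The series f = h and f = k/a satisfy f² - 2zf = x²/a² - 2zx and x² -
2zax²f = f² - 2za²xf² respectively, in which ε enters only through a. At ε = 0 both series are x and
a' = -z⁻². Differentiating coefficientwise gives f' = -z⁻²x²/(z - x) and f' = -z⁻¹x²/(1 - zx), which
are geometric series. Since exp(∑ A_j x^(j+1) d/dx) x = x + ∑ A_j x^(j+1) to first order in A, the
coefficient of x^(k+1) in f' is the derivative of A_k (`hasDerivAt_of_isSewing`). The chain rule for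
a polynomial in finitely many coordinates divided by a power of a finishes the proof
(`IsMero.exists_hasDerivAt`). -/

lemma X_pow_dvd_derivative {n : ℕ} {f : PowerSeries ℂ} (h : (X : PowerSeries ℂ) ^ (n + 1) ∣ f) :
    (X : PowerSeries ℂ) ^ n ∣ derivative ℂ f := by
  obtain ⟨g, rfl⟩ := h
  rw [Derivation.leibniz, Derivation.leibniz_pow]
  refine ⟨X * derivative ℂ g + g * ((n + 1 : ℕ) : PowerSeries ℂ), ?_⟩
  have h1 : derivative ℂ (X : PowerSeries ℂ) = 1 := by simp
  simp only [smul_eq_mul, nsmul_eq_mul, Nat.add_sub_cancel, h1]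
  ring

lemma X_pow_succ_dvd_vfOp_iterate_X (A : ℕ+ → ℂ) (n : ℕ) :
    (X : PowerSeries ℂ) ^ (n + 1) ∣ (vfOp A)^[n] X := by
  induction n with
  | zero => simp
  | succ n ih =>
    rw [Function.iterate_succ_apply', vfOp, vf]
    obtain ⟨g, hg⟩ := X_pow_dvd_derivative ih
    rw [hg]
    exact ⟨(PowerSeries.mk fun m => A m.succPNat) * g, by ring⟩

lemma coeff_vf_succ (A : ℕ+ → ℂ) (k : ℕ+) : coeff ((k : ℕ) + 1) (vf A) = A k := by
  obtain ⟨m, rfl⟩ : ∃ m : ℕ, k = m.succPNat := ⟨k.natPred, (PNat.succPNat_natPred k).symm⟩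
  rw [vf, Nat.succPNat_coe, Nat.succ_eq_add_one, add_assoc, coeff_X_pow_mul, coeff_mk]

lemma X_pow_dvd_vf_sub {A A' : ℕ+ → ℂ} {k : ℕ+} (h : ∀ j < k, A j = A' j) :
    (X : PowerSeries ℂ) ^ ((k : ℕ) + 1) ∣ vf A - vf A' := by
  rw [X_pow_dvd_iff]
  intro m hm
  rw [vf, vf, ← mul_sub, coeff_X_pow_mul']
  split_ifs with h2
  · have : ((m - 2).succPNat) < k := by
      rw [← PNat.coe_lt_coe, Nat.succPNat_coe]; omega
    simp [h _ this]
  · rfl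

/-- With v = `vf A` and v' = `vf A'`, split v·p' - v'·q' as (v - v')·p' + v'·(p' - q'). In the first
term v - v' has order k + 1, and p' has positive order once p is a proper iterate. In the second,
the factor v' has order 2 while differentiation costs only one. Hence from the second iterate on,
A_k does not reach the coefficient of x^(k+1). -/
lemma X_pow_dvd_vfOp_iterate_sub {A A' : ℕ+ → ℂ} {k : ℕ+} (h : ∀ j < k, A j = A' j) (n : ℕ) :
    (X : PowerSeries ℂ) ^ ((k : ℕ) + 1) ∣ (vfOp A)^[n + 1] X - (vfOp A')^[n + 1] X ∧
    (X : PowerSeries ℂ) ^ ((k : ℕ) + 2) ∣ (vfOp A)^[n + 2] X - (vfOp A')^[n + 2] X := by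
  have step : ∀ n, (X : PowerSeries ℂ) ^ ((k : ℕ) + 1) ∣
      (vfOp A)^[n + 1] X - (vfOp A')^[n + 1] X →
      (X : PowerSeries ℂ) ^ ((k : ℕ) + 2) ∣
      (vfOp A)^[n + 2] X - (vfOp A')^[n + 2] X := by
    intro n hn
    rw [Function.iterate_succ_apply' _ (n + 1), Function.iterate_succ_apply' _ (n + 1)]
    obtain ⟨d, hd⟩ := X_pow_dvd_vf_sub h
    obtain ⟨e, he⟩ := X_pow_dvd_derivative hn
    obtain ⟨g, hg⟩ := X_pow_dvd_derivative (X_pow_succ_dvd_vfOp_iterate_X A (n + 1))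
    rw [map_sub] at he
    have : vfOp A ((vfOp A)^[n + 1] X) - vfOp A' ((vfOp A')^[n + 1] X) =
        (vf A - vf A') * derivative ℂ ((vfOp A)^[n + 1] X) + vf A' *
          (derivative ℂ ((vfOp A)^[n + 1] X) - derivative ℂ ((vfOp A')^[n + 1] X)) := by
      rw [vfOp, vfOp]; ring
    rw [this, he, hd, hg, vf]
    refine ⟨X ^ n * d * g + (PowerSeries.mk fun m => A' m.succPNat) * e, by ring⟩
  have one : ∀ n, (X : PowerSeries ℂ) ^ ((k : ℕ) + 1) ∣
      (vfOp A)^[n + 1] X - (vfOp A')^[n + 1] X := by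
    intro n
    induction n with
    | zero => simpa [vfOp] using X_pow_dvd_vf_sub h
    | succ n ih => exact (pow_dvd_pow _ (by omega)).trans (step n ih)
  exact ⟨one n, step n (one n)⟩

/-- The coefficient of `x ^ (k + 1)` in `exp (∑ A_j x ^ (j + 1) d/dx) x` is `A_k` plus an
expression in the `A_j` with `j < k`. -/
lemma coeff_expVf_sub {A A' : ℕ+ → ℂ} {k : ℕ+} (h : ∀ j < k, A j = A' j) :
    coeff ((k : ℕ) + 1) (expVf A X) - coeff ((k : ℕ) + 1) (expVf A' X) = A k - A' k := by
  rw [expVf, expVf, coeff_mk, coeff_mk, ← Finset.sum_sub_distrib, Finset.sum_range_succ',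
    Finset.sum_range_succ']
  have h0 : ∀ n ∈ Finset.range (k : ℕ),
      coeff ((k : ℕ) + 1) ((vfOp A)^[n + 1 + 1] X) / ((n + 1 + 1).factorial : ℂ) -
      coeff ((k : ℕ) + 1) ((vfOp A')^[n + 1 + 1] X) / ((n + 1 + 1).factorial : ℂ) = 0 := by
    intro n _
    rw [← sub_div, ← map_sub,
      X_pow_dvd_iff.mp (X_pow_dvd_vfOp_iterate_sub h n).2 _ (Nat.lt_succ_self _), zero_div]
  rw [Finset.sum_eq_zero h0]
  simp [vfOp, coeff_vf_succ]

lemma expVf_X_injective {A A' : ℕ+ → ℂ} (h : expVf A X = expVf A' X) : A = A' := by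
  funext k
  induction k using PNat.strongInductionOn with
  | _ k ih =>
    have := coeff_expVf_sub (k := k) ih
    rw [h, sub_self] at this
    exact (sub_eq_zero.mp this.symm)

lemma coeff_zero_expVf_X (A : ℕ+ → ℂ) : coeff 0 (expVf A X) = 0 := by
  simp [expVf]

lemma coeff_one_expVf_X (A : ℕ+ → ℂ) : coeff 1 (expVf A X) = 1 := by
  have : coeff 1 (vfOp A X) = 0 :=
    X_pow_dvd_iff.mp (X_pow_succ_dvd_vfOp_iterate_X A 1) _ (by norm_num)
  simp [expVf, Finset.sum_range_succ, this]

/-- The sequence `A` with `exp (∑ A_j x ^ (j + 1) d/dx) x = f`. -/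
def logSeq (f : PowerSeries ℂ) (k : ℕ+) : ℂ :=
  coeff ((k : ℕ) + 1) f - coeff ((k : ℕ) + 1)
    (expVf (fun j => if _ : j < k then logSeq f j else 0) X)
termination_by k

lemma logSeq_eq (f : PowerSeries ℂ) (k : ℕ+) :
    logSeq f k = coeff ((k : ℕ) + 1) f - coeff ((k : ℕ) + 1)
      (expVf (fun j => if j < k then logSeq f j else 0) X) := by
  rw [logSeq]
  simp

/-- By triangularity the series of `logSeq f` and of its truncation below k differ in degree k + 1
by exactly the k-th entry, which the recursion chose to be the missing amount. -/
lemma expVf_logSeq {f : PowerSeries ℂ} (h0 : coeff 0 f = 0) (h1 : coeff 1 f = 1) :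
    expVf (logSeq f) X = f := by
  ext n
  rcases n with _ | _ | n
  · rw [coeff_zero_expVf_X, h0]
  · rw [coeff_one_expVf_X, h1]
  · have h := coeff_expVf_sub (A := logSeq f)
      (A' := fun j => if j < n.succPNat then logSeq f j else 0) (k := n.succPNat)
      (fun j hj => by simp [hj])
    have h2 := logSeq_eq f n.succPNat
    rw [if_neg (lt_irrefl _), sub_zero] at h
    rw [Nat.succPNat_coe] at h h2
    have := h.trans h2
    linear_combination this

lemma vfOp_C_mul (A : ℕ+ → ℂ) (a : ℂ) (f : PowerSeries ℂ) :
    vfOp A (C a * f) = C a * vfOp A f := by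
  have : derivative ℂ (C a) = 0 := derivative_C
  rw [vfOp, vfOp, Derivation.leibniz, this]
  simp only [smul_eq_mul, mul_zero, add_zero]
  ring

lemma vfOp_iterate_C_mul (A : ℕ+ → ℂ) (a : ℂ) (f : PowerSeries ℂ) (n : ℕ) :
    (vfOp A)^[n] (C a * f) = C a * (vfOp A)^[n] f := by
  induction n with
  | zero => rfl
  | succ n ih => rw [Function.iterate_succ_apply', ih, vfOp_C_mul, Function.iterate_succ_apply']

/-- The operator commutes with constants, so a is merely a factor in front. This separates the
determination of a from that of A. -/
lemma localSeries_eq (a : ℂ) (A : ℕ+ → ℂ) : localSeries a A = C a * expVf A X := by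
  have : rescale a X = C a * X := by
    ext n
    rw [coeff_rescale, coeff_C_mul, coeff_X]
    split_ifs with h <;> simp [h]
  ext n
  rw [localSeries, this, expVf, expVf, coeff_mk, coeff_C_mul, coeff_mk, Finset.mul_sum]
  refine Finset.sum_congr rfl fun m _ => ?_
  rw [vfOp_iterate_C_mul, coeff_C_mul, mul_div_assoc]

/-! ### Coefficientwise derivatives of families of power series -/

/-- The coefficients of the family `f` of power series have the coefficients of `f'` as their
derivatives at the parameter `x`. -/
def HasCoeffDerivAt (f : ℂ → PowerSeries ℂ) (f' : PowerSeries ℂ) (x : ℂ) : Prop :=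
  ∀ n, HasDerivAt (fun t => coeff n (f t)) (coeff n f') x

lemma HasCoeffDerivAt.mul {f g : ℂ → PowerSeries ℂ} {f' g' : PowerSeries ℂ} {x : ℂ}
    (hf : HasCoeffDerivAt f f' x) (hg : HasCoeffDerivAt g g' x) :
    HasCoeffDerivAt (fun t => f t * g t) (f' * g x + f x * g') x := by
  intro n
  simp only [coeff_mul, map_add, ← Finset.sum_add_distrib]
  exact HasDerivAt.fun_sum fun p _ => (hf p.1).mul (hg p.2)

lemma HasCoeffDerivAt.derivative {f : ℂ → PowerSeries ℂ} {f' : PowerSeries ℂ} {x : ℂ}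
    (hf : HasCoeffDerivAt f f' x) :
    HasCoeffDerivAt (fun t => PowerSeries.derivative ℂ (f t)) (PowerSeries.derivative ℂ f') x := by
  intro n
  simp only [PowerSeries.coeff_derivative]
  exact (hf (n + 1)).mul_const _

lemma hasCoeffDerivAt_const (f : PowerSeries ℂ) (x : ℂ) :
    HasCoeffDerivAt (fun _ => f) 0 x := fun n => by
  simpa using hasDerivAt_const x (coeff n f)

lemma HasCoeffDerivAt.unique {f : ℂ → PowerSeries ℂ} {f' f'' : PowerSeries ℂ} {x : ℂ}
    (h : HasCoeffDerivAt f f' x) (h' : HasCoeffDerivAt f f'' x) : f' = f'' := by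
  ext n
  exact (h n).unique (h' n)

lemma HasCoeffDerivAt.vf {A : ℂ → ℕ+ → ℂ} {A' : ℕ+ → ℂ} {x : ℂ}
    (hA : ∀ k, HasDerivAt (fun t => A t k) (A' k) x) :
    HasCoeffDerivAt (fun t => vf (A t)) (VOC.vf A') x := by
  intro n
  simp only [VOC.vf, coeff_X_pow_mul', coeff_mk]
  split_ifs
  · exact hA _
  · exact hasDerivAt_const _ _

lemma exists_hasCoeffDerivAt_vfOp_iterate {A : ℂ → ℕ+ → ℂ} {A' : ℕ+ → ℂ} {x : ℂ}
    (hA : ∀ k, HasDerivAt (fun t => A t k) (A' k) x) (n : ℕ) :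
    ∃ g, HasCoeffDerivAt (fun t => (vfOp (A t))^[n] X) g x := by
  induction n with
  | zero => exact ⟨0, hasCoeffDerivAt_const _ _⟩
  | succ n ih =>
    obtain ⟨g, hg⟩ := ih
    simp only [Function.iterate_succ_apply', vfOp]
    exact ⟨_, (HasCoeffDerivAt.vf hA).mul hg.derivative⟩

lemma exists_hasCoeffDerivAt_expVf {A : ℂ → ℕ+ → ℂ} {A' : ℕ+ → ℂ} {x : ℂ}
    (hA : ∀ k, HasDerivAt (fun t => A t k) (A' k) x) :
    ∃ g, HasCoeffDerivAt (fun t => expVf (A t) X) g x := by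
  choose g hg using exists_hasCoeffDerivAt_vfOp_iterate hA
  refine ⟨PowerSeries.mk fun k => ∑ n ∈ Finset.range (k + 1), coeff k (g n) / (n.factorial : ℂ),
    fun k => ?_⟩
  simp only [expVf, coeff_mk]
  exact HasDerivAt.fun_sum fun n _ => (hg n k).div_const _

lemma vfOp_zero (f : PowerSeries ℂ) : vfOp 0 f = 0 := by
  have : vf 0 = 0 := by
    ext n; simp [vf, coeff_X_pow_mul']
  rw [vfOp, this, zero_mul]

/-- At A = 0 the operator is zero, so second and higher iterates have vanishing derivative and only
the term linear in A survives. -/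
lemma HasCoeffDerivAt.expVf {A : ℂ → ℕ+ → ℂ} {A' : ℕ+ → ℂ} {x : ℂ} (h0 : A x = 0)
    (hA : ∀ k, HasDerivAt (fun t => A t k) (A' k) x) :
    HasCoeffDerivAt (fun t => expVf (A t) X) (VOC.vf A') x := by
  have hn : ∀ n, HasCoeffDerivAt (fun t => (vfOp (A t))^[n + 2] X) 0 x := by
    intro n
    obtain ⟨g, hg⟩ := exists_hasCoeffDerivAt_vfOp_iterate hA (n + 1)
    have := (HasCoeffDerivAt.vf hA).mul hg.derivative
    have e0 : VOC.vf (0 : ℕ+ → ℂ) = 0 := by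
      ext n; simp [VOC.vf, coeff_X_pow_mul']
    simp only [h0, Function.iterate_succ_apply' _ n, vfOp_zero, e0, map_zero, mul_zero, zero_mul,
      add_zero] at this
    simpa only [Function.iterate_succ_apply', vfOp] using this
  have h1 : HasCoeffDerivAt (fun t => (vfOp (A t))^[1] X) (VOC.vf A') x := by
    have := (HasCoeffDerivAt.vf hA).mul (hasCoeffDerivAt_const X x).derivative
    simpa [vfOp] using this
  intro k
  simp only [VOC.expVf, coeff_mk]
  rcases k with _ | k
  · simpa [VOC.vf] using hasDerivAt_const x (0 : ℂ)
  · simp only [Finset.sum_range_succ' _ (k + 1), Finset.sum_range_succ' _ k]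
    have := ((HasDerivAt.fun_sum (u := Finset.range k) fun n _ =>
      ((hn n (k + 1)).div_const (((n + 1 + 1).factorial : ℕ) : ℂ))).fun_add
      ((h1 (k + 1)).div_const (((0 + 1).factorial : ℕ) : ℂ))).fun_add
      (((hasCoeffDerivAt_const X x) (k + 1)).div_const (((0).factorial : ℕ) : ℂ))
    simpa using this

/-- If `exp (∑ A_j(t) x ^ (j + 1) d/dx) x` is differentiable in `t` and `A = 0` at the parameter
value in question, then `A` is differentiable there, and its derivative is read off from that of
the series. -/
lemma HasCoeffDerivAt.hasDerivAt_of_expVf {A : ℂ → ℕ+ → ℂ} {f' : PowerSeries ℂ} {x : ℂ}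
    (h0 : A x = 0) (hf : HasCoeffDerivAt (fun t => VOC.expVf (A t) X) f' x) (k : ℕ+) :
    HasDerivAt (fun t => A t k) (coeff ((k : ℕ) + 1) f') x := by
  have hd : ∀ k, DifferentiableAt ℂ (fun t => A t k) x := by
    intro k
    induction k using PNat.strongInductionOn with
    | _ k ih =>
      -- Truncate A below k. By induction the truncation is differentiable, hence so is its
      -- exponential, and A_k is the difference of the two coefficients in degree k + 1.
      have hA : ∀ j, HasDerivAt (fun t => (fun t j => if j < k then A t j else 0 : ℂ → ℕ+ → ℂ) t j)
          (deriv (fun t => if j < k then A t j else 0) x) x := by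
        intro j
        by_cases hj : j < k
        · simpa [hj] using (ih j hj).hasDerivAt
        · simpa [hj] using hasDerivAt_const x (0 : ℂ)
      obtain ⟨g, hg⟩ := exists_hasCoeffDerivAt_expVf hA
      have := (hf ((k : ℕ) + 1)).sub (hg ((k : ℕ) + 1))
      refine this.differentiableAt.congr_of_eventuallyEq (Filter.Eventually.of_forall fun t => ?_)
      have := coeff_expVf_sub (A := A t) (A' := fun j => if j < k then A t j else 0) (k := k)
        (fun j hj => by simp [hj])
      simp only [lt_irrefl, if_false, sub_zero] at this
      exact this.symm
  have := (HasCoeffDerivAt.expVf h0 fun k => (hd k).hasDerivAt).unique hf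
  rw [← this, coeff_vf_succ]
  exact (hd k).hasDerivAt

/-! ### Perturbing the roots of quadratic equations over the power series. -/

lemma HasCoeffDerivAt.sub {f g : ℂ → PowerSeries ℂ} {f' g' : PowerSeries ℂ} {x : ℂ}
    (hf : HasCoeffDerivAt f f' x) (hg : HasCoeffDerivAt g g' x) :
    HasCoeffDerivAt (fun t => f t - g t) (f' - g') x := by
  intro n
  simp only [map_sub]
  exact (hf n).fun_sub (hg n)

lemma hasCoeffDerivAt_C {c : ℂ → ℂ} {c' x : ℂ} (hc : HasDerivAt c c' x) :
    HasCoeffDerivAt (fun t => C (c t)) (C c') x := by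
  intro n
  simp only [coeff_C]
  split_ifs
  · exact hc
  · exact hasDerivAt_const _ _

lemma HasCoeffDerivAt.congr {f g : ℂ → PowerSeries ℂ} {f' : PowerSeries ℂ} {x : ℂ}
    (hf : HasCoeffDerivAt f f' x) (h : ∀ᶠ t in 𝓝 x, g t = f t) : HasCoeffDerivAt g f' x :=
  fun n => (hf n).congr_of_eventuallyEq (h.mono fun t ht => by simp only [ht])

lemma hasCoeffDerivAt_of_differentiableAt {f : ℂ → PowerSeries ℂ} {x : ℂ}
    (hf : ∀ n, DifferentiableAt ℂ (fun t => coeff n (f t)) x) :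
    HasCoeffDerivAt f (PowerSeries.mk fun n => deriv (fun t => coeff n (f t)) x) x := by
  intro n
  rw [coeff_mk]
  exact (hf n).hasDerivAt

/-- As r starts in degree 2, a product contributing to degree m ≤ n + 1 of r² has both indices at
most m - 2 < n. This makes the recursions for quadratic roots well founded. -/
lemma differentiableAt_coeff_sq {r : ℂ → PowerSeries ℂ} {x : ℂ}
    (h0 : ∀ᶠ t in 𝓝 x, coeff 0 (r t) = 0 ∧ coeff 1 (r t) = 0) {n : ℕ}
    (h : ∀ i < n, DifferentiableAt ℂ (fun t => coeff i (r t)) x) {m : ℕ} (hm : m ≤ n + 1) :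
    DifferentiableAt ℂ (fun t => coeff m (r t * r t)) x := by
  simp only [coeff_mul]
  refine DifferentiableAt.fun_sum fun p hp => ?_
  rw [Finset.HasAntidiagonal.mem_antidiagonal] at hp
  rcases p with ⟨i, j⟩
  by_cases hij : 2 ≤ i ∧ 2 ≤ j
  · exact (h i (by simp at hp; omega)).mul (h j (by simp at hp; omega))
  · refine (differentiableAt_const (0 : ℂ)).congr_of_eventuallyEq (h0.mono fun t ht => ?_)
    have : i = 0 ∨ i = 1 ∨ j = 0 ∨ j = 1 := by omega
    rcases this with rfl | rfl | rfl | rfl <;> simp [ht.1, ht.2]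

lemma differentiableAt_coeff_mul_X {r : ℂ → PowerSeries ℂ} {x : ℂ} {n : ℕ}
    (h : ∀ i < n, DifferentiableAt ℂ (fun t => coeff i (r t)) x) {m : ℕ} (hm : m ≤ n) :
    DifferentiableAt ℂ (fun t => coeff m (X * r t)) x := by
  rcases m with _ | m
  · simp
  · simp only [coeff_succ_X_mul]
    exact h m (by omega)

/-- Derivative of the root `f = x + …` of `f² - 2 z f = τ x² - 2 z x` with respect to a parameter
on which `τ` depends. -/
lemma hasCoeffDerivAt_of_quadratic_out {z : ℂ} (hz : z ≠ 0) {f : ℂ → PowerSeries ℂ} {τ : ℂ → ℂ}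
    {τ' x : ℂ} (hτ : HasDerivAt τ τ' x) (hfx : f x = X)
    (h01 : ∀ᶠ t in 𝓝 x, coeff 0 (f t) = 0 ∧ coeff 1 (f t) = 1)
    (heq : ∀ᶠ t in 𝓝 x, f t * f t - C (2 * z) * f t = C (τ t) * X ^ 2 - C (2 * z) * X) (k : ℕ+) :
    ∃ f', HasCoeffDerivAt f f' x ∧ coeff ((k : ℕ) + 1) f' = -(τ' / 2) * z⁻¹ ^ (k : ℕ) := by
  have hr0 : ∀ᶠ t in 𝓝 x, coeff 0 (f t - X) = 0 ∧ coeff 1 (f t - X) = 0 :=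
    h01.mono fun t ht => by simp_all
  have hd : ∀ n, DifferentiableAt ℂ (fun t => coeff n (f t - X)) x := by
    intro n
    induction n using Nat.strong_induction_on with
    | _ n ih =>
      -- The quadratic equation, solved for the coefficient of r = f - x coming from the linear term
      -- 2zr. Only lower coefficients of r occur on the right.
      have key : ∀ᶠ t in 𝓝 x, coeff n (f t - X) = (2 * z)⁻¹ * (coeff n (X ^ 2 : PowerSeries ℂ) +
          2 * coeff n (X * (f t - X)) + coeff n ((f t - X) * (f t - X)) -
          τ t * coeff n (X ^ 2 : PowerSeries ℂ)) := by
        filter_upwards [heq] with t ht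
        have h2 : C (2 * z) * (f t - X) = X ^ 2 + C 2 * (X * (f t - X)) +
            (f t - X) * (f t - X) - C (τ t) * X ^ 2 := by
          have : (C 2 : PowerSeries ℂ) = 2 := map_ofNat C 2
          rw [this]
          linear_combination -ht
        have := congrArg (coeff n) h2
        simp only [map_add, map_sub, coeff_C_mul] at this
        rw [map_sub]
        field_simp
        linear_combination this
      refine DifferentiableAt.congr_of_eventuallyEq ?_ key
      have a1 := differentiableAt_coeff_mul_X ih le_rfl
      have a2 := differentiableAt_coeff_sq hr0 ih (Nat.le_succ n)
      have a3 := hτ.differentiableAt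
      fun_prop
  have hd' : ∀ n, DifferentiableAt ℂ (fun t => coeff n (f t)) x := fun n =>
    ((hd n).add_const (coeff n (X : PowerSeries ℂ))).congr_of_eventuallyEq
      (Filter.Eventually.of_forall fun t => by simp)
  have hf := hasCoeffDerivAt_of_differentiableAt hd'
  set f' := PowerSeries.mk fun n => deriv (fun t => coeff n (f t)) x
  refine ⟨f', hf, ?_⟩
  have e1 := (((hf.mul hf).sub ((hasCoeffDerivAt_const (C (2 * z)) x).mul hf)).congr
    (g := fun t => C (τ t) * X ^ 2 - C (2 * z) * X) (heq.mono fun t ht => ht.symm)).unique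
    (((hasCoeffDerivAt_C hτ).mul (hasCoeffDerivAt_const (X ^ 2) x)).sub
      (hasCoeffDerivAt_const (C (2 * z) * X) x))
  rw [hfx] at e1
  have c1 : coeff 1 f' = 0 := by
    refine (hf 1).unique ((hasDerivAt_const x (1 : ℂ)).congr_of_eventuallyEq ?_)
    exact h01.mono fun t ht => ht.2
  -- The differentiated equation at f = x, that is (z - x) f' = -(τ'/2) x². Its coefficients form a
  -- geometric progression of ratio 1/z.
  have e2 : C (2 * z) * f' = X * (f' + f') - C τ' * X ^ 2 := by
    linear_combination -e1
  have e3 : ∀ n, 2 * z * coeff (n + 1) f' = 2 * coeff n f' - τ' * coeff (n + 1) (X ^ 2 : PowerSeries ℂ) := by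
    intro n
    have := congrArg (coeff (n + 1)) e2
    rw [map_sub, coeff_C_mul, coeff_C_mul, coeff_succ_X_mul, map_add] at this
    rw [this]; ring
  have main : ∀ m : ℕ, coeff (m + 2) f' = -(τ' / 2) * z⁻¹ ^ (m + 1) := by
    intro m
    induction m with
    | zero =>
      have := e3 1
      rw [c1] at this
      simp [coeff_X_pow] at this
      rw [zero_add, zero_add, pow_one]
      field_simp
      linear_combination this
    | succ m ih =>
      have := e3 (m + 2)
      rw [ih, coeff_X_pow, if_neg (by omega)] at this
      rw [show m + 1 + 2 = m + 2 + 1 by ring, pow_succ z⁻¹ (m + 1)]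
      have h2 : coeff (m + 2 + 1) f' = z⁻¹ * (z * coeff (m + 2 + 1) f') := by
        field_simp
      rw [h2]
      linear_combination z⁻¹ / 2 * this
  have := main ((k : ℕ) - 1)
  have hk := k.pos
  rwa [show (k : ℕ) - 1 + 2 = (k : ℕ) + 1 by omega, show (k : ℕ) - 1 + 1 = k by omega] at this

/-- Derivative of the root `f = x + …` of `x² - 2 z σ x² f = f² (1 - 2 z σ² x)` with respect to a
parameter on which `σ` depends. -/
lemma hasCoeffDerivAt_of_quadratic_in {z : ℂ} {f : ℂ → PowerSeries ℂ} {σ : ℂ → ℂ}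
    {σ' x : ℂ} (hσ : HasDerivAt σ σ' x) (hσx : σ x = 1) (hfx : f x = X)
    (h01 : ∀ᶠ t in 𝓝 x, coeff 0 (f t) = 0 ∧ coeff 1 (f t) = 1)
    (heq : ∀ᶠ t in 𝓝 x, X ^ 2 - C (2 * z * σ t) * (X ^ 2 * f t) =
      f t * f t - C (2 * z * σ t ^ 2) * (X * (f t * f t))) (k : ℕ+) :
    ∃ f', HasCoeffDerivAt f f' x ∧ coeff ((k : ℕ) + 1) f' = σ' * z ^ (k : ℕ) := by
  have hr0 : ∀ᶠ t in 𝓝 x, coeff 0 (f t - X) = 0 ∧ coeff 1 (f t - X) = 0 :=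
    h01.mono fun t ht => by simp_all
  have two : (C 2 : PowerSeries ℂ) = 2 := map_ofNat C 2
  have hd : ∀ n, DifferentiableAt ℂ (fun t => coeff n (f t - X)) x := by
    intro n
    induction n using Nat.strong_induction_on with
    | _ n ih =>
      -- Here the leading linear term is 2x(f - x), so the equation is read in degree n + 1 to
      -- isolate the coefficient n. The square is therefore needed in degree n + 1 as well.
      have key : ∀ᶠ t in 𝓝 x, coeff n (f t - X) = 2⁻¹ * (
          - 2 * z * σ t * (coeff n (X ^ 2 : PowerSeries ℂ) + coeff n (X * (f t - X)))
          - coeff (n + 1) ((f t - X) * (f t - X))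
          + 2 * z * σ t ^ 2 * (coeff n (X ^ 2 : PowerSeries ℂ) + 2 * coeff n (X * (f t - X))
            + coeff n ((f t - X) * (f t - X)))) := by
        filter_upwards [heq] with t ht
        have h2 : C 2 * (X * (f t - X)) = -(C (2 * z * σ t) * (X * (X ^ 2 + X * (f t - X))))
            - (f t - X) * (f t - X) + C (2 * z * σ t ^ 2) * (X * (X ^ 2 + C 2 * (X * (f t - X))
            + (f t - X) * (f t - X))) := by
          rw [two]
          linear_combination -ht
        have := congrArg (coeff (n + 1)) h2
        simp only [map_add, map_sub, map_neg, coeff_C_mul, coeff_succ_X_mul] at this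
        rw [map_sub]
        linear_combination 2⁻¹ * this
      refine DifferentiableAt.congr_of_eventuallyEq ?_ key
      have a1 := differentiableAt_coeff_mul_X ih le_rfl
      have a2 := differentiableAt_coeff_sq hr0 ih (Nat.le_succ n)
      have a4 := differentiableAt_coeff_sq hr0 ih le_rfl
      have a3 := hσ.differentiableAt
      fun_prop
  have hd' : ∀ n, DifferentiableAt ℂ (fun t => coeff n (f t)) x := fun n =>
    ((hd n).add_const (coeff n (X : PowerSeries ℂ))).congr_of_eventuallyEq
      (Filter.Eventually.of_forall fun t => by simp)
  have hf := hasCoeffDerivAt_of_differentiableAt hd'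
  set f' := PowerSeries.mk fun n => deriv (fun t => coeff n (f t)) x
  refine ⟨f', hf, ?_⟩
  have hs1 := hasCoeffDerivAt_C (hσ.const_mul (2 * z))
  have hs2 := hasCoeffDerivAt_C ((hσ.fun_pow 2).const_mul (2 * z))
  have e1 := (((hasCoeffDerivAt_const (X ^ 2) x).sub
      (hs1.mul ((hasCoeffDerivAt_const (X ^ 2) x).mul hf)))).unique
    (((hf.mul hf).sub (hs2.mul ((hasCoeffDerivAt_const X x).mul (hf.mul hf)))).congr heq)
  rw [hfx, hσx] at e1
  have c1 : coeff 1 f' = 0 := by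
    refine (hf 1).unique ((hasDerivAt_const x (1 : ℂ)).congr_of_eventuallyEq ?_)
    exact h01.mono fun t ht => ht.2
  have c0 : coeff 0 f' = 0 := by
    refine (hf 0).unique ((hasDerivAt_const x (0 : ℂ)).congr_of_eventuallyEq ?_)
    exact h01.mono fun t ht => ht.1
  -- The differentiated equation at f = x and σ = 1. After cancelling 2x it reads (1 - zx) f' =
  -- zσ'x², a progression of ratio z.
  have e2 : X * (C 2 * f') = X * (C (2 * z) * (X * f') + C (2 * z * σ') * X ^ 2) := by
    simp only [Nat.cast_ofNat, one_pow, mul_one, map_mul, two] at e1 ⊢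
    linear_combination -e1
  have e3 : ∀ n, coeff (n + 1) f' = z * coeff n f' + z * σ' * coeff (n + 1) (X ^ 2 : PowerSeries ℂ) := by
    intro n
    have := congrArg (coeff (n + 1)) (mul_left_cancel₀ X_ne_zero e2)
    rw [map_add, coeff_C_mul, coeff_C_mul, coeff_C_mul, coeff_succ_X_mul] at this
    linear_combination 2⁻¹ * this
  have main : ∀ m : ℕ, coeff (m + 2) f' = σ' * z ^ (m + 1) := by
    intro m
    induction m with
    | zero =>
      rw [e3, c1, coeff_X_pow, if_pos rfl]
      ring
    | succ m ih =>
      rw [show m + 1 + 2 = m + 2 + 1 by ring, e3, ih, coeff_X_pow, if_neg (by omega)]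
      ring
  have := main ((k : ℕ) - 1)
  have hk := k.pos
  rwa [show (k : ℕ) - 1 + 2 = (k : ℕ) + 1 by omega, show (k : ℕ) - 1 + 1 = k by omega] at this

/-! ### Germs of analytic functions and power series -/

/-- The power series `f` converges to the function `g` near `0`. -/
def IsSeries (f : PowerSeries ℂ) (g : ℂ → ℂ) : Prop :=
  ∀ᶠ x in 𝓝 (0 : ℂ), HasSum (fun n => coeff n f * x ^ n) (g x)

lemma IsSeries.hasFPowerSeriesAt {f : PowerSeries ℂ} {g : ℂ → ℂ} (h : IsSeries f g) :
    HasFPowerSeriesAt g (FormalMultilinearSeries.ofScalars ℂ fun n => coeff n f) 0 := by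
  rw [hasFPowerSeriesAt_iff]
  refine h.mono fun x hx => ?_
  simpa [FormalMultilinearSeries.coeff_ofScalars, mul_comm] using hx

lemma IsSeries.congr {f : PowerSeries ℂ} {g g' : ℂ → ℂ} (h : IsSeries f g)
    (hg : ∀ᶠ x in 𝓝 (0 : ℂ), g' x = g x) : IsSeries f g' := by
  filter_upwards [h, hg] with x hx hx'
  rwa [hx']

lemma IsSeries.unique {f f' : PowerSeries ℂ} {g : ℂ → ℂ} (h : IsSeries f g)
    (h' : IsSeries f' g) : f = f' := by
  have := h.hasFPowerSeriesAt.eq_formalMultilinearSeries h'.hasFPowerSeriesAt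
  ext n
  have := congrArg (fun p => FormalMultilinearSeries.coeff p n) this
  simpa [FormalMultilinearSeries.coeff_ofScalars] using this

lemma AbsConv.isSeries {f : PowerSeries ℂ} (h : AbsConv f) : IsSeries f (seriesFun f) := by
  obtain ⟨r, hr, h⟩ := h
  filter_upwards [Metric.ball_mem_nhds (0 : ℂ) hr] with x hx
  exact (h x (by simpa using hx)).of_norm.hasSum

lemma IsSeries.eq_seriesFun {f : PowerSeries ℂ} {g : ℂ → ℂ} (h : IsSeries f g) :
    ∀ᶠ x in 𝓝 (0 : ℂ), seriesFun f x = g x :=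
  h.mono fun _ hx => hx.tsum_eq

lemma IsSeries.absConv {f : PowerSeries ℂ} {g : ℂ → ℂ} (h : IsSeries f g) : AbsConv f := by
  obtain ⟨r, hr, h⟩ := Metric.eventually_nhds_iff.mp h
  exact ⟨r, hr, fun x hx => (h (by simpa using hx)).summable.norm⟩

lemma _root_.AnalyticAt.exists_isSeries {g : ℂ → ℂ} (h : AnalyticAt ℂ g 0) :
    ∃ f, IsSeries f g := by
  obtain ⟨p, hp⟩ := h
  rw [hasFPowerSeriesAt_iff] at hp
  refine ⟨PowerSeries.mk fun n => p.coeff n, hp.mono fun x hx => ?_⟩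
  simpa [mul_comm] using hx

lemma IsSeries.mul {f f' : PowerSeries ℂ} {g g' : ℂ → ℂ} (h : IsSeries f g)
    (h' : IsSeries f' g') : IsSeries (f * f') (fun x => g x * g' x) := by
  filter_upwards [h, h'] with x hx hx'
  have e : ∀ n, coeff n (f * f') * x ^ n = ∑ p ∈ Finset.HasAntidiagonal.antidiagonal n,
      (coeff p.1 f * x ^ p.1) * (coeff p.2 f' * x ^ p.2) := by
    intro n
    rw [coeff_mul, Finset.sum_mul]
    refine Finset.sum_congr rfl fun p hp => ?_
    rw [← Finset.HasAntidiagonal.mem_antidiagonal.mp hp, pow_add]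
    ring
  simp only [e]
  have hs := summable_norm_sum_mul_antidiagonal_of_summable_norm hx.summable.norm
    hx'.summable.norm
  have := tsum_mul_tsum_eq_tsum_sum_antidiagonal_of_summable_norm hx.summable.norm
    hx'.summable.norm
  rw [hx.tsum_eq, hx'.tsum_eq] at this
  rw [this]
  exact hs.of_norm.hasSum

lemma IsSeries.sub {f f' : PowerSeries ℂ} {g g' : ℂ → ℂ} (h : IsSeries f g)
    (h' : IsSeries f' g') : IsSeries (f - f') (fun x => g x - g' x) := by
  filter_upwards [h, h'] with x hx hx'
  simp only [map_sub, sub_mul]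
  exact hx.sub hx'

lemma isSeries_C (c : ℂ) : IsSeries (C c) (fun _ => c) := by
  refine Eventually.of_forall fun x => ?_
  convert hasSum_single (f := fun n => coeff n (C c) * x ^ n) 0 ?_ using 1
  · simp
  · intro n hn
    simp [coeff_C, hn]

lemma isSeries_X : IsSeries X (fun x => x) := by
  refine Eventually.of_forall fun x => ?_
  convert hasSum_single (f := fun n => coeff n (X : PowerSeries ℂ) * x ^ n) 1 ?_ using 1
  · simp
  · intro n hn
    simp [coeff_X, hn]

lemma IsSeries.coeff_zero {f : PowerSeries ℂ} {g : ℂ → ℂ} (h : IsSeries f g) :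
    coeff 0 f = g 0 := by
  have := h.self_of_nhds
  have h2 := hasSum_single (f := fun n => coeff n f * (0 : ℂ) ^ n) 0 (fun n hn => by simp [hn])
  simpa using h2.unique this

lemma IsSeries.hasDerivAt {f : PowerSeries ℂ} {g : ℂ → ℂ} (h : IsSeries f g) :
    HasDerivAt g (coeff 1 f) 0 := by
  have := h.hasFPowerSeriesAt.hasDerivAt
  have e : (FormalMultilinearSeries.ofScalars ℂ (fun n => coeff n f) 1 fun _ => (1 : ℂ)) =
      coeff 1 f := FormalMultilinearSeries.coeff_ofScalars
  rwa [e] at this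

/-! ### The principal square root -/

lemma sqrt_mul_self (x : ℂ) : Complex.sqrt x * Complex.sqrt x = x := by
  rw [← pow_two, Complex.sqrt]
  exact Complex.cpow_ofNat_inv_pow x 2

lemma re_sqrt_pos {x : ℂ} (hx : x ∈ Complex.slitPlane) : 0 < (Complex.sqrt x).re := by
  have hx0 : x ≠ 0 := Complex.slitPlane_ne_zero hx
  rw [Complex.sqrt, Complex.cpow_def_of_ne_zero hx0, Complex.exp_re]
  refine mul_pos (Real.exp_pos _) (Real.cos_pos_of_mem_Ioo ?_)
  have h1 := Complex.neg_pi_lt_arg x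
  have h2 := lt_of_le_of_ne (Complex.arg_le_pi x) (Complex.mem_slitPlane_iff_arg.mp hx).1
  have : (Complex.log x * 2⁻¹).im = x.arg / 2 := by
    rw [show (2⁻¹ : ℂ) = ((2⁻¹ : ℝ) : ℂ) by push_cast; rfl, Complex.im_mul_ofReal,
      Complex.log_im]
    rfl
  rw [this]
  constructor <;> linarith

lemma sqrt_ne_zero {x : ℂ} (hx : x ≠ 0) : Complex.sqrt x ≠ 0 := fun h => by
  have := sqrt_mul_self x
  rw [h, zero_mul] at this
  exact hx this.symm

lemma analyticAt_sqrt {x : ℂ} (hx : x ∈ Complex.slitPlane) : AnalyticAt ℂ Complex.sqrt x := by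
  unfold Complex.sqrt
  exact analyticAt_id.cpow analyticAt_const hx

/-- The only other root is the negative of the principal one, whose real part is positive on the
slit plane. -/
lemma sqrt_eq_of_mul_self {x c : ℂ} (hx : x ∈ Complex.slitPlane) (h : c * c = x)
    (hc : 0 < c.re) : Complex.sqrt x = c := by
  have h1 := sqrt_mul_self x
  have : (Complex.sqrt x - c) * (Complex.sqrt x + c) = 0 := by
    linear_combination h1 - h
  rcases mul_eq_zero.mp this with h2 | h2
  · exact sub_eq_zero.mp h2
  · have h3 := re_sqrt_pos hx
    have := congrArg Complex.re h2
    simp at this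
    linarith

lemma one_sub_mem_slitPlane {x : ℂ} (hx : ‖x‖ < 1) : 1 - x ∈ Complex.slitPlane := by
  have := Complex.mem_slitPlane_of_norm_lt_one (z := -x) (by simpa using hx)
  rwa [← sub_eq_add_neg] at this

lemma inv_mem_slitPlane {x : ℂ} (hx : x ∈ Complex.slitPlane) : x⁻¹ ∈ Complex.slitPlane := by
  have h := Complex.normSq_pos.mpr (Complex.slitPlane_ne_zero hx)
  rw [Complex.mem_slitPlane_iff] at hx ⊢
  rw [Complex.inv_re, Complex.inv_im]
  exact hx.imp (fun h' => div_pos h' h) fun h' => div_ne_zero (neg_ne_zero.mpr h') h.ne'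

lemma sqrt_inv {x : ℂ} (hx : x ∈ Complex.slitPlane) :
    Complex.sqrt x⁻¹ = (Complex.sqrt x)⁻¹ := by
  refine sqrt_eq_of_mul_self (inv_mem_slitPlane hx) ?_ ?_
  · rw [← mul_inv, sqrt_mul_self]
  · rw [Complex.inv_re]
    exact div_pos (re_sqrt_pos hx) (Complex.normSq_pos.mpr (sqrt_ne_zero (Complex.slitPlane_ne_zero hx)))

lemma hasDerivAt_sqrt_one : HasDerivAt Complex.sqrt (1 / 2 : ℂ) 1 := by
  have h := (analyticAt_sqrt Complex.one_mem_slitPlane).differentiableAt.hasDerivAt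
  have h2 := h.mul h
  have h3 : (Complex.sqrt * Complex.sqrt) = id := funext sqrt_mul_self
  rw [h3] at h2
  have := h2.unique (hasDerivAt_id 1)
  rw [Complex.sqrt_one] at this
  rwa [show (1 / 2 : ℂ) = deriv Complex.sqrt 1 by linear_combination -(1 / 2) * this]

/-! ### The coordinate of the sphere with one tube -/

lemma coeff_expVf_single_two_odd (t : ℂ) (n : ℕ) :
    coeff (2 * n + 1) (expVf (Pi.single 2 t) X) =
      t ^ n * (∏ i ∈ Finset.range n, (1 + (i : ℂ) * 2)) / (n.factorial : ℂ) := by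
  rw [expVf, coeff_mk, Finset.sum_eq_single n]
  · rw [vfOp_single_iterate, coeff_C_mul, coeff_X_pow]
    simp [mul_comm]
  · intro m _ hm
    rw [vfOp_single_iterate, coeff_C_mul, coeff_X_pow, if_neg]
    · simp
    · simp only [PNat.val_ofNat]; omega
  · intro h
    exact absurd (Finset.mem_range.mpr (by omega)) h

lemma coeff_expVf_single_two_even (t : ℂ) (n : ℕ) :
    coeff (2 * n) (expVf (Pi.single 2 t) X) = 0 := by
  rw [expVf, coeff_mk]
  refine Finset.sum_eq_zero fun m _ => ?_
  rw [vfOp_single_iterate, coeff_C_mul, coeff_X_pow, if_neg]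
  · simp
  · simp only [PNat.val_ofNat]; omega

/-- Coefficientwise this is the recursion (n + 1) c_(n+1) = t(2n + 1) c_n for the odd coefficients;
the even ones vanish. -/
lemma X_mul_derivative_expVf_single_two (t : ℂ) :
    X * derivative ℂ (expVf (Pi.single 2 t) X) * (1 - C (2 * t) * X ^ 2) =
      expVf (Pi.single 2 t) X := by
  set f := expVf (Pi.single 2 t) X with hf
  have e1 : X * derivative ℂ f * (1 - C (2 * t) * X ^ 2) =
      X * derivative ℂ f - C (2 * t) * (X ^ 2 * (X * derivative ℂ f)) := by ring
  have e2 : ∀ m, coeff m (X * derivative ℂ f) = m * coeff m f := by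
    intro m
    rcases m with _ | m
    · simp
    · rw [coeff_succ_X_mul, PowerSeries.coeff_derivative]; push_cast; ring
  ext m
  rw [e1, map_sub, coeff_C_mul, coeff_X_pow_mul', e2]
  obtain ⟨n, rfl | rfl⟩ := m.even_or_odd'
  · split_ifs with h
    · rw [e2, show 2 * n - 2 = 2 * (n - 1) by omega, hf, coeff_expVf_single_two_even,
        coeff_expVf_single_two_even]
      simp
    · rw [hf, coeff_expVf_single_two_even]
      simp
  · rcases n with _ | n
    · simp
    · rw [if_pos (by omega), e2, show 2 * (n + 1) + 1 - 2 = 2 * n + 1 by omega, hf,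
        coeff_expVf_single_two_odd, coeff_expVf_single_two_odd, Finset.prod_range_succ,
        Nat.factorial_succ]
      have : (n.factorial : ℂ) ≠ 0 := by exact_mod_cast n.factorial_ne_zero
      have : (n + 1 : ℂ) ≠ 0 := by exact_mod_cast n.succ_ne_zero
      push_cast
      field_simp
      ring

/-- The differential equation for f gives x g' = 2g for g = f²(1 - 2tx²). Hence g is a multiple of
x², and f = x + … fixes the multiple. -/
lemma expVf_single_two_sq (t : ℂ) :
    expVf (Pi.single 2 t) X * expVf (Pi.single 2 t) X * (1 - C (2 * t) * X ^ 2) = X ^ 2 := by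
  have h := X_mul_derivative_expVf_single_two t
  have c0 := coeff_zero_expVf_X (Pi.single 2 t)
  have c1 := coeff_one_expVf_X (Pi.single 2 t)
  set f := expVf (Pi.single 2 t) X
  set g := f * f * (1 - C (2 * t) * X ^ 2) with hg
  have hC : derivative ℂ (C (2 * t)) = 0 := derivative_C
  have hX : derivative ℂ (X : PowerSeries ℂ) = 1 := by simp
  have hd : X * derivative ℂ g = 2 * g := by
    have h2 : derivative ℂ (1 - C (2 * t) * X ^ 2) = -(C (2 * t) * (2 * X)) := by
      rw [map_sub, Derivation.leibniz, Derivation.leibniz_pow, hC, hX, Derivation.map_one_eq_zero]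
      simp
    rw [hg, Derivation.leibniz, Derivation.leibniz, h2]
    simp only [smul_eq_mul]
    linear_combination 2 * f * h
  have hn : ∀ n : ℕ, (n : ℂ) * coeff n g = 2 * coeff n g := by
    intro n
    have := congrArg (coeff n) hd
    have h2 : (2 : PowerSeries ℂ) = C 2 := (map_ofNat C 2).symm
    rw [h2, coeff_C_mul] at this
    rw [← this]
    rcases n with _ | n
    · simp
    · rw [coeff_succ_X_mul, PowerSeries.coeff_derivative]; push_cast; ring
  ext n
  rw [coeff_X_pow]
  split_ifs with h2
  · obtain ⟨r, hr⟩ : X ∣ f := X_dvd_iff.mpr (by simpa using c0)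
    have hr0 : coeff 0 r = 1 := by
      rw [hr] at c1
      simpa [coeff_succ_X_mul] using (coeff_succ_X_mul 0 r).symm.trans c1
    have : g = X ^ 2 * (r * r * (1 - C (2 * t) * X ^ 2)) := by rw [hg, hr]; ring
    rw [h2, this, coeff_X_pow_mul']
    simp at hr0
    simp [hr0]
  · have h3 : ((n : ℂ) - 2) * coeff n g = 0 := by linear_combination hn n
    rcases mul_eq_zero.mp h3 with h4 | h4
    · exact absurd (by exact_mod_cast sub_eq_zero.mp h4) h2
    · exact h4

lemma localSeries_one (A : ℕ+ → ℂ) : localSeries 1 A = expVf A X := by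
  rw [localSeries_eq, map_one, one_mul]

/-- The closed form of the coordinate `exp (-ε x ^ 3 d/dx) x`. -/
lemma seriesFun_single_two (ε : ℂ) : ∀ᶠ w in 𝓝 (0 : ℂ),
    seriesFun (localSeries 1 (H.single 2 (-ε)).1) w = w / Complex.sqrt (1 + 2 * ε * w ^ 2) := by
  have hH : (H.single 2 (-ε)).1 = Pi.single 2 (-ε) := rfl
  rw [localSeries_one, hH]
  have hs := (absConv_single 2 (-ε)).isSeries
  set f := expVf (Pi.single 2 (-ε)) X with hf
  have hcont : ContinuousAt (fun w : ℂ => 1 + 2 * ε * w ^ 2) 0 := by fun_prop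
  have hslit : ∀ᶠ w in 𝓝 (0 : ℂ), 1 + 2 * ε * w ^ 2 ∈ Complex.slitPlane :=
    hcont.eventually_mem (Complex.isOpen_slitPlane.mem_nhds (by simp))
  have hsq : ∀ᶠ w in 𝓝 (0 : ℂ),
      seriesFun f w * seriesFun f w * (1 - 2 * -ε * (w * w)) = w * w := by
    have h1 := (hs.mul hs).mul ((isSeries_C 1).sub ((isSeries_C (2 * -ε)).mul
      (isSeries_X.mul isSeries_X)))
    have h2 : f * f * (C 1 - C (2 * -ε) * (X * X)) = X * X := by
      rw [map_one, ← pow_two (X : PowerSeries ℂ), expVf_single_two_sq]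
    rw [h2] at h1
    filter_upwards [h1.eq_seriesFun, (isSeries_X.mul isSeries_X).eq_seriesFun] with w hw hw'
    rw [← hw, hw']
  have h0 : seriesFun f 0 = 0 := by
    rw [← hs.coeff_zero, hf, coeff_zero_expVf_X]
  have hder : HasDerivAt (seriesFun f) 1 0 := by
    have := hs.hasDerivAt
    rwa [hf, coeff_one_expVf_X] at this
  -- The square identity gives f(w)/w · √(1 + 2εw²) = ±1. The limit 1 at w = 0 makes the real part
  -- positive nearby and so selects the sign.
  have hlim : Tendsto (fun w => (seriesFun f w / w) * Complex.sqrt (1 + 2 * ε * w ^ 2))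
      (𝓝[≠] 0) (𝓝 (1 * 1)) := by
    refine Tendsto.mul ?_ ?_
    · have := hasDerivAt_iff_tendsto_slope.mp hder
      refine this.congr fun w => ?_
      rw [slope_def_field, h0, sub_zero, sub_zero]
    · have hc : ContinuousAt (fun w : ℂ => Complex.sqrt (1 + 2 * ε * w ^ 2)) 0 :=
        ContinuousAt.comp (f := fun w : ℂ => 1 + 2 * ε * w ^ 2)
          (analyticAt_sqrt (by simp)).continuousAt hcont
      have := hc.tendsto
      simp only [ne_eq, OfNat.ofNat_ne_zero, not_false_eq_true, zero_pow, mul_zero, add_zero,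
        Complex.sqrt_one] at this
      exact this.mono_left nhdsWithin_le_nhds
  have hre : ∀ᶠ w in 𝓝[≠] (0 : ℂ),
      0 < ((seriesFun f w / w) * Complex.sqrt (1 + 2 * ε * w ^ 2)).re := by
    have : ContinuousAt Complex.re (1 * 1) := Complex.continuous_re.continuousAt
    exact (this.tendsto.comp hlim).eventually_const_lt (by simp)
  rw [eventually_nhdsWithin_iff] at hre
  filter_upwards [hre, hsq, hslit] with w h1 h2 h3
  by_cases hw : w = 0
  · subst hw
    rw [h0]; simp
  · have h4 := h1 hw
    have h5 := sqrt_mul_self (1 + 2 * ε * w ^ 2)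
    have hsn := sqrt_ne_zero (Complex.slitPlane_ne_zero h3)
    set s := Complex.sqrt (1 + 2 * ε * w ^ 2)
    have h6 : (seriesFun f w / w * s - 1) * (seriesFun f w / w * s + 1) = 0 := by
      field_simp
      linear_combination h2 + seriesFun f w ^ 2 * h5
    rcases mul_eq_zero.mp h6 with h7 | h7
    · rw [eq_div_iff hsn]
      have := sub_eq_zero.mp h7
      field_simp at this
      exact this
    · rw [eq_neg_of_add_eq_zero_left h7] at h4
      simp at h4
      linarith

/-! ### Inverses of injective holomorphic functions -/

/-- An injective holomorphic function is nowhere locally constant, hence open, so its inverse is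
continuous. The inverse is differentiable wherever f' ≠ 0, and the remaining points are isolated,
hence removable. The nonvanishing of f' is not needed. -/
lemma exists_holomorphic_inverse {f : ℂ → ℂ} {U : Set ℂ} (hU : IsOpen U)
    (hf : DifferentiableOn ℂ f U) (hinj : Set.InjOn f U) :
    IsOpen (f '' U) ∧ ∃ g : ℂ → ℂ, ∀ x ∈ U, g (f x) = x ∧ DifferentiableAt ℂ g (f x) := by
  have han := hf.analyticOnNhd hU
  have hno : ∀ x ∈ U, ∀ c : ℂ, ¬ ∀ᶠ y in 𝓝 x, f y = c := by
    intro x hx c h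
    have h1 : ∀ᶠ y in 𝓝[≠] x, f y = c ∧ y ∈ U :=
      (h.and (hU.mem_nhds hx)).filter_mono nhdsWithin_le_nhds
    obtain ⟨y, ⟨hy, hyU⟩, hne⟩ := (h1.and self_mem_nhdsWithin).exists
    exact hne (hinj hyU hx (hy.trans h.self_of_nhds.symm))
  have hmap : ∀ x ∈ U, 𝓝 (f x) ≤ map f (𝓝 x) := fun x hx =>
    ((han x hx).eventually_constant_or_nhds_le_map_nhds).resolve_left (hno x hx _)
  have himg : ∀ x ∈ U, ∀ V ∈ 𝓝 x, f '' (V ∩ U) ∈ 𝓝 (f x) := fun x hx V hV =>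
    hmap x hx (image_mem_map (inter_mem hV (hU.mem_nhds hx)))
  refine ⟨?_, Function.invFunOn f U, ?_⟩
  · rw [isOpen_iff_mem_nhds]
    rintro _ ⟨x, hx, rfl⟩
    simpa using himg x hx Set.univ univ_mem
  · set g := Function.invFunOn f U
    have hg : ∀ x ∈ U, g (f x) = x := fun x hx => hinj.leftInvOn_invFunOn hx
    have hcont : ∀ x ∈ U, ContinuousAt g (f x) := by
      intro x hx
      rw [ContinuousAt, hg x hx]
      intro V hV
      refine mem_map.mpr (mem_of_superset (himg x hx V hV) ?_)
      rintro _ ⟨y, ⟨hy, hyU⟩, rfl⟩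
      rw [Set.mem_preimage, hg y hyU]
      exact hy
    have hright : ∀ x ∈ U, ∀ᶠ y in 𝓝 (f x), f (g y) = y ∧ g y ∈ U := by
      intro x hx
      refine mem_of_superset (himg x hx Set.univ univ_mem) ?_
      rintro _ ⟨y, ⟨-, hyU⟩, rfl⟩
      exact ⟨by rw [hg y hyU], by rwa [hg y hyU]⟩
    have hd : ∀ x ∈ U, deriv f x ≠ 0 → DifferentiableAt ℂ g (f x) := by
      intro x hx h
      refine (HasDerivAt.of_local_left_inverse (f := f) (f' := deriv f x) (hcont x hx) ?_ h
        ((hright x hx).mono fun y hy => hy.1)).differentiableAt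
      rw [hg x hx]
      exact (han x hx).differentiableAt.hasDerivAt
    intro x hx
    refine ⟨hg x hx, ?_⟩
    refine (Complex.analyticAt_of_differentiable_on_punctured_nhds_of_continuousAt ?_
      (hcont x hx)).differentiableAt
    -- If f' vanished near x, then f would be constant on a ball, contradicting injectivity.
    have hne : ∀ᶠ y in 𝓝[≠] x, deriv f y ≠ 0 := by
      refine ((han x hx).deriv.eventually_eq_zero_or_eventually_ne_zero).resolve_left fun h => ?_
      obtain ⟨r, hr, hb⟩ := Metric.eventually_nhds_iff_ball.mp (h.and (hU.mem_nhds hx))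
      refine hno x hx (f x) ?_
      filter_upwards [Metric.ball_mem_nhds x hr] with y hy
      exact (convex_ball x r).is_const_of_fderivWithin_eq_zero (𝕜 := ℂ)
        (fun w hw => (han w (hb w hw).2).differentiableAt.differentiableWithinAt)
        (fun w hw => by
          rw [fderivWithin_of_isOpen Metric.isOpen_ball hw]
          ext
          simpa using (hb w hw).1) hy (Metric.mem_ball_self hr)
    have htend : Tendsto g (𝓝[≠] (f x)) (𝓝[≠] x) := by
      refine tendsto_nhdsWithin_iff.mpr ⟨?_, ?_⟩
      · have := (hcont x hx).tendsto
        rw [hg x hx] at this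
        exact this.mono_left nhdsWithin_le_nhds
      · filter_upwards [(hright x hx).filter_mono nhdsWithin_le_nhds, self_mem_nhdsWithin]
          with y hy hyne h
        exact hyne (by rw [← hy.1, Set.mem_singleton_iff.mp h]; rfl)
    filter_upwards [htend.eventually hne, (hright x hx).filter_mono nhdsWithin_le_nhds]
      with y h1 h2
    have := hd (g y) h2.2 h1
    rwa [h2.1] at this

/-! ### Holomorphic maps on the sphere -/

lemma mdifferentiableAt_toC {p : Sphere} (hp : p ≠ OnePoint.infty) :
    MDifferentiableAt 𝓘(ℂ, ℂ) 𝓘(ℂ, ℂ) toC p :=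
  mdifferentiableAt_atlas (I := 𝓘(ℂ, ℂ)) (e := finChart) (Or.inl rfl) hp

lemma mdifferentiableAt_coe (w : ℂ) :
    MDifferentiableAt 𝓘(ℂ, ℂ) 𝓘(ℂ, ℂ) (fun w : ℂ => (w : Sphere)) w :=
  mdifferentiableAt_atlas_symm (I := 𝓘(ℂ, ℂ)) (e := finChart) (Or.inl rfl) (Set.mem_univ _)

lemma invS_eq_infty {p : Sphere} : invS p = OnePoint.infty ↔ p = ((0 : ℂ) : Sphere) :=
  ⟨fun h => by rw [← invS_invS p, h, invS_infty], fun h => by rw [h, invS_zero]⟩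

lemma invS_eq_zero {p : Sphere} : invS p = ((0 : ℂ) : Sphere) ↔ p = OnePoint.infty :=
  ⟨fun h => by rw [← invS_invS p, h, invS_zero], fun h => by rw [h, invS_infty]⟩

lemma coe_toC {p : Sphere} (hp : p ≠ OnePoint.infty) : ((toC p : ℂ) : Sphere) = p := by
  induction p using OnePoint.rec with
  | infty => exact absurd rfl hp
  | coe w => rfl

lemma mdifferentiableAt_toC_invS {p : Sphere} (hp : p ≠ ((0 : ℂ) : Sphere)) :
    MDifferentiableAt 𝓘(ℂ, ℂ) 𝓘(ℂ, ℂ) (fun p => toC (invS p)) p := by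
  refine mdifferentiableAt_atlas (I := 𝓘(ℂ, ℂ)) (e := invChart) (Or.inr rfl) ?_
  rw [invChart_source]
  exact fun h => hp (invS_eq_infty.mp h)

lemma mdifferentiableAt_invS_coe (w : ℂ) :
    MDifferentiableAt 𝓘(ℂ, ℂ) 𝓘(ℂ, ℂ) (fun w : ℂ => invS (w : Sphere)) w :=
  mdifferentiableAt_atlas_symm (I := 𝓘(ℂ, ℂ)) (e := invChart) (Or.inr rfl) (by
    simp [invChart, finChart])

lemma mdifferentiableAt_invS (p : Sphere) :
    MDifferentiableAt 𝓘(ℂ, ℂ) 𝓘(ℂ, ℂ) invS p := by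
  by_cases hp : p = OnePoint.infty
  · have hp0 : p ≠ ((0 : ℂ) : Sphere) := by rw [hp]; exact (OnePoint.coe_ne_infty 0).symm
    have h := (mdifferentiableAt_coe (toC (invS p))).comp p (mdifferentiableAt_toC_invS hp0)
    refine h.congr_of_eventuallyEq ?_
    filter_upwards [isOpen_ne.mem_nhds hp0] with q hq
    exact (coe_toC fun h => hq (invS_eq_infty.mp h)).symm
  · have h := (mdifferentiableAt_invS_coe (toC p)).comp p (mdifferentiableAt_toC hp)
    refine h.congr_of_eventuallyEq ?_
    filter_upwards [isOpen_ne.mem_nhds hp] with q hq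
    simp only [Function.comp_apply]
    rw [coe_toC hq]

/-! ### The inverse of a local coordinate -/

/-- Reduces to the plane by composing the coordinate with whichever of the parametrisations w and
1/w covers the point. -/
lemma Tube.exists_inverse (t : Tube) : IsOpen (t.coord '' t.nbhd) ∧ ∃ Ψ : ℂ → Sphere,
    (∀ p ∈ t.nbhd, Ψ (t.coord p) = p) ∧
    ∀ v ∈ t.coord '' t.nbhd, MDifferentiableAt 𝓘(ℂ, ℂ) 𝓘(ℂ, ℂ) Ψ v := by
  set Ψ := Function.invFunOn t.coord t.nbhd
  have hΨ : ∀ p ∈ t.nbhd, Ψ (t.coord p) = p :=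
    fun p hp => t.injOn_coord.leftInvOn_invFunOn hp
  have key : ∀ φ : ℂ → Sphere, (∀ w, MDifferentiableAt 𝓘(ℂ, ℂ) 𝓘(ℂ, ℂ) φ w) →
      Function.Injective φ → ∀ w, φ w ∈ t.nbhd →
      t.coord '' t.nbhd ∈ 𝓝 (t.coord (φ w)) ∧
        MDifferentiableAt 𝓘(ℂ, ℂ) 𝓘(ℂ, ℂ) Ψ (t.coord (φ w)) := by
    intro φ hφ hinj w hw
    have hU : IsOpen (φ ⁻¹' t.nbhd) := t.isOpen_nbhd.preimage
      (continuous_iff_continuousAt.mpr fun w => (hφ w).continuousAt)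
    have hd : DifferentiableOn ℂ (t.coord ∘ φ) (φ ⁻¹' t.nbhd) := by
      intro x hx
      have h1 := (t.holo_coord (φ x) hx).mdifferentiableAt (t.isOpen_nbhd.mem_nhds hx)
      exact (mdifferentiableAt_iff_differentiableAt.mp
        (h1.comp x (hφ x))).differentiableWithinAt
    have hi : Set.InjOn (t.coord ∘ φ) (φ ⁻¹' t.nbhd) := fun x hx y hy h =>
      hinj (t.injOn_coord hx hy h)
    obtain ⟨ho, g, hg⟩ := exists_holomorphic_inverse hU hd hi
    have h2 := ((hφ (g (t.coord (φ w)))).comp (t.coord (φ w))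
      (mdifferentiableAt_iff_differentiableAt.mpr (hg w hw).2))
    refine ⟨mem_of_superset (ho.mem_nhds ⟨w, hw, rfl⟩) ?_, h2.congr_of_eventuallyEq ?_⟩
    · rintro _ ⟨x, hx, rfl⟩
      exact ⟨φ x, hx, rfl⟩
    filter_upwards [ho.mem_nhds ⟨w, hw, rfl⟩] with v hv
    obtain ⟨x, hx, rfl⟩ := hv
    simp only [Function.comp_apply]
    rw [hΨ _ hx]
    exact congrArg φ (hg x hx).1.symm
  have main : ∀ p ∈ t.nbhd, t.coord '' t.nbhd ∈ 𝓝 (t.coord p) ∧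
      MDifferentiableAt 𝓘(ℂ, ℂ) 𝓘(ℂ, ℂ) Ψ (t.coord p) := by
    intro p hp
    by_cases hpi : p = OnePoint.infty
    · have hp0 : ((toC (invS p) : ℂ) : Sphere) = invS p := coe_toC fun h => by
        rw [invS_eq_infty, hpi] at h
        exact OnePoint.coe_ne_infty 0 h.symm
      have := key (fun w => invS w) mdifferentiableAt_invS_coe
        (invHomeo.injective.comp OnePoint.coe_injective) (toC (invS p))
      simp only [hp0, invS_invS] at this
      exact this hp
    · have := key (fun w => w) mdifferentiableAt_coe OnePoint.coe_injective (toC p)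
      simp only [coe_toC hpi] at this
      exact this hp
  refine ⟨isOpen_iff_mem_nhds.mpr ?_, Ψ, hΨ, ?_⟩
  · rintro _ ⟨p, hp, rfl⟩
    exact (main p hp).1
  · rintro _ ⟨p, hp, rfl⟩
    exact (main p hp).2

lemma analyticAt_toC_invS_comp {Ψ : ℂ → Sphere} {v : ℂ}
    (h : ∀ᶠ x in 𝓝 v, MDifferentiableAt 𝓘(ℂ, ℂ) 𝓘(ℂ, ℂ) Ψ x) (hv : Ψ v ≠ ((0 : ℂ) : Sphere)) :
    AnalyticAt ℂ (fun x => toC (invS (Ψ x))) v := by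
  rw [Complex.analyticAt_iff_eventually_differentiableAt]
  filter_upwards [h, h.self_of_nhds.continuousAt.eventually_mem (isOpen_ne.mem_nhds hv)]
    with x hx hx0
  exact mdifferentiableAt_iff_differentiableAt.mp ((mdifferentiableAt_toC_invS hx0).comp x hx)

lemma invS_coe_ne_zero (w : ℂ) : invS (w : Sphere) ≠ ((0 : ℂ) : Sphere) := fun h =>
  OnePoint.coe_ne_infty w (invS_eq_zero.mp h)

lemma invS_toC_invS {p : Sphere} (hp : p ≠ ((0 : ℂ) : Sphere)) :
    invS ((toC (invS p) : ℂ) : Sphere) = p := by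
  rw [coe_toC fun h => hp (invS_eq_infty.mp h), invS_invS]

lemma toC_invS_coe {w : ℂ} (hw : w ≠ 0) : toC (invS (w : Sphere)) = w⁻¹ := by
  rw [invS_coe hw, toC_coe]

/-! ### The square roots of `x² - 2ε` and `u² + 2ε` near infinity -/

/-- The branch of the square root of `x² - 2ε` which is asymptotic to `x` at infinity. -/
def rootSub (ε x : ℂ) : ℂ := x * Complex.sqrt (1 - 2 * ε / x ^ 2)

/-- The branch of the square root of `u² + 2ε` which is asymptotic to `u` at infinity. -/
def rootAdd (ε u : ℂ) : ℂ := u / Complex.sqrt (1 - 2 * ε / (u ^ 2 + 2 * ε))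

lemma one_sub_div_mem_slitPlane {a b : ℂ} (h : ‖a‖ < ‖b‖) : 1 - a / b ∈ Complex.slitPlane := by
  refine one_sub_mem_slitPlane ?_
  rw [norm_div]
  exact (div_lt_one ((norm_nonneg _).trans_lt h)).mpr h

lemma ne_zero_of_norm_lt {a b : ℂ} (h : ‖a‖ < ‖b‖) : b ≠ 0 :=
  norm_pos_iff.mp ((norm_nonneg _).trans_lt h)

lemma rootSub_sq {ε x : ℂ} (hx : ‖2 * ε‖ < ‖x ^ 2‖) : rootSub ε x ^ 2 = x ^ 2 - 2 * ε := by
  have h0 := ne_zero_of_norm_lt hx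
  rw [rootSub, mul_pow, pow_two (Complex.sqrt _), sqrt_mul_self, mul_sub, mul_one,
    mul_div_cancel₀ _ h0]

/-- For u² = x² - 2ε the radicand in `rootAdd` is 1 - 2ε/x², the very one in `rootSub`. The two
principal roots cancel without a choice of branch; hence the form of `rootAdd` as a quotient. -/
lemma rootAdd_rootSub {ε x : ℂ} (hx : ‖2 * ε‖ < ‖x ^ 2‖) : rootAdd ε (rootSub ε x) = x := by
  rw [rootAdd, rootSub_sq hx, sub_add_cancel, rootSub]
  exact mul_div_cancel_right₀ _
    (sqrt_ne_zero (Complex.slitPlane_ne_zero (one_sub_div_mem_slitPlane hx)))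

lemma rootAdd_sq {ε u : ℂ} (hu : ‖2 * ε‖ < ‖u ^ 2 + 2 * ε‖) :
    rootAdd ε u ^ 2 = u ^ 2 + 2 * ε := by
  have h0 := ne_zero_of_norm_lt hu
  have h1 := Complex.slitPlane_ne_zero (one_sub_div_mem_slitPlane hu)
  rw [rootAdd, div_pow, pow_two (Complex.sqrt _), sqrt_mul_self, div_eq_iff h1]
  field_simp
  ring

lemma rootSub_rootAdd {ε u : ℂ} (hu : ‖2 * ε‖ < ‖u ^ 2 + 2 * ε‖) :
    rootSub ε (rootAdd ε u) = u := by
  rw [rootSub, rootAdd_sq hu, rootAdd]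
  exact div_mul_cancel₀ _
    (sqrt_ne_zero (Complex.slitPlane_ne_zero (one_sub_div_mem_slitPlane hu)))

lemma analyticAt_rootSub {ε x : ℂ} (hx : ‖2 * ε‖ < ‖x ^ 2‖) : AnalyticAt ℂ (rootSub ε) x := by
  have h1 : AnalyticAt ℂ (fun x : ℂ => 1 - 2 * ε / x ^ 2) x :=
    analyticAt_const.sub (analyticAt_const.div (analyticAt_id.pow 2) (ne_zero_of_norm_lt hx))
  exact analyticAt_id.mul
    (AnalyticAt.fun_comp (analyticAt_sqrt (one_sub_div_mem_slitPlane hx)) h1)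

lemma analyticAt_rootAdd {ε u : ℂ} (hu : ‖2 * ε‖ < ‖u ^ 2 + 2 * ε‖) :
    AnalyticAt ℂ (rootAdd ε) u := by
  have h1 : AnalyticAt ℂ (fun u : ℂ => 1 - 2 * ε / (u ^ 2 + 2 * ε)) u :=
    analyticAt_const.sub (analyticAt_const.div
      ((analyticAt_id.pow 2).add analyticAt_const) (ne_zero_of_norm_lt hu))
  have hs := one_sub_div_mem_slitPlane hu
  exact analyticAt_id.div (AnalyticAt.fun_comp (analyticAt_sqrt hs) h1)
    (sqrt_ne_zero (Complex.slitPlane_ne_zero hs))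

/-! ### The discs which are cut out -/

/-- The inverse of the coordinate avoids 0 on the closed disc, so composed with 1/w it is
holomorphic there. The germ makes it v + z near 0, hence on the whole disc. Thus the disc and the
coordinate on it do not depend on the chosen neighbourhood of the tube. -/
lemma disc_of_coord_inv_sub {s : Tube} {z : ℂ}
    (hgerm : ∀ᶠ p in 𝓝 s.pt, s.coord p = toC (invS p) - z) {r : ℝ} (hr : 0 < r)
    (hball : Metric.closedBall 0 r ⊆ s.coord '' s.nbhd) (h0 : ((0 : ℂ) : Sphere) ∉ s.disc r)
    (y : ℂ) :
    (∀ ρ ≤ r, invS (y : Sphere) ∈ s.disc ρ ↔ ‖y - z‖ ≤ ρ) ∧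
      (invS (y : Sphere) ∈ s.disc r → s.coord (invS (y : Sphere)) = y - z) := by
  obtain ⟨ho, Ψ, hΨ, hΨd⟩ := s.exists_inverse
  have hmem : ∀ v ∈ Metric.closedBall (0 : ℂ) r, Ψ v ∈ s.nbhd ∧ s.coord (Ψ v) = v := by
    intro v hv
    obtain ⟨p, hp, rfl⟩ := hball hv
    rw [hΨ p hp]
    exact ⟨hp, rfl⟩
  have hne : ∀ v ∈ Metric.closedBall (0 : ℂ) r, Ψ v ≠ ((0 : ℂ) : Sphere) := by
    intro v hv h
    have h1 := hmem v hv
    rw [h] at h1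
    exact h0 ⟨h1.1, by rw [h1.2]; simpa using hv⟩
  have hc0 : (0 : ℂ) ∈ Metric.closedBall (0 : ℂ) r := Metric.mem_closedBall_self hr.le
  have hΨ0 : Ψ 0 = s.pt := by rw [← s.coord_pt, hΨ _ s.pt_mem]
  have han : AnalyticOnNhd ℂ (fun v => toC (invS (Ψ v))) (Metric.closedBall 0 r) := fun v hv =>
    analyticAt_toC_invS_comp (eventually_of_mem (ho.mem_nhds (hball hv)) hΨd) (hne v hv)
  have hnear : (fun v => toC (invS (Ψ v))) =ᶠ[𝓝 0] fun v => v + z := by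
    have hc : Tendsto Ψ (𝓝 0) (𝓝 s.pt) := by
      rw [← hΨ0]
      exact (hΨd 0 (hball hc0)).continuousAt
    filter_upwards [hc.eventually hgerm, Metric.closedBall_mem_nhds (0 : ℂ) hr] with v hv hv'
    rw [(hmem v hv').2] at hv
    linear_combination -hv
  have heq := han.eqOn_of_preconnected_of_eventuallyEq (g := fun v => v + z)
    (fun v _ => analyticAt_id.add analyticAt_const) (convex_closedBall 0 r).isPreconnected hc0
    hnear
  have hval : ∀ v ∈ Metric.closedBall (0 : ℂ) r, Ψ v = invS ((v + z : ℂ) : Sphere) := by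
    intro v hv
    have := heq hv
    simp only at this
    rw [← this, invS_toC_invS (hne v hv)]
  have hfwd : invS (y : Sphere) ∈ s.disc r → s.coord (invS (y : Sphere)) = y - z := by
    rintro ⟨h1, h2⟩
    have h3 := hval _ (by simpa using h2)
    rw [hΨ _ h1] at h3
    have := OnePoint.coe_injective (invHomeo.injective h3)
    linear_combination -this
  refine ⟨fun ρ hρ => ⟨fun h => ?_, fun h => ?_⟩, hfwd⟩
  · rw [← hfwd ⟨h.1, h.2.trans hρ⟩]
    exact h.2
  · have hv : y - z ∈ Metric.closedBall (0 : ℂ) r := by simpa using h.trans hρ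
    have h1 := hmem _ hv
    rw [hval _ hv, sub_add_cancel] at h1
    exact ⟨h1.1, by rwa [h1.2]⟩

/-- Continues the inverse u = √(1 - 2εv²)/v of the germ over the whole disc. That the coordinate
covers the closed disc of radius r is what bounds ε: the function v·u is a holomorphic square root
of 1 - 2εv², so the latter cannot have a simple zero there. -/
lemma disc_of_coord_sqrt {t : Tube} {ε : ℂ} (hpt : t.pt = ((0 : ℂ) : Sphere))
    (hgerm : ∀ᶠ p in 𝓝 t.pt, t.coord p = toC p / Complex.sqrt (1 + 2 * ε * toC p ^ 2)) {r : ℝ}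
    (hr : 0 < r) (hball : Metric.closedBall 0 r ⊆ t.coord '' t.nbhd) :
    ‖2 * ε‖ < r⁻¹ ^ 2 ∧ ∀ u : ℂ,
    (∀ ρ ≤ r, 0 < ρ → (invS (u : Sphere) ∈ t.disc ρ ↔ ρ⁻¹ ^ 2 ≤ ‖u ^ 2 + 2 * ε‖)) ∧
      (invS (u : Sphere) ∈ t.disc r → t.coord (invS (u : Sphere)) = (rootAdd ε u)⁻¹) := by
  obtain ⟨ho, Ψ, hΨ, hΨd⟩ := t.exists_inverse
  -- A slightly larger open disc is still covered. This allows derivatives on the boundary circle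
  -- and makes the bound on ε strict.
  obtain ⟨δ, hδ, hthick⟩ := (isCompact_closedBall (0 : ℂ) r).exists_thickening_subset_open ho hball
  rw [thickening_closedBall hδ hr.le] at hthick
  set U := Metric.ball (0 : ℂ) (δ + r) with hU
  have hUo : IsOpen U := Metric.isOpen_ball
  have hDU : Metric.closedBall 0 r ⊆ U := Metric.closedBall_subset_ball (by linarith)
  have hmem : ∀ v ∈ U, Ψ v ∈ t.nbhd ∧ t.coord (Ψ v) = v := by
    intro v hv
    obtain ⟨p, hp, rfl⟩ := hthick hv
    rw [hΨ p hp]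
    exact ⟨hp, rfl⟩
  have hc0 : (0 : ℂ) ∈ U := Metric.mem_ball_self (by linarith)
  have hΨ0 : Ψ 0 = ((0 : ℂ) : Sphere) := by rw [← hpt, ← t.coord_pt, hΨ _ t.pt_mem]
  have hcoord0 : t.coord ((0 : ℂ) : Sphere) = 0 := by rw [← hpt]; exact t.coord_pt
  have hne : ∀ v ∈ U, v ≠ 0 → Ψ v ≠ ((0 : ℂ) : Sphere) := by
    intro v hv hv0 h
    have h1 := (hmem v hv).2
    rw [h, hcoord0] at h1
    exact hv0 h1.symm
  -- The pole of 1/w at v = 0 is cancelled by the factor v; the value 1 is the limit there.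
  set m : ℂ → ℂ := fun v => if v = 0 then 1 else v * toC (invS (Ψ v)) with hm
  have hnear : m =ᶠ[𝓝 0] fun v => Complex.sqrt (1 - 2 * ε * v ^ 2) := by
    have hc : Tendsto Ψ (𝓝 0) (𝓝 ((0 : ℂ) : Sphere)) := by
      rw [← hΨ0]
      exact (hΨd 0 (hthick hc0)).continuousAt
    have hcont : ContinuousAt (fun p : Sphere => 1 + 2 * ε * toC p ^ 2) ((0 : ℂ) : Sphere) := by
      have := (mdifferentiableAt_toC (OnePoint.coe_ne_infty 0)).continuousAt
      fun_prop
    have hslit : ∀ᶠ p in 𝓝 ((0 : ℂ) : Sphere), 1 + 2 * ε * toC p ^ 2 ∈ Complex.slitPlane :=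
      hcont.eventually_mem (Complex.isOpen_slitPlane.mem_nhds (by simp))
    rw [hpt] at hgerm
    filter_upwards [hc.eventually hgerm, hc.eventually hslit,
      hc.eventually (isOpen_ne.mem_nhds (OnePoint.coe_ne_infty (0 : ℂ))),
      hUo.mem_nhds hc0] with v h1 h2 h3 h4
    rw [(hmem v h4).2] at h1
    by_cases hv : v = 0
    · simp [hm, hv]
    · have hw : toC (Ψ v) ≠ 0 := fun h => by
        rw [h] at h1
        exact hv (by simpa using h1)
      have hs := sqrt_mul_self (1 + 2 * ε * toC (Ψ v) ^ 2)
      have hs0 := sqrt_ne_zero (Complex.slitPlane_ne_zero h2)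
      have hvs : v * Complex.sqrt (1 + 2 * ε * toC (Ψ v) ^ 2) = toC (Ψ v) :=
        (eq_div_iff hs0).mp h1
      have h5 : 1 - 2 * ε * v ^ 2 = (1 + 2 * ε * toC (Ψ v) ^ 2)⁻¹ := by
        refine eq_inv_of_mul_eq_one_left ?_
        linear_combination 2 * ε * v ^ 2 * hs - 2 * ε *
          (v * Complex.sqrt (1 + 2 * ε * toC (Ψ v) ^ 2) + toC (Ψ v)) * hvs
      have h6 : toC (invS (Ψ v)) = (toC (Ψ v))⁻¹ := by
        rw [← toC_invS_coe hw, coe_toC h3]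
      rw [h5, sqrt_inv h2]
      simp only [hm, hv, if_false, h6]
      rw [← div_eq_mul_inv, div_eq_iff hw, eq_inv_mul_iff_mul_eq₀ hs0, mul_comm, hvs]
  have han0 : ∀ v : ℂ, ‖2 * ε * v ^ 2‖ < 1 →
      AnalyticAt ℂ (fun v => Complex.sqrt (1 - 2 * ε * v ^ 2)) v := fun v hv => by
    have h1 : AnalyticAt ℂ (fun v : ℂ => 1 - 2 * ε * v ^ 2) v := by fun_prop
    exact AnalyticAt.fun_comp (analyticAt_sqrt (one_sub_mem_slitPlane hv)) h1
  have han : AnalyticOnNhd ℂ m U := by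
    intro v hv
    by_cases hv0 : v = 0
    · rw [hv0]
      exact (han0 0 (by simp)).congr hnear.symm
    · have h1 : AnalyticAt ℂ (fun v => v * toC (invS (Ψ v))) v := analyticAt_id.mul
        (analyticAt_toC_invS_comp (eventually_of_mem (ho.mem_nhds (hthick hv)) hΨd) (hne v hv hv0))
      refine h1.congr ?_
      filter_upwards [isOpen_ne.mem_nhds hv0] with x hx
      simp only [hm]
      rw [if_neg hx]
  have hsq : Set.EqOn (fun v => m v * m v) (fun v => 1 - 2 * ε * v ^ 2) U := by
    refine (han.mul han).eqOn_of_preconnected_of_eventuallyEq (fun v _ => by fun_prop)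
      (convex_ball _ _).isPreconnected hc0 ?_
    filter_upwards [hnear] with v hv
    change m v * m v = _
    rw [hv, sqrt_mul_self]
  -- At such a v the function m vanishes, so m² has derivative 0, whereas 1 - 2εv² has a simple
  -- zero.
  have hne1 : ∀ v ∈ U, 2 * ε * v ^ 2 ≠ 1 := by
    intro v hv h
    have h1 := (han v hv).differentiableAt.hasDerivAt
    have h2 := (h1.mul h1).congr_of_eventuallyEq (f₁ := fun v => 1 - 2 * ε * v ^ 2)
      (eventually_of_mem (hUo.mem_nhds hv) fun x hx => (hsq hx).symm)
    have h3 : HasDerivAt (fun v : ℂ => 1 - 2 * ε * v ^ 2) (-(2 * ε * (2 * v))) v := by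
      simpa using ((hasDerivAt_pow 2 v).const_mul (2 * ε)).const_sub 1
    have h4 := h2.unique h3
    have h5 : m v = 0 := by
      have := hsq hv
      simp only [h, sub_self] at this
      exact mul_self_eq_zero.mp this
    rw [h5] at h4
    have : (2 : ℂ) = 0 := by linear_combination v * h4 - 2 * h
    exact two_ne_zero this
  have hεr : ‖2 * ε‖ < r⁻¹ ^ 2 := by
    by_contra hcon
    push Not at hcon
    have hε : (2 * ε) ≠ 0 := by
      rw [← norm_pos_iff]
      exact lt_of_lt_of_le (by positivity) hcon
    have hs := sqrt_mul_self (2 * ε)⁻¹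
    refine hne1 (Complex.sqrt (2 * ε)⁻¹) (hDU ?_) ?_
    · have h1 : ‖Complex.sqrt (2 * ε)⁻¹‖ ^ 2 ≤ r ^ 2 := by
        rw [← norm_pow, pow_two (Complex.sqrt _), hs, norm_inv]
        rw [inv_pow] at hcon
        exact inv_le_of_inv_le₀ (by positivity) hcon
      simpa using le_of_sq_le_sq h1 hr.le
    · rw [pow_two, hs, mul_inv_cancel₀ hε]
  have hlt : ∀ v ∈ Metric.closedBall (0 : ℂ) r, ‖2 * ε * v ^ 2‖ < 1 := by
    intro v hv
    have hv' : ‖v‖ ≤ r := by simpa using hv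
    rw [norm_mul, norm_pow]
    calc ‖2 * ε‖ * ‖v‖ ^ 2 ≤ ‖2 * ε‖ * r ^ 2 := by gcongr
      _ < r⁻¹ ^ 2 * r ^ 2 := by gcongr
      _ = 1 := by field_simp
  have heq : Set.EqOn m (fun v => Complex.sqrt (1 - 2 * ε * v ^ 2)) (Metric.closedBall 0 r) :=
    (han.mono hDU).eqOn_of_preconnected_of_eventuallyEq (fun v hv => han0 v (hlt v hv))
      (convex_closedBall 0 r).isPreconnected (Metric.mem_closedBall_self hr.le) hnear
  have hroot : ∀ v ∈ Metric.closedBall (0 : ℂ) r, v ≠ 0 →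
      toC (invS (Ψ v)) ^ 2 + 2 * ε = v⁻¹ ^ 2 ∧ rootAdd ε (toC (invS (Ψ v))) = v⁻¹ := by
    intro v hv hv0
    have h1 := heq hv
    simp only [hm, hv0, if_false] at h1
    have h2 := sqrt_mul_self (1 - 2 * ε * v ^ 2)
    have h3 := sqrt_ne_zero (Complex.slitPlane_ne_zero (one_sub_mem_slitPlane (hlt v hv)))
    have h4 : toC (invS (Ψ v)) ^ 2 + 2 * ε = v⁻¹ ^ 2 := by
      rw [← h1] at h2
      field_simp
      linear_combination h2
    refine ⟨h4, ?_⟩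
    have h5 : 1 - 2 * ε / (toC (invS (Ψ v)) ^ 2 + 2 * ε) = 1 - 2 * ε * v ^ 2 := by
      rw [h4]; field_simp
    rw [rootAdd, h5, div_eq_iff h3, ← h1]
    field_simp
  have hfwd : ∀ u : ℂ, invS (u : Sphere) ∈ t.disc r → ∃ v ∈ Metric.closedBall (0 : ℂ) r,
      v ≠ 0 ∧ v = t.coord (invS (u : Sphere)) ∧ toC (invS (Ψ v)) = u := by
    rintro u ⟨h1, h2⟩
    refine ⟨_, by simpa using h2, fun h => ?_, rfl, ?_⟩
    · have := hΨ _ h1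
      rw [h, hΨ0] at this
      exact invS_coe_ne_zero u this.symm
    · rw [hΨ _ h1, invS_invS, toC_coe]
  refine ⟨hεr, fun u => ⟨fun ρ hρ hρ0 => ⟨fun h => ?_, fun h => ?_⟩, fun h => ?_⟩⟩
  · obtain ⟨v, hv, hv0, hve, hu⟩ := hfwd u ⟨h.1, h.2.trans hρ⟩
    have h2 := h.2
    rw [← hve] at h2
    rw [← hu, (hroot v hv hv0).1, norm_pow, norm_inv]
    have := norm_pos_iff.mpr hv0
    gcongr
  · have hu : ‖2 * ε‖ < ‖u ^ 2 + 2 * ε‖ := hεr.trans_le (le_trans (by gcongr) h)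
    have hW := rootAdd_sq hu
    have hW0 : rootAdd ε u ≠ 0 := fun h0 => by
      rw [h0] at hW
      exact ne_zero_of_norm_lt hu (by rw [← hW]; ring)
    have hvρ : ‖(rootAdd ε u)⁻¹‖ ≤ ρ := by
      rw [← hW, norm_pow] at h
      rw [norm_inv]
      exact inv_le_of_inv_le₀ hρ0 (le_of_sq_le_sq h (norm_nonneg _))
    have hv : (rootAdd ε u)⁻¹ ∈ Metric.closedBall (0 : ℂ) r := by simpa using hvρ.trans hρ
    have h1 := hroot _ hv (inv_ne_zero hW0)
    rw [inv_inv] at h1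
    have h2 : ‖2 * ε‖ < ‖toC (invS (Ψ (rootAdd ε u)⁻¹)) ^ 2 + 2 * ε‖ := by
      rw [h1.1, hW]; exact hu
    -- The point found over 1/`rootAdd ε u` has the same `rootAdd` as u, and `rootSub` recovers
    -- both, so it is u itself.
    have h3 := rootSub_rootAdd h2
    rw [h1.2, rootSub_rootAdd hu] at h3
    have h4 := hmem _ (hDU hv)
    have h5 := invS_toC_invS (hne _ (hDU hv) (inv_ne_zero hW0))
    rw [← h3] at h5
    rw [← h5] at h4
    exact ⟨h4.1, by rw [h4.2]; exact hvρ⟩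
  · obtain ⟨v, hv, hv0, hve, hu⟩ := hfwd u h
    rw [← hve, ← hu, (hroot v hv hv0).2, inv_inv]

/-! ### Canonical representatives -/

lemma expVf_zero_X : expVf 0 PowerSeries.X = PowerSeries.X := by
  ext k
  rw [expVf, PowerSeries.coeff_mk, Finset.sum_eq_single 0]
  · simp
  · intro n _ hn
    obtain ⟨n, rfl⟩ := Nat.exists_eq_succ_of_ne_zero hn
    rw [Function.iterate_succ_apply', vfOp_zero, map_zero, zero_div]
  · simp

lemma seriesFun_localSeries_one_zero (x : ℂ) :
    seriesFun (localSeries 1 (0 : H).1) x = x := by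
  have h0 : (0 : H).1 = 0 := rfl
  rw [localSeries_one, h0, expVf_zero_X, seriesFun, tsum_eq_single 1]
  · simp
  · intro n hn
    simp [PowerSeries.coeff_X, hn]

lemma represents_omegaElt_iff {ε : ℂ} {S : Worldsheet} :
    (omegaElt ε).Represents S ↔
      S.out = [] ∧ ∃ t : Tube, S.inn = [t] ∧ t.pt = ((0 : ℂ) : Sphere) ∧
        ∀ᶠ p in 𝓝 t.pt, t.coord p = toC p / Complex.sqrt (1 + 2 * ε * toC p ^ 2) := by
  have key : ∀ t : Tube, t.pt = ((0 : ℂ) : Sphere) → ((∀ᶠ p in 𝓝 t.pt,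
      t.coord p = seriesFun (localSeries 1 (H.single 2 (-ε)).1) (toC p)) ↔
      ∀ᶠ p in 𝓝 t.pt, t.coord p = toC p / Complex.sqrt (1 + 2 * ε * toC p ^ 2)) := by
    intro t ht
    have hc : Tendsto toC (𝓝 t.pt) (𝓝 0) := by
      rw [ht]
      exact (mdifferentiableAt_toC (OnePoint.coe_ne_infty 0)).continuousAt
    have := hc.eventually (seriesFun_single_two ε)
    constructor <;> intro h <;> filter_upwards [h, this] with p h1 h2 <;> rw [h1, h2]
  constructor
  · rintro ⟨h1, h2⟩
    obtain ⟨t, l, ht, hl, hS⟩ := List.forall₂_cons_right_iff.mp h2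
    obtain rfl := List.forall₂_nil_right_iff.mp hl
    exact ⟨List.forall₂_nil_right_iff.mp h1, t, hS, ht.1, (key t ht.1).mp ht.2⟩
  · rintro ⟨h1, t, hS, hpt, hg⟩
    refine ⟨by rw [h1]; exact List.Forall₂.nil, ?_⟩
    rw [hS]
    exact List.Forall₂.cons ⟨hpt, (key t hpt).mpr hg⟩ List.Forall₂.nil

lemma represents_pantsElt_iff {z : ℂˣ} {T : Worldsheet} :
    (pantsElt z).Represents T ↔
      (∃ τ s : Tube, T.out = [τ, s] ∧
        (τ.pt = OnePoint.infty ∧ ∀ᶠ p in 𝓝 τ.pt, τ.coord p = toC (invS p)) ∧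
        s.pt = invS ((z : ℂ) : Sphere) ∧ ∀ᶠ p in 𝓝 s.pt, s.coord p = toC (invS p) - z) ∧
      ∃ τ₀ : Tube, T.inn = [τ₀] ∧ τ₀.pt = ((0 : ℂ) : Sphere) ∧
        ∀ᶠ p in 𝓝 τ₀.pt, τ₀.coord p = toC p := by
  have hout : (pantsElt z).outData = [(0, 1, 0), ((z : ℂ), 1, 0)] := by
    change (0, 1, 0) :: List.ofFn (fun i : Fin 1 => ((z : ℂ), ((1 : ℂˣ) : ℂ), (0 : H))) = _
    simp
  have hin : (pantsElt z).inData = (1, 0) := by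
    change (((1 : ℂˣ) : ℂ), (0 : H)) = _
    simp
  rw [KStarSpace.Represents, hout, hin]
  simp only [List.forall₂_cons_right_iff, List.forall₂_nil_right_iff, Tube.IsOut, Tube.IsIn,
    seriesFun_localSeries_one_zero, invS_zero, sub_zero]
  constructor
  · rintro ⟨⟨τ, l, hτ, ⟨s, l', hs, rfl, rfl⟩, h⟩, ⟨τ₀, l, hτ₀, rfl, h'⟩⟩
    exact ⟨⟨τ, s, h, hτ, hs⟩, τ₀, h', hτ₀⟩
  · rintro ⟨⟨τ, s, h, hτ, hs⟩, τ₀, h', hτ₀⟩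
    exact ⟨⟨τ, _, hτ, ⟨s, _, hs, rfl, rfl⟩, h⟩, τ₀, _, hτ₀, rfl, h'⟩

lemma represents_mk₁_iff {A : H} {a : ℂˣ} {B : H} {R : Worldsheet} :
    (KStarSpace.mk₁ A a B).Represents R ↔
      (∃ ρ : Tube, R.out = [ρ] ∧ ρ.pt = OnePoint.infty ∧
        ∀ᶠ p in 𝓝 ρ.pt, ρ.coord p = seriesFun (localSeries 1 A.1) (toC (invS p))) ∧
      ∃ ρ₀ : Tube, R.inn = [ρ₀] ∧ ρ₀.pt = ((0 : ℂ) : Sphere) ∧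
        ∀ᶠ p in 𝓝 ρ₀.pt, ρ₀.coord p = seriesFun (localSeries a B.1) (toC p) := by
  have hout : (KStarSpace.mk₁ A a B).outData = [(0, 1, A)] := by
    change (0, 1, A) :: List.ofFn (fun i : Fin 0 => _) = _
    simp
  have hin : (KStarSpace.mk₁ A a B).inData = ((a : ℂ), B) := rfl
  rw [KStarSpace.Represents, hout, hin]
  simp only [List.forall₂_cons_right_iff, List.forall₂_nil_right_iff, Tube.IsOut, Tube.IsIn,
    invS_zero, sub_zero]
  constructor
  · rintro ⟨⟨ρ, l, hρ, rfl, h⟩, ⟨ρ₀, l, hρ₀, rfl, h'⟩⟩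
    exact ⟨⟨ρ, h, hρ⟩, ρ₀, h', hρ₀⟩
  · rintro ⟨⟨ρ, h, hρ⟩, ρ₀, h', hρ₀⟩
    exact ⟨⟨ρ, _, hρ, rfl, h⟩, ρ₀, _, hρ₀, rfl, h'⟩

lemma exists_eq_mk₁ (Q : KStarSpace 1) : ∃ A a B, Q = KStarSpace.mk₁ A a B := by
  obtain ⟨z, hz, A, o, a, B⟩ := (Q : KStarSucc 0)
  refine ⟨A, a, B, ?_⟩
  have h1 : z = Fin.elim0 := Subsingleton.elim _ _
  have h2 : o = Fin.elim0 := Subsingleton.elim _ _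
  subst h1 h2
  rfl

lemma toC_invS (p : Sphere) : toC (invS p) = (toC p)⁻¹ := by
  induction p using OnePoint.rec with
  | infty => simp
  | coe w =>
    by_cases hw : w = 0
    · subst hw; simp
    · rw [toC_invS_coe hw, toC_coe]

lemma Tube.disc_mono (t : Tube) {r r' : ℝ} (h : r ≤ r') : t.disc r ⊆ t.disc r' :=
  fun _ hp => ⟨hp.1, hp.2.trans h⟩

/-! ### Behaviour of the square roots at infinity -/

lemma tendsto_sq_add_cobounded (c : ℂ) :
    Tendsto (fun u : ℂ => u ^ 2 + c) (Bornology.cobounded ℂ) (Bornology.cobounded ℂ) := by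
  rw [← tendsto_norm_atTop_iff_cobounded]
  have h1 : Tendsto (fun u : ℂ => ‖u‖ ^ 2 - ‖c‖) (Bornology.cobounded ℂ) atTop :=
    tendsto_atTop_add_const_right _ _
      ((tendsto_pow_atTop two_ne_zero).comp tendsto_norm_cobounded_atTop)
  refine tendsto_atTop_mono (fun u => ?_) h1
  have := norm_sub_norm_le (u ^ 2) (-c)
  rwa [norm_pow, norm_neg, sub_neg_eq_add] at this

lemma tendsto_rootAdd_div (ε : ℂ) :
    Tendsto (fun u => rootAdd ε u / u) (Bornology.cobounded ℂ) (𝓝 1) := by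
  have h1 : Tendsto (fun u : ℂ => 1 - 2 * ε * (u ^ 2 + 2 * ε)⁻¹) (Bornology.cobounded ℂ)
      (𝓝 (1 - 2 * ε * 0)) :=
    ((tendsto_inv₀_cobounded.comp (tendsto_sq_add_cobounded (2 * ε))).const_mul _).const_sub _
  have h2 : Tendsto (fun u : ℂ => (Complex.sqrt (1 - 2 * ε * (u ^ 2 + 2 * ε)⁻¹))⁻¹)
      (Bornology.cobounded ℂ) (𝓝 1) := by
    have hs : ContinuousAt Complex.sqrt (1 - 2 * ε * 0) :=
      (analyticAt_sqrt (by simp)).continuousAt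
    have := (hs.tendsto.comp h1).inv₀ (by simp)
    simpa using this
  refine h2.congr' ?_
  filter_upwards [Bornology.eventually_ne_cobounded (0 : ℂ)] with u hu
  rw [rootAdd, div_div, mul_comm (Complex.sqrt _), ← div_div, div_self hu, one_div, div_eq_mul_inv]

lemma tendsto_add_rootAdd_div_sub (ε z u₀ : ℂ) :
    Tendsto (fun u => (z + rootAdd ε u) / (u - u₀)) (Bornology.cobounded ℂ) (𝓝 1) := by
  have hi : Tendsto (fun u : ℂ => u⁻¹) (Bornology.cobounded ℂ) (𝓝 0) := tendsto_inv₀_cobounded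
  have h := ((hi.const_mul z).add (tendsto_rootAdd_div ε)).div
    ((hi.const_mul u₀).const_sub 1) (by simp)
  simp only [mul_zero, zero_add, sub_zero, div_one] at h
  refine h.congr' ?_
  filter_upwards [Bornology.eventually_ne_cobounded (0 : ℂ)] with u hu
  have : u - u₀ = u * (1 - u₀ * u⁻¹) := by field_simp
  rw [Pi.div_apply, this, ← div_div]
  congr 1
  field_simp

lemma tendsto_sub_const_cobounded (c : ℂ) :
    Tendsto (fun u : ℂ => u - c) (Bornology.cobounded ℂ) (Bornology.cobounded ℂ) := by
  rw [← tendsto_norm_atTop_iff_cobounded]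
  exact tendsto_atTop_mono (fun u => norm_sub_norm_le u c)
    (tendsto_atTop_add_const_right _ (-‖c‖) tendsto_norm_cobounded_atTop)

lemma tendsto_add_rootAdd (ε z : ℂ) :
    Tendsto (fun u => z + rootAdd ε u) (Bornology.cobounded ℂ) (Bornology.cobounded ℂ) := by
  rw [← tendsto_norm_atTop_iff_cobounded]
  have h1 := (tendsto_add_rootAdd_div_sub ε z 0).norm
  have h2 := h1.pos_mul_atTop (by simp) (tendsto_norm_cobounded_atTop (E := ℂ))
  refine h2.congr' ?_
  filter_upwards [Bornology.eventually_ne_cobounded (0 : ℂ)] with u hu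
  rw [sub_zero, ← norm_mul, div_mul_cancel₀ _ hu]

/-! ### The coordinates of a sewn sphere -/

/-- Liouville: the difference quotient of N at u₀ is entire with a finite limit at infinity, hence
constant. -/
lemma differentiable_eq_mul_sub {N : ℂ → ℂ} (hN : Differentiable ℂ N) {u₀ a : ℂ} (h0 : N u₀ = 0)
    (h : Tendsto (fun u => N u / (u - u₀)) (Bornology.cobounded ℂ) (𝓝 a)) (u : ℂ) :
    N u = a * (u - u₀) := by
  have hd : Differentiable ℂ (dslope N u₀) :=
    differentiableOn_univ.mp ((Complex.differentiableOn_dslope univ_mem).mpr hN.differentiableOn)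
  have ht : Tendsto (dslope N u₀) (cocompact ℂ) (𝓝 a) := by
    rw [← Metric.cobounded_eq_cocompact]
    refine h.congr' ?_
    filter_upwards [Bornology.eventually_ne_cobounded u₀] with u hu
    rw [dslope_of_ne _ hu, slope_def_field, h0, sub_zero]
  have h1 := hd.apply_eq_of_tendsto_cocompact u ht
  have h2 := sub_smul_dslope N u₀ u
  rw [h1, h0, sub_zero, smul_eq_mul] at h2
  rw [← h2, mul_comm]

lemma hasDerivAt_seriesFun_localSeries (a : ℂ) (A : H) :
    seriesFun (localSeries a A.1) 0 = 0 ∧ HasDerivAt (seriesFun (localSeries a A.1)) a 0 := by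
  have hs : AbsConv (localSeries a A.1) := by
    rw [localSeries_eq]
    exact ((isSeries_C a).mul (AbsConv.isSeries A.2)).absConv
  constructor
  · rw [← hs.isSeries.coeff_zero, localSeries_eq, PowerSeries.coeff_C_mul, coeff_zero_expVf_X,
      mul_zero]
  · have := hs.isSeries.hasDerivAt
    rwa [localSeries_eq, PowerSeries.coeff_C_mul, coeff_one_expVf_X, mul_one,
      ← localSeries_eq] at this

lemma rootSub_neg {ε z : ℂ} : rootSub ε (-z) = -(z * Complex.sqrt (1 - 2 * ε / z ^ 2)) := by
  rw [rootSub, neg_sq, neg_mul]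

/-- The entry of the sewn sphere in `a₀` and the coordinates at its punctures. -/
theorem KStarSpace.IsSewing.coordinates {ε : ℂ} {z : ℂˣ} {A : H} {a : ℂˣ} {B : H}
    (h : KStarSpace.IsSewing 1 (omegaElt ε) (pantsElt z) (KStarSpace.mk₁ A a B)) :
    (a : ℂ) = Complex.sqrt (1 - 2 * ε / (z : ℂ) ^ 2) ∧
    (∀ᶠ Y in 𝓝 (0 : ℂ), seriesFun (localSeries 1 A.1) Y =
      z + rootAdd ε (Y / a - z * a)) ∧
    ∀ᶠ w in 𝓝[≠] (0 : ℂ), seriesFun (localSeries a B.1) w =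
      (z + rootAdd ε ((a * w)⁻¹ - z * a))⁻¹ := by
  obtain ⟨S, T, R, hS, hT, hR, I₁, I₂, O₁, O₂, t, s, hSi, hI, hTo, hO, r₁, r₂, hr₂, hr, hb₁, hb₂,
    -, hd₂, F, G, hF, hG, hFi, hGi, -, hFG, hout, hinn⟩ := h
  obtain ⟨hSout, t', hSt, htpt, htc⟩ := represents_omegaElt_iff.mp hS
  obtain ⟨⟨τ, s', hTs, ⟨hτpt, hτc⟩, hspt, hsc⟩, τ₀, hTinn, hτ₀pt, hτ₀c⟩ :=
    represents_pantsElt_iff.mp hT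
  obtain ⟨⟨ρ, hRo, hρpt, hρc⟩, ρ₀, hRi, hρ₀pt, hρ₀c⟩ := represents_mk₁_iff.mp hR
  -- Tube numbers start at 1, and outgoing ones are counted from the end of the list, so 1 and -1
  -- leave no tubes before t and none after s.
  obtain rfl : I₁ = [] := List.length_eq_zero_iff.mp (by omega)
  obtain rfl : O₂ = [] := List.length_eq_zero_iff.mp (by omega)
  rw [hSt, List.nil_append, List.cons.injEq] at hSi
  obtain ⟨rfl, rfl⟩ := hSi
  have hO₁ : [τ] ++ [s'] = O₁ ++ [s] := by rw [← hTo, hTs]; rfl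
  obtain ⟨rfl, hs⟩ := List.append_inj' hO₁ rfl
  obtain rfl : s' = s := by simpa using hs
  rw [hSout, hRo] at hout
  rw [hTinn, hRi] at hinn
  simp only [List.map_cons, List.map_nil, List.append_nil, List.nil_append,
    List.forall₂_cons, List.forall₂_nil_left_iff, and_true] at hout hinn
  obtain ⟨hGτ, hGτc⟩ := hout
  obtain ⟨hGτ₀, hGτ₀c⟩ := hinn
  have hr₁ : 0 < r₁ := hr₂.trans hr
  have hrr : r₁⁻¹ < r₂⁻¹ := by gcongr
  have hrr2 : r₁⁻¹ ^ 2 < r₂⁻¹ ^ 2 := by gcongr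
  simp only [List.append_nil, hTinn, List.singleton_append, List.mem_cons, List.not_mem_nil,
    or_false, forall_eq_or_imp, forall_eq, hτpt, hτ₀pt] at hd₂
  obtain ⟨hdi, hd0⟩ := hd₂
  obtain ⟨hεr, hdt⟩ := disc_of_coord_sqrt htpt htc hr₁ hb₁
  have hds := disc_of_coord_inv_sub hsc (inv_pos.mpr hr₂) hb₂ hd0
  rw [hτpt, hρpt] at hGτ
  rw [hτ₀pt, hρ₀pt] at hGτ₀
  -- The puncture ∞ is y = 0, at distance |z| from z, and must lie outside the disc.
  have hzr : r₂⁻¹ < ‖(z : ℂ)‖ := by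
    have := mt ((hds 0).1 r₂⁻¹ le_rfl).mpr (by rwa [invS_zero])
    rwa [zero_sub, norm_neg, not_le] at this
  have hεz : ‖2 * ε‖ < ‖(z : ℂ) ^ 2‖ := by
    rw [norm_pow]
    refine hεr.trans (hrr2.trans ?_)
    gcongr
  have hs0 : ((0 : ℂ) : Sphere) ∈ (s'.disc r₁⁻¹)ᶜ := fun h => hd0 (s'.disc_mono hrr.le h)
  have hpF : ∀ u : ℂ, ‖u ^ 2 + 2 * ε‖ < r₂⁻¹ ^ 2 → invS (u : Sphere) ∈ (t'.disc r₂)ᶜ := by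
    intro u hu hmem
    exact absurd (((hdt u).1 r₂ hr.le hr₂).mp hmem) (not_le.mpr hu)
  have hpG : ∀ y : ℂ, r₁⁻¹ < ‖y - z‖ → invS (y : Sphere) ∈ (s'.disc r₁⁻¹)ᶜ := by
    intro y hy hmem
    exact absurd (((hds y).1 r₁⁻¹ hrr.le).mp hmem) (not_le.mpr hy)
  -- The point 0 of the target is the image under G of the puncture 0, which is not in the gluing
  -- annulus. So 1/F has no pole.
  have hF0 : ∀ p ∈ (t'.disc r₂)ᶜ, F p ≠ ((0 : ℂ) : Sphere) := by
    intro p hp h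
    rw [← hGτ₀] at h
    exact hd0 ((hFG p hp _ hs0).mp h).2.1
  have hG0 : ∀ q ∈ (s'.disc r₁⁻¹)ᶜ, q ≠ ((0 : ℂ) : Sphere) → G q ≠ ((0 : ℂ) : Sphere) := by
    intro q hq hq0 h
    rw [← hGτ₀] at h
    exact hq0 (hGi hq hs0 h)
  have hON : IsOpen {u : ℂ | ‖u ^ 2 + 2 * ε‖ < r₂⁻¹ ^ 2} :=
    isOpen_lt (by fun_prop) continuous_const
  have hOK : IsOpen {y : ℂ | r₁⁻¹ < ‖y - z‖} := isOpen_lt continuous_const (by fun_prop)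
  have hOM : IsOpen {u : ℂ | r₁⁻¹ ^ 2 < ‖u ^ 2 + 2 * ε‖} :=
    isOpen_lt continuous_const (by fun_prop)
  have hFd : ∀ u : ℂ, ‖u ^ 2 + 2 * ε‖ < r₂⁻¹ ^ 2 →
      MDifferentiableAt 𝓘(ℂ, ℂ) 𝓘(ℂ, ℂ) (fun u : ℂ => F (invS (u : Sphere))) u := fun u hu =>
    (MDifferentiableWithinAt.comp (g := F) (u := (t'.disc r₂)ᶜ) u (hF _ (hpF u hu)) (mdifferentiableAt_invS_coe u).mdifferentiableWithinAt
      (s := {u : ℂ | ‖u ^ 2 + 2 * ε‖ < r₂⁻¹ ^ 2}) (fun x hx => hpF x hx)).mdifferentiableAt (hON.mem_nhds hu)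
  have hGd : ∀ y : ℂ, r₁⁻¹ < ‖y - z‖ →
      MDifferentiableAt 𝓘(ℂ, ℂ) 𝓘(ℂ, ℂ) (fun y : ℂ => G (invS (y : Sphere))) y := fun y hy =>
    (MDifferentiableWithinAt.comp (g := G) (u := (s'.disc r₁⁻¹)ᶜ) y (hG _ (hpG y hy)) (mdifferentiableAt_invS_coe y).mdifferentiableWithinAt
      (s := {y : ℂ | r₁⁻¹ < ‖y - z‖}) (fun x hx => hpG x hx)).mdifferentiableAt (hOK.mem_nhds hy)
  -- The two maps F and G written in the coordinates 1/w of source and target.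
  set N₁ : ℂ → ℂ := fun u => toC (invS (F (invS (u : Sphere)))) with hN₁
  set K : ℂ → ℂ := fun y => toC (invS (G (invS (y : Sphere)))) with hK
  have hN₁a : ∀ u : ℂ, ‖u ^ 2 + 2 * ε‖ < r₂⁻¹ ^ 2 → AnalyticAt ℂ N₁ u := fun u hu =>
    analyticAt_toC_invS_comp (eventually_of_mem (hON.mem_nhds hu) hFd) (hF0 _ (hpF u hu))
  have hKa : ∀ y : ℂ, r₁⁻¹ < ‖y - z‖ → AnalyticAt ℂ K y := fun y hy =>
    analyticAt_toC_invS_comp (eventually_of_mem (hOK.mem_nhds hy) hGd)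
      (hG0 _ (hpG y hy) (invS_coe_ne_zero y))
  have hroot : ∀ u : ℂ, r₁⁻¹ ^ 2 < ‖u ^ 2 + 2 * ε‖ → r₁⁻¹ < ‖rootAdd ε u‖ := by
    intro u hu
    rw [← rootAdd_sq (hεr.trans hu), norm_pow] at hu
    exact lt_of_pow_lt_pow_left₀ 2 (norm_nonneg _) hu
  have hroot' : ∀ u : ℂ, r₁⁻¹ ^ 2 < ‖u ^ 2 + 2 * ε‖ → r₁⁻¹ < ‖(z + rootAdd ε u) - z‖ := by
    intro u hu
    rw [add_sub_cancel_left]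
    exact hroot u hu
  have hoverlap : ∀ u : ℂ, r₁⁻¹ ^ 2 < ‖u ^ 2 + 2 * ε‖ → ‖u ^ 2 + 2 * ε‖ < r₂⁻¹ ^ 2 →
      N₁ u = K (z + rootAdd ε u) := by
    intro u h1 h2
    have h3 : invS (u : Sphere) ∈ t'.disc r₁ := ((hdt u).1 r₁ le_rfl hr₁).mpr h1.le
    have h4 : invS ((z + rootAdd ε u : ℂ) : Sphere) ∈ s'.disc r₂⁻¹ := by
      refine ((hds _).1 _ le_rfl).mpr ?_
      rw [add_sub_cancel_left]
      rw [← rootAdd_sq (hεr.trans h1), norm_pow] at h2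
      exact (lt_of_pow_lt_pow_left₀ 2 (inv_pos.mpr hr₂).le h2).le
    have h5 := (hFG _ (hpF u h2) _ (hpG _ (hroot' u h1))).mpr ⟨h3, h4, by
      rw [(hdt u).2 h3, (hds _).2 h4, inv_inv, add_sub_cancel_left]⟩
    simp only [hN₁, hK]
    rw [h5]
  -- The expressions agree on the annulus r₁⁻² < |u² + 2ε| < r₂⁻². The first is holomorphic inside
  -- its outer boundary and the second outside its inner one, so together they give an entire
  -- function.
  set N : ℂ → ℂ := fun u => if ‖u ^ 2 + 2 * ε‖ < r₂⁻¹ ^ 2 then N₁ u else K (z + rootAdd ε u)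
    with hNdef
  have hNK : ∀ u : ℂ, r₁⁻¹ ^ 2 < ‖u ^ 2 + 2 * ε‖ → N u = K (z + rootAdd ε u) := by
    intro u hu
    simp only [hNdef]
    split_ifs with h
    · exact hoverlap u hu h
    · rfl
  have hNd : Differentiable ℂ N := by
    intro u
    by_cases hu : ‖u ^ 2 + 2 * ε‖ < r₂⁻¹ ^ 2
    · refine (hN₁a u hu).differentiableAt.congr_of_eventuallyEq ?_
      filter_upwards [hON.mem_nhds hu] with x hx
      exact if_pos hx
    · have hu' : r₁⁻¹ ^ 2 < ‖u ^ 2 + 2 * ε‖ := hrr2.trans_le (not_lt.mp hu)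
      have h1 : DifferentiableAt ℂ (fun u => z + rootAdd ε u) u :=
        (analyticAt_rootAdd (hεr.trans hu')).differentiableAt.const_add _
      have h2 := (hKa _ (hroot' u hu')).differentiableAt
      refine (DifferentiableAt.comp (g := K) u h2 h1).congr_of_eventuallyEq ?_
      filter_upwards [hOM.mem_nhds hu'] with x hx
      exact hNK x hx
  -- The u corresponding to y = 0, the remaining outgoing puncture, which G sends to ∞.
  set u₀ := rootSub ε (-z) with hu₀
  have hεz' : ‖2 * ε‖ < ‖(-(z : ℂ)) ^ 2‖ := by rwa [neg_sq]
  have hu₀sq : u₀ ^ 2 + 2 * ε = (z : ℂ) ^ 2 := by rw [hu₀, rootSub_sq hεz']; ring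
  have hu₀add : rootAdd ε u₀ = -z := rootAdd_rootSub hεz'
  have hu₀r : r₁⁻¹ ^ 2 < ‖u₀ ^ 2 + 2 * ε‖ := by
    rw [hu₀sq, norm_pow]
    refine hrr2.trans ?_
    gcongr
  have hK0 : K 0 = 0 := by
    simp only [hK]
    rw [invS_zero, hGτ, invS_infty, toC_coe]
  have hN0 : N u₀ = 0 := by rw [hNK u₀ hu₀r, hu₀add, add_neg_cancel, hK0]
  -- the coordinate at the incoming puncture
  obtain ⟨hk0, hkd⟩ := hasDerivAt_seriesFun_localSeries (a : ℂ) B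
  set k := seriesFun (localSeries (a : ℂ) B.1) with hk
  have hinvt : Tendsto (fun y : ℂ => invS (y : Sphere)) (Bornology.cobounded ℂ)
      (𝓝 ((0 : ℂ) : Sphere)) := by
    have := (continuous_invS.tendsto OnePoint.infty).comp tendsto_coe_cobounded
    rwa [invS_infty] at this
  have hfar : ∀ᶠ y in Bornology.cobounded ℂ, r₁⁻¹ < ‖y - (z : ℂ)‖ :=
    (tendsto_norm_cobounded_atTop.comp (tendsto_sub_const_cobounded (z : ℂ))).eventually_gt_atTop _
  have hGt : Tendsto (fun y : ℂ => G (invS (y : Sphere))) (Bornology.cobounded ℂ)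
      (𝓝 ((0 : ℂ) : Sphere)) := by
    have h1 := (hG _ hs0).continuousWithinAt
    rw [ContinuousWithinAt, hGτ₀] at h1
    exact h1.comp (tendsto_nhdsWithin_iff.mpr ⟨hinvt, hfar.mono fun y hy => hpG y hy⟩)
  -- G intertwines the coordinate w = 1/y at the puncture 0 with the coordinate k of the target.
  have hkK : ∀ᶠ y in Bornology.cobounded ℂ, k (K y)⁻¹ = y⁻¹ := by
    rw [hτ₀pt] at hGτ₀c hτ₀c
    rw [hρ₀pt] at hρ₀c
    filter_upwards [hinvt.eventually hGτ₀c, hinvt.eventually hτ₀c, hGt.eventually hρ₀c]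
      with y h1 h2 h3
    simp only [hK]
    rw [toC_invS, inv_inv, ← h3, h1, h2, toC_invS, toC_coe]
  have hKinv : Tendsto (fun y => (K y)⁻¹) (Bornology.cobounded ℂ) (𝓝[≠] 0) := by
    refine tendsto_nhdsWithin_iff.mpr ⟨?_, ?_⟩
    · have h1 := (mdifferentiableAt_toC (OnePoint.coe_ne_infty 0)).continuousAt.tendsto.comp hGt
      rw [toC_coe] at h1
      refine h1.congr fun y => ?_
      simp only [hK, Function.comp_apply]
      rw [toC_invS, inv_inv]
    · filter_upwards [hkK, Bornology.eventually_ne_cobounded (0 : ℂ)] with y h1 h2 h3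
      rw [Set.mem_singleton_iff.mp h3, hk0] at h1
      exact h2 (inv_eq_zero.mp h1.symm)
  have hKdiv : Tendsto (fun y => K y / y) (Bornology.cobounded ℂ) (𝓝 (a : ℂ)) := by
    have h1 := (hasDerivAt_iff_tendsto_slope.mp hkd).comp hKinv
    refine h1.congr' ?_
    filter_upwards [hkK] with y hy
    rw [Function.comp_apply, slope_def_field, hk0, hy, sub_zero, sub_zero, div_inv_eq_mul,
      mul_comm, div_eq_mul_inv]
  have hrt := tendsto_add_rootAdd ε (z : ℂ)
  have hOMfar : ∀ᶠ u in Bornology.cobounded ℂ, r₁⁻¹ ^ 2 < ‖u ^ 2 + 2 * ε‖ :=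
    (tendsto_norm_cobounded_atTop.comp (tendsto_sq_add_cobounded (2 * ε))).eventually_gt_atTop _
  have hNlim : Tendsto (fun u => N u / (u - u₀)) (Bornology.cobounded ℂ) (𝓝 (a : ℂ)) := by
    have h1 := (hKdiv.comp hrt).mul (tendsto_add_rootAdd_div_sub ε z u₀)
    rw [mul_one] at h1
    refine h1.congr' ?_
    filter_upwards [hOMfar, hrt.eventually (Bornology.eventually_ne_cobounded (0 : ℂ))]
      with u h2 h3
    rw [hNK u h2, Function.comp_apply, div_mul_div_cancel₀ h3]
  have hNeq := differentiable_eq_mul_sub hNd hN0 hNlim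
  have hKeq : ∀ u : ℂ, r₁⁻¹ ^ 2 < ‖u ^ 2 + 2 * ε‖ → K (z + rootAdd ε u) = a * (u - u₀) :=
    fun u hu => by rw [← hNK u hu, hNeq]
  have ha0 : (a : ℂ) ≠ 0 := a.ne_zero
  -- the coordinate at the outgoing puncture
  obtain ⟨-, hhd⟩ := hasDerivAt_seriesFun_localSeries 1 A
  set h := seriesFun (localSeries 1 A.1) with hh
  have h0K : r₁⁻¹ < ‖(0 : ℂ) - z‖ := by
    rw [zero_sub, norm_neg]; exact hrr.trans hzr
  have hhK : ∀ᶠ y in 𝓝 (0 : ℂ), h (K y) = y := by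
    have h1 : Tendsto (fun y : ℂ => invS (y : Sphere)) (𝓝 0) (𝓝 τ.pt) := by
      have := (mdifferentiableAt_invS_coe 0).continuousAt.tendsto
      rwa [invS_zero, ← hτpt] at this
    have h2 : Tendsto (fun y : ℂ => G (invS (y : Sphere))) (𝓝 0) (𝓝 ρ.pt) := by
      have := (hGd 0 h0K).continuousAt.tendsto
      rwa [invS_zero, hGτ, ← hρpt] at this
    filter_upwards [h1.eventually hGτc, h1.eventually hτc, h2.eventually hρc] with y h3 h4 h5
    simp only [hK]
    rw [← h5, h3, h4, invS_invS, toC_coe]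
  have hu₀ε : ‖2 * ε‖ < ‖u₀ ^ 2 + 2 * ε‖ := hεr.trans hu₀r
  have hhu : ∀ᶠ u in 𝓝 u₀, h (a * (u - u₀)) = z + rootAdd ε u := by
    have h1 : Tendsto (fun u => z + rootAdd ε u) (𝓝 u₀) (𝓝 0) := by
      have := ((analyticAt_rootAdd hu₀ε).continuousAt.tendsto).const_add (z : ℂ)
      rwa [hu₀add, add_neg_cancel] at this
    filter_upwards [h1.eventually hhK, hOM.mem_nhds hu₀r] with u h2 h3
    rw [← hKeq u h3, h2]
  have hY : ∀ᶠ Y in 𝓝 (0 : ℂ), h Y = z + rootAdd ε (Y / a + u₀) := by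
    have h1 : Tendsto (fun Y : ℂ => Y / a + u₀) (𝓝 0) (𝓝 u₀) := by
      have : ContinuousAt (fun Y : ℂ => Y / a + u₀) 0 := by fun_prop
      simpa using this.tendsto
    filter_upwards [h1.eventually hhu] with Y h2
    rwa [add_sub_cancel_right, mul_div_cancel₀ _ ha0] at h2
  -- Since W² = u² + 2ε, the derivative of W at u₀ is u₀/W(u₀) = -u₀/z. The chain rule gives h'(0) =
  -- -u₀/(za), which must be 1.
  have ha : u₀ = -(z * a) := by
    have h1 : HasDerivAt (rootAdd ε) (deriv (rootAdd ε) u₀) u₀ :=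
      (analyticAt_rootAdd hu₀ε).differentiableAt.hasDerivAt
    have h2 : HasDerivAt (fun u => rootAdd ε u ^ 2) (2 * u₀) u₀ := by
      have h3 : HasDerivAt (fun u : ℂ => u ^ 2 + 2 * ε) (2 * u₀) u₀ := by
        simpa using (hasDerivAt_pow 2 u₀).add_const (2 * ε)
      refine h3.congr_of_eventuallyEq ?_
      filter_upwards [hOM.mem_nhds hu₀r] with u hu
      exact rootAdd_sq (hεr.trans hu)
    have h3 := (h1.fun_pow 2).unique h2
    rw [hu₀add] at h3
    have h4 : HasDerivAt (fun Y : ℂ => z + rootAdd ε (Y / a + u₀)) (deriv (rootAdd ε) u₀ * (1 / a))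
        0 := by
      have h5 : HasDerivAt (fun Y : ℂ => Y / a + u₀) (1 / (a : ℂ)) 0 :=
        ((hasDerivAt_id (0 : ℂ)).div_const (a : ℂ)).add_const u₀
      refine HasDerivAt.const_add _ (HasDerivAt.comp (h₂ := rootAdd ε) 0 ?_ h5)
      simpa using h1
    have h5 := (h4.congr_of_eventuallyEq hY).unique hhd
    field_simp at h5
    rw [h5] at h3
    simp at h3
    linear_combination (-1 / 2 : ℂ) * h3
  refine ⟨?_, ?_, ?_⟩
  · rw [hu₀, rootSub_neg] at ha
    exact (mul_left_cancel₀ z.ne_zero (neg_injective ha)).symm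
  · refine hY.mono fun Y h1 => ?_
    rw [h1, ha, sub_eq_add_neg]
  · have h1 : Tendsto (fun w : ℂ => ((a : ℂ) * w)⁻¹ - z * a) (𝓝[≠] 0) (Bornology.cobounded ℂ) := by
      refine (tendsto_sub_const_cobounded _).comp (tendsto_inv₀_nhdsNE_zero.comp ?_)
      refine tendsto_nhdsWithin_iff.mpr ⟨?_, ?_⟩
      · have : ContinuousAt (fun w : ℂ => (a : ℂ) * w) 0 := by fun_prop
        have := this.tendsto
        rw [mul_zero] at this
        exact this.mono_left nhdsWithin_le_nhds
      · filter_upwards [self_mem_nhdsWithin] with w hw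
        exact mul_ne_zero ha0 hw
    filter_upwards [h1.eventually (hrt.eventually hkK), h1.eventually hOMfar,
      self_mem_nhdsWithin] with w h2 h3 h4
    have hw : w ≠ 0 := h4
    rw [hKeq _ h3, ha] at h2
    rw [← h2]
    congr 1
    field_simp
    ring

/-! ### Construction of tubes -/

/-- The tube with local coordinate `g` at the point `c` of the plane. -/
def Tube.ofFun (g : ℂ → ℂ) (U : Set ℂ) (c : ℂ) (hU : IsOpen U) (hg : DifferentiableOn ℂ g U)
    (hi : Set.InjOn g U) (hc : c ∈ U) (hgc : g c = 0) : Tube where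
  pt := c
  nbhd := (fun w : ℂ => (w : Sphere)) '' U
  coord p := g (toC p)
  isOpen_nbhd := OnePoint.isOpenEmbedding_coe.isOpenMap U hU
  pt_mem := ⟨c, hc, rfl⟩
  injOn_coord := by
    rintro _ ⟨x, hx, rfl⟩ _ ⟨y, hy, rfl⟩ h
    exact congrArg _ (hi hx hy h)
  holo_coord := by
    rintro _ ⟨x, hx, rfl⟩
    have h1 := (hg.differentiableAt (hU.mem_nhds hx))
    exact (MDifferentiableAt.comp (x : Sphere) (g := g) (f := toC)
      (mdifferentiableAt_iff_differentiableAt.mpr h1)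
      (mdifferentiableAt_toC (OnePoint.coe_ne_infty x))).mdifferentiableWithinAt
  coord_pt := hgc

/-- The image of a tube under the inversion of the sphere. -/
def Tube.inv (t : Tube) : Tube where
  pt := invS t.pt
  nbhd := invS ⁻¹' t.nbhd
  coord p := t.coord (invS p)
  isOpen_nbhd := t.isOpen_nbhd.preimage continuous_invS
  pt_mem := by
    rw [Set.mem_preimage, invS_invS]
    exact t.pt_mem
  injOn_coord := fun p hp q hq h => invHomeo.injective (t.injOn_coord hp hq h)
  holo_coord := by
    intro p hp
    exact (((t.holo_coord _ hp).mdifferentiableAt (t.isOpen_nbhd.mem_nhds hp)).comp p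
      (mdifferentiableAt_invS p)).mdifferentiableWithinAt
  coord_pt := by rw [invS_invS, t.coord_pt]

lemma exists_tube_zero {g : ℂ → ℂ} {a : ℂ} (hg : AnalyticAt ℂ g 0) (h0 : g 0 = 0)
    (hd : HasDerivAt g a 0) (ha : a ≠ 0) :
    ∃ t : Tube, t.pt = ((0 : ℂ) : Sphere) ∧ ∀ p, t.coord p = g (toC p) := by
  have hs : HasStrictDerivAt g a 0 := by
    have := hg.hasStrictDerivAt
    rwa [hd.deriv] at this
  have h1 := hs.eventually_left_inverse ha
  have h2 := (Complex.analyticAt_iff_eventually_differentiableAt.mp hg)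
  obtain ⟨U, hU, hUo, hU0⟩ := eventually_nhds_iff.mp (h1.and h2)
  refine ⟨Tube.ofFun g U 0 hUo (fun x hx => (hU x hx).2.differentiableWithinAt)
    (fun x hx y hy h => ?_) hU0 h0, rfl, fun p => rfl⟩
  rw [← (hU x hx).1, ← (hU y hy).1, h]

/-- After division by a the series begins with x, so it is the exponential of its `logSeq`, and
convergence is inherited from g. -/
lemma exists_localSeries {g : ℂ → ℂ} {a : ℂ} (hg : AnalyticAt ℂ g 0) (h0 : g 0 = 0)
    (hd : HasDerivAt g a 0) (ha : a ≠ 0) :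
    ∃ A : H, ∀ᶠ x in 𝓝 (0 : ℂ), seriesFun (localSeries a A.1) x = g x := by
  obtain ⟨f, hf⟩ := hg.exists_isSeries
  have e0 : PowerSeries.coeff 0 (PowerSeries.C a⁻¹ * f) = 0 := by
    rw [PowerSeries.coeff_C_mul, hf.coeff_zero, h0, mul_zero]
  have e1 : PowerSeries.coeff 1 (PowerSeries.C a⁻¹ * f) = 1 := by
    rw [PowerSeries.coeff_C_mul, hf.hasDerivAt.unique hd, inv_mul_cancel₀ ha]
  have e2 := expVf_logSeq e0 e1
  refine ⟨⟨logSeq (PowerSeries.C a⁻¹ * f), ?_⟩, ?_⟩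
  · rw [e2]
    exact ((isSeries_C a⁻¹).mul hf).absConv
  · change ∀ᶠ x in 𝓝 (0 : ℂ), seriesFun (localSeries a (logSeq (PowerSeries.C a⁻¹ * f))) x = g x
    rw [localSeries_eq, e2, ← mul_assoc, ← map_mul, mul_inv_cancel₀ ha, map_one, one_mul]
    exact hf.eq_seriesFun

lemma analyticAt_id_div {E : ℂ → ℂ} (hE : AnalyticAt ℂ E 0) (h0 : E 0 ≠ 0) :
    AnalyticAt ℂ (fun x => x / E x) 0 ∧ HasDerivAt (fun x => x / E x) (E 0)⁻¹ 0 := by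
  refine ⟨analyticAt_id.div hE h0, ?_⟩
  have := (hasDerivAt_id (0 : ℂ)).fun_div hE.differentiableAt.hasDerivAt h0
  have e : (1 * E 0 - id 0 * deriv E 0) / E 0 ^ 2 = (E 0)⁻¹ := by
    simp only [id, zero_mul, sub_zero, one_mul]
    field_simp
  rwa [e] at this

/-! ### The explicit coordinates -/

lemma hasDerivAt_rootAdd {ε u : ℂ} (hu : ‖2 * ε‖ < ‖u ^ 2 + 2 * ε‖) :
    HasDerivAt (rootAdd ε) (u / rootAdd ε u) u := by
  have h1 := (analyticAt_rootAdd hu).differentiableAt.hasDerivAt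
  have h2 : HasDerivAt (fun u => rootAdd ε u ^ 2) (2 * u) u := by
    have h3 : HasDerivAt (fun u : ℂ => u ^ 2 + 2 * ε) (2 * u) u := by
      simpa using (hasDerivAt_pow 2 u).add_const (2 * ε)
    refine h3.congr_of_eventuallyEq ?_
    have ho : IsOpen {u : ℂ | ‖2 * ε‖ < ‖u ^ 2 + 2 * ε‖} :=
      isOpen_lt continuous_const (by fun_prop)
    filter_upwards [ho.mem_nhds hu] with u hu
    exact rootAdd_sq hu
  have h3 := (h1.fun_pow 2).unique h2
  have h0 : rootAdd ε u ≠ 0 := fun h => by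
    have := rootAdd_sq hu
    rw [h] at this
    exact ne_zero_of_norm_lt hu (by rw [← this]; ring)
  rwa [show u / rootAdd ε u = deriv (rootAdd ε) u by
    rw [div_eq_iff h0]
    simp at h3
    linear_combination -(1 / 2 : ℂ) * h3]

section

variable {ε z σ : ℂ}

/-- At Y = 0 the argument is -zσ = `rootSub ε (-z)`, where `rootAdd` has value -z and derivative σ.
The factor 1/σ normalises the derivative to 1. -/
lemma outCoord_facts (hz : z ≠ 0) (hε : ‖2 * ε‖ < ‖z ^ 2‖)
    (hσ : σ = Complex.sqrt (1 - 2 * ε / z ^ 2)) :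
    AnalyticAt ℂ (fun Y => z + rootAdd ε (Y / σ - z * σ)) 0 ∧
      z + rootAdd ε (0 / σ - z * σ) = 0 ∧
      HasDerivAt (fun Y => z + rootAdd ε (Y / σ - z * σ)) 1 0 := by
  have hε' : ‖2 * ε‖ < ‖(-z) ^ 2‖ := by rwa [neg_sq]
  have hσ0 : σ ≠ 0 := by
    rw [hσ]
    exact sqrt_ne_zero (Complex.slitPlane_ne_zero (one_sub_div_mem_slitPlane hε))
  have hu : rootSub ε (-z) = 0 / σ - z * σ := by rw [rootSub_neg, ← hσ]; ring
  have hu2 : ‖2 * ε‖ < ‖(0 / σ - z * σ) ^ 2 + 2 * ε‖ := by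
    rw [← hu, rootSub_sq hε', neg_sq, sub_add_cancel]
    exact hε
  have hr : rootAdd ε (0 / σ - z * σ) = -z := by rw [← hu, rootAdd_rootSub hε']
  have hl : HasDerivAt (fun Y : ℂ => Y / σ - z * σ) (1 / σ) 0 :=
    ((hasDerivAt_id (0 : ℂ)).div_const σ).sub_const _
  have hla : AnalyticAt ℂ (fun Y : ℂ => Y / σ - z * σ) 0 := by fun_prop
  have h1 : AnalyticAt ℂ (fun Y => rootAdd ε (Y / σ - z * σ)) 0 :=
    AnalyticAt.fun_comp (g := rootAdd ε) (f := fun Y : ℂ => Y / σ - z * σ)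
      (analyticAt_rootAdd hu2) hla
  have h2 : HasDerivAt (fun Y => rootAdd ε (Y / σ - z * σ)) _ 0 :=
    HasDerivAt.comp (h₂ := rootAdd ε) (h := fun Y : ℂ => Y / σ - z * σ) 0
      (hasDerivAt_rootAdd hu2) hl
  refine ⟨analyticAt_const.add h1, by rw [hr, add_neg_cancel], ?_⟩
  have h3 : (0 / σ - z * σ) / rootAdd ε (0 / σ - z * σ) * (1 / σ) = 1 := by
    rw [hr]
    field_simp
    ring
  rw [h3] at h2
  exact h2.const_add z

/-- Clearing denominators turns the formula for the coordinate at 0, singular as written, into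
w/E(w) with E(0) = σ⁻¹. This exhibits both analyticity at 0 and the derivative σ. -/
lemma inCoord_facts (ε z : ℂ) (hσ0 : σ ≠ 0) :
    ∃ E : ℂ → ℂ, AnalyticAt ℂ E 0 ∧ E 0 = σ⁻¹ ∧
      ∀ᶠ w in 𝓝 (0 : ℂ), w ≠ 0 → w / E w = (z + rootAdd ε ((σ * w)⁻¹ - z * σ))⁻¹ := by
  set D : ℂ → ℂ := fun w => (1 - z * σ ^ 2 * w) ^ 2 + 2 * ε * (σ * w) ^ 2 with hD
  set S : ℂ → ℂ := fun w => Complex.sqrt (1 - 2 * ε * (σ * w) ^ 2 / D w) with hS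
  have hDa : AnalyticAt ℂ D 0 := by simp only [hD]; fun_prop
  have hD0 : D 0 = 1 := by simp [hD]
  have hSa : AnalyticAt ℂ S 0 := by
    refine AnalyticAt.fun_comp (g := Complex.sqrt) (analyticAt_sqrt (by simp)) ?_
    exact analyticAt_const.sub (AnalyticAt.div (by fun_prop) hDa (by simp [hD0]))
  have hS0 : S 0 = 1 := by simp [hS]
  refine ⟨fun w => z * w + (1 - z * σ ^ 2 * w) / (σ * S w), ?_, by simp [hS0], ?_⟩
  · exact AnalyticAt.add (by fun_prop) (AnalyticAt.div (by fun_prop)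
      (analyticAt_const.mul hSa) (by simp [hS0, hσ0]))
  · filter_upwards [hDa.continuousAt.eventually_ne (hD0.trans_ne one_ne_zero)] with w hDw hw
    have h1 : ((σ * w)⁻¹ - z * σ) ^ 2 + 2 * ε = D w / (σ * w) ^ 2 := by
      simp only [hD]; field_simp
    have h2 : rootAdd ε ((σ * w)⁻¹ - z * σ) = (1 - z * σ ^ 2 * w) / (σ * S w) / w := by
      rw [rootAdd, h1]
      have : 2 * ε / (D w / (σ * w) ^ 2) = 2 * ε * (σ * w) ^ 2 / D w := by field_simp
      rw [this]
      change _ / S w = _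
      have h3 : (σ * w)⁻¹ - z * σ = (1 - z * σ ^ 2 * w) / (σ * w) := by field_simp
      rw [h3, div_div, div_div]
      ring_nf
    rw [h2]
    rw [show z + (1 - z * σ ^ 2 * w) / (σ * S w) / w =
      (z * w + (1 - z * σ ^ 2 * w) / (σ * S w)) / w by rw [add_div, mul_div_cancel_right₀ _ hw],
      inv_div]

/-! ### The gluing map near the incoming puncture. -/

lemma gluing_facts (ε z : ℂ) (hσ0 : σ ≠ 0) :
    ∃ D : ℂ → ℂ, AnalyticAt ℂ D 0 ∧ D 0 ≠ 0 ∧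
      ∀ᶠ x in 𝓝 (0 : ℂ), x ≠ 0 → x / D x = (σ * (rootSub ε (x⁻¹ - z) + z * σ))⁻¹ := by
  set S : ℂ → ℂ := fun x => Complex.sqrt (1 - 2 * ε * x ^ 2 / (1 - z * x) ^ 2) with hS
  have hSa : AnalyticAt ℂ S 0 := by
    refine AnalyticAt.fun_comp (g := Complex.sqrt) (analyticAt_sqrt (by simp)) ?_
    exact analyticAt_const.sub (AnalyticAt.div (by fun_prop) (by fun_prop) (by simp))
  have hS0 : S 0 = 1 := by simp [hS]
  refine ⟨fun x => σ * ((1 - z * x) * S x + z * σ * x), ?_, by simp [hS0, hσ0], ?_⟩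
  · fun_prop
  · filter_upwards with x hx
    have h3 : x⁻¹ - z = (1 - z * x) / x := by field_simp
    have h1 : 2 * ε / (x⁻¹ - z) ^ 2 = 2 * ε * x ^ 2 / (1 - z * x) ^ 2 := by
      rw [h3, div_pow, div_div_eq_mul_div]
    have h2 : rootSub ε (x⁻¹ - z) = (1 - z * x) / x * S x := by
      rw [rootSub, h1, h3]
    rw [h2, show σ * ((1 - z * x) / x * S x + z * σ) = σ * ((1 - z * x) * S x + z * σ * x) / x by
      field_simp, inv_div]

/-- The analytic isomorphism between the part of the sewn sphere which comes from the sphere with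
two outgoing punctures and the complement of a disc. -/
def gluingMap (ε z σ : ℂ) (q : Sphere) : Sphere :=
  open Classical in
  if q = ((0 : ℂ) : Sphere) then ((0 : ℂ) : Sphere)
  else invS ((σ * (rootSub ε (toC (invS q) - z) + z * σ) : ℂ) : Sphere)

lemma gluingMap_zero : gluingMap ε z σ ((0 : ℂ) : Sphere) = ((0 : ℂ) : Sphere) := if_pos rfl

lemma gluingMap_of_ne {q : Sphere} (hq : q ≠ ((0 : ℂ) : Sphere)) : gluingMap ε z σ q =
    invS ((σ * (rootSub ε (toC (invS q) - z) + z * σ) : ℂ) : Sphere) := if_neg hq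

lemma mdifferentiableAt_gluingMap {q : Sphere} (hq : q ≠ ((0 : ℂ) : Sphere))
    (hy : ‖2 * ε‖ < ‖(toC (invS q) - z) ^ 2‖) :
    MDifferentiableAt 𝓘(ℂ, ℂ) 𝓘(ℂ, ℂ) (gluingMap ε z σ) q := by
  have h1 : DifferentiableAt ℂ (fun y => σ * (rootSub ε (y - z) + z * σ)) (toC (invS q)) := by
    have := (AnalyticAt.fun_comp (g := rootSub ε) (f := fun y => y - z) (x := toC (invS q))
      (analyticAt_rootSub hy) (by fun_prop)).differentiableAt
    fun_prop
  have h2 := (mdifferentiableAt_invS_coe _).comp q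
    ((mdifferentiableAt_iff_differentiableAt.mpr h1).comp q (mdifferentiableAt_toC_invS hq))
  refine h2.congr_of_eventuallyEq ?_
  filter_upwards [isOpen_ne.mem_nhds hq] with p hp
  exact gluingMap_of_ne hp

/-- In the coordinate w the map has a removable singularity at 0 with value 0. This justifies the
exceptional value in `gluingMap` and yields its holomorphy there. -/
lemma exists_gluingMap_zero (ε z : ℂ) (hσ0 : σ ≠ 0) :
    ∃ g : ℂ → ℂ, AnalyticAt ℂ g 0 ∧ g 0 = 0 ∧
      (∀ᶠ x in 𝓝 (0 : ℂ), x ≠ 0 → g x ≠ 0 ∧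
        g x = (σ * (rootSub ε (x⁻¹ - z) + z * σ))⁻¹) ∧
      ∀ᶠ p in 𝓝 ((0 : ℂ) : Sphere), gluingMap ε z σ p = (g (toC p) : Sphere) := by
  obtain ⟨D, hD, hD0, hg⟩ := gluing_facts ε z hσ0
  have h2 : ∀ᶠ x in 𝓝 (0 : ℂ), x ≠ 0 → x / D x ≠ 0 ∧
      x / D x = (σ * (rootSub ε (x⁻¹ - z) + z * σ))⁻¹ := by
    filter_upwards [hg, hD.continuousAt.eventually_ne hD0] with x h1 h2 hx
    exact ⟨div_ne_zero hx h2, h1 hx⟩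
  refine ⟨_, (analyticAt_id_div hD hD0).1, zero_div _, h2, ?_⟩
  have hc : Tendsto toC (𝓝 ((0 : ℂ) : Sphere)) (𝓝 0) :=
    (mdifferentiableAt_toC (OnePoint.coe_ne_infty 0)).continuousAt
  filter_upwards [hc.eventually h2, isOpen_ne.mem_nhds (OnePoint.coe_ne_infty (0 : ℂ))] with p h3 h4
  by_cases hp : p = ((0 : ℂ) : Sphere)
  · rw [hp, gluingMap_zero, toC_coe, zero_div]
  · have h5 : toC p ≠ 0 := fun h => hp (by rw [← coe_toC h4, h])
    obtain ⟨h6, h7⟩ := h3 h5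
    rw [gluingMap_of_ne hp, toC_invS, h7, invS_coe]
    intro h
    rw [h7, h, inv_zero] at h6
    exact h6 rfl

end

/-! ### Existence of the sewing -/

/-- Injectivity comes from (1 - 2εg²)(1 + 2εw²) = 1: the value g determines the radicand, hence the
root, hence w. The bound 1/2 keeps the preimages of the closed disc inside U. -/
lemma exists_tube_div_sqrt {ε : ℂ} {r : ℝ} (hε : ‖2 * ε‖ * r ^ 2 < 1 / 2) :
    ∃ t : Tube, t.pt = ((0 : ℂ) : Sphere) ∧
      (∀ p, t.coord p = toC p / Complex.sqrt (1 + 2 * ε * toC p ^ 2)) ∧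
      Metric.closedBall 0 r ⊆ t.coord '' t.nbhd := by
  set U : Set ℂ := {w | ‖2 * ε * w ^ 2‖ < 1} with hU
  have hUo : IsOpen U := isOpen_lt (by fun_prop) continuous_const
  have hslit : ∀ w ∈ U, 1 + 2 * ε * w ^ 2 ∈ Complex.slitPlane := fun w hw =>
    Complex.mem_slitPlane_of_norm_lt_one hw
  set g : ℂ → ℂ := fun w => w / Complex.sqrt (1 + 2 * ε * w ^ 2) with hg
  have hgd : DifferentiableOn ℂ g U := by
    intro w hw
    have h1 : AnalyticAt ℂ (fun w : ℂ => 1 + 2 * ε * w ^ 2) w := by fun_prop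
    exact (analyticAt_id.div (AnalyticAt.fun_comp (f := fun w : ℂ => 1 + 2 * ε * w ^ 2) (x := w)
      (analyticAt_sqrt (hslit w hw)) h1)
      (sqrt_ne_zero (Complex.slitPlane_ne_zero (hslit w hw)))).differentiableAt.differentiableWithinAt
  have hgsq : ∀ w ∈ U, (1 - 2 * ε * g w ^ 2) * (1 + 2 * ε * w ^ 2) = 1 := by
    intro w hw
    have h0 := Complex.slitPlane_ne_zero (hslit w hw)
    simp only [hg]
    rw [div_pow, pow_two (Complex.sqrt _), sqrt_mul_self]
    field_simp
    ring
  have hgi : Set.InjOn g U := by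
    intro x hx y hy hxy
    have h1 := hgsq x hx
    have h2 := hgsq y hy
    rw [← hxy] at h2
    have h3 : 1 + 2 * ε * x ^ 2 = 1 + 2 * ε * y ^ 2 :=
      mul_left_cancel₀ (left_ne_zero_of_mul_eq_one h1) (h1.trans h2.symm)
    simp only [hg, ← h3] at hxy
    exact (div_left_inj' (sqrt_ne_zero (Complex.slitPlane_ne_zero (hslit x hx)))).mp hxy
  have hU0 : (0 : ℂ) ∈ U := by simp [hU]
  refine ⟨Tube.ofFun g U 0 hUo hgd hgi hU0 (by simp [hg]), rfl, fun p => rfl, ?_⟩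
  intro v hv
  have hv' : ‖v‖ ≤ r := by simpa using hv
  have hb : ‖2 * ε * v ^ 2‖ < 1 / 2 := by
    rw [norm_mul, norm_pow]
    exact lt_of_le_of_lt (by gcongr) hε
  have hs := one_sub_mem_slitPlane (hb.trans (by norm_num))
  have hs0 := Complex.slitPlane_ne_zero hs
  have hsq := sqrt_mul_self (1 - 2 * ε * v ^ 2)
  have hsq0 := sqrt_ne_zero hs0
  -- The explicit preimage of v. Here 2εw² = b/(1 - b) with b = 2εv², of modulus below 1 when |b| <
  -- 1/2.
  set w := v / Complex.sqrt (1 - 2 * ε * v ^ 2) with hw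
  have hw2 : 2 * ε * w ^ 2 = 2 * ε * v ^ 2 / (1 - 2 * ε * v ^ 2) := by
    rw [hw, div_pow, pow_two (Complex.sqrt _), hsq, mul_div_assoc]
  have hwU : w ∈ U := by
    change ‖2 * ε * w ^ 2‖ < 1
    rw [hw2, norm_div, div_lt_one (norm_pos_iff.mpr hs0)]
    have := norm_sub_norm_le (1 : ℂ) (2 * ε * v ^ 2)
    rw [norm_one] at this
    linarith
  refine ⟨(w : Sphere), ⟨w, hwU, rfl⟩, ?_⟩
  change w / Complex.sqrt (1 + 2 * ε * w ^ 2) = v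
  have h1 : 1 + 2 * ε * w ^ 2 = (1 - 2 * ε * v ^ 2)⁻¹ := by
    rw [hw2]; field_simp; ring
  rw [h1, sqrt_inv hs, hw, div_inv_eq_mul, div_mul_cancel₀ _ hsq0]

lemma exists_tube_inv_sub (z : ℂ) (r : ℝ) :
    ∃ s : Tube, s.pt = invS (z : Sphere) ∧ (∀ p, s.coord p = toC (invS p) - z) ∧
      Metric.closedBall 0 r ⊆ s.coord '' s.nbhd ∧ ((0 : ℂ) : Sphere) ∉ s.nbhd := by
  refine ⟨(Tube.ofFun (fun w => w - z) Set.univ z isOpen_univ (by fun_prop)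
    (sub_left_injective.injOn) trivial (sub_self z)).inv, rfl, fun p => rfl, ?_, ?_⟩
  · intro v _
    refine ⟨invS ((v + z : ℂ) : Sphere), ⟨v + z, trivial, (invS_invS _).symm⟩, ?_⟩
    change toC (invS (invS _)) - z = v
    rw [invS_invS, toC_coe, add_sub_cancel_right]
  · rintro ⟨w, -, hw⟩
    rw [invS_zero] at hw
    exact OnePoint.coe_ne_infty w hw

/-- The uniqueness computation read backwards: the formulas forced on the coordinates of a sewing
are taken as definitions, and F and G as the maps u ↦ σ(u + zσ) and y ↦ σ(`rootSub`(y - z) + zσ) in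
the coordinate 1/w. -/
theorem exists_isSewing {z : ℂˣ} {ε : ℂ} (hε : 8 * ‖2 * ε‖ < ‖(z : ℂ)‖ ^ 2) :
    ∃ Q : KStarSpace 1, KStarSpace.IsSewing 1 (omegaElt ε) (pantsElt z) Q := by
  have hz : (z : ℂ) ≠ 0 := z.ne_zero
  have hzn : 0 < ‖(z : ℂ)‖ := norm_pos_iff.mpr hz
  have hεz : ‖2 * ε‖ < ‖(z : ℂ) ^ 2‖ := by
    rw [norm_pow]
    nlinarith [norm_nonneg (2 * ε)]
  obtain ⟨σ, hσ⟩ : ∃ σ, σ = Complex.sqrt (1 - 2 * ε / (z : ℂ) ^ 2) := ⟨_, rfl⟩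
  have hσ0 : σ ≠ 0 := by
    rw [hσ]
    exact sqrt_ne_zero (Complex.slitPlane_ne_zero (one_sub_div_mem_slitPlane hεz))
  obtain ⟨hha, hh0, hhd⟩ := outCoord_facts hz hεz hσ
  obtain ⟨E, hEa, hE0, hE⟩ := inCoord_facts ε (z : ℂ) hσ0
  have hE0' : E 0 ≠ 0 := by rw [hE0]; exact inv_ne_zero hσ0
  obtain ⟨hka, hkd⟩ := analyticAt_id_div hEa hE0'
  rw [hE0, inv_inv] at hkd
  obtain ⟨A, hA⟩ := exists_localSeries hha hh0 hhd one_ne_zero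
  obtain ⟨B, hB⟩ := exists_localSeries hka (zero_div _) hkd hσ0
  obtain ⟨ρ₁, hρ₁pt, hρ₁c⟩ := exists_tube_zero hha hh0 hhd one_ne_zero
  obtain ⟨ρ₀, hρ₀pt, hρ₀c⟩ := exists_tube_zero hka (zero_div _) hkd hσ0
  -- Any inverses r₁⁻¹ < r₂⁻¹ < |z| keep ∞ outside the disc about 1/z. The choice |z|/2 turns the
  -- hypothesis on ε into ‖2ε‖ r₁² < 1/2.
  set r₁ : ℝ := 2 / ‖(z : ℂ)‖ with hr₁
  set r₂ : ℝ := 3 / (2 * ‖(z : ℂ)‖) with hr₂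
  have hr₁i : r₁⁻¹ = ‖(z : ℂ)‖ / 2 := by rw [hr₁, inv_div]
  have hr₂i : r₂⁻¹ = 2 * ‖(z : ℂ)‖ / 3 := by rw [hr₂, inv_div]
  have hr₁p : 0 < r₁ := by positivity
  have hr₂p : 0 < r₂ := by positivity
  have hrr : r₁⁻¹ < r₂⁻¹ := by rw [hr₁i, hr₂i]; linarith
  have hr : r₂ < r₁ := (inv_lt_inv₀ hr₁p hr₂p).mp hrr
  obtain ⟨t, htpt, htc, htb⟩ := exists_tube_div_sqrt (ε := ε) (r := r₁) (by
    rw [hr₁, div_pow, mul_div_assoc', div_lt_iff₀ (by positivity)]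
    linarith)
  obtain ⟨s, hspt, hsc, hsb, hs0⟩ := exists_tube_inv_sub (z : ℂ) r₂⁻¹
  obtain ⟨hεr, hdt⟩ := disc_of_coord_sqrt htpt (Eventually.of_forall htc) hr₁p htb
  have hds := disc_of_coord_inv_sub (Eventually.of_forall hsc) (inv_pos.mpr hr₂p) hsb
    (fun h => hs0 h.1)
  obtain ⟨g, hga, hg0, hg, hGg⟩ := exists_gluingMap_zero (ε := ε) (z := (z : ℂ)) hσ0
  have hrr2 : r₁⁻¹ ^ 2 < r₂⁻¹ ^ 2 := by gcongr
  -- the tubes of the sphere with two outgoing punctures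
  let τ₀ : Tube := Tube.ofFun (fun w => w) Set.univ 0 isOpen_univ (by fun_prop)
    (fun _ _ _ _ h => h) trivial rfl
  have hinf : s.pt ≠ OnePoint.infty := by
    rw [hspt, ne_eq, invS_eq_infty]
    exact fun h => hz (OnePoint.coe_injective h)
  have hs0' : s.pt ≠ ((0 : ℂ) : Sphere) := by
    rw [hspt]
    exact invS_coe_ne_zero _
  have h0inf : ((0 : ℂ) : Sphere) ≠ OnePoint.infty := OnePoint.coe_ne_infty 0
  have hτpt : τ₀.inv.pt = OnePoint.infty := invS_zero
  have hτ₀pt : τ₀.pt = ((0 : ℂ) : Sphere) := rfl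
  have hρpt : ρ₁.inv.pt = OnePoint.infty := by
    change invS ρ₁.pt = _
    rw [hρ₁pt, invS_zero]
  -- the discs
  have hinfs : OnePoint.infty ∉ s.disc r₂⁻¹ := by
    have h1 := (hds 0).1 r₂⁻¹ le_rfl
    rw [invS_zero, zero_sub, norm_neg] at h1
    rw [h1, hr₂i, not_le]
    linarith
  have h0s : ∀ r, ((0 : ℂ) : Sphere) ∉ s.disc r := fun r h => hs0 h.1
  have h0t : ∀ r, 0 ≤ r → ((0 : ℂ) : Sphere) ∈ t.disc r := by
    intro r hr
    rw [← htpt]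
    exact ⟨t.pt_mem, by rw [t.coord_pt, norm_zero]; exact hr⟩
  have hpF : ∀ p ∈ (t.disc r₂)ᶜ, ∃ u : ℂ, p = invS (u : Sphere) ∧
      ‖u ^ 2 + 2 * ε‖ < r₂⁻¹ ^ 2 := by
    intro p hp
    have hp0 : p ≠ ((0 : ℂ) : Sphere) := fun h => hp (h ▸ h0t r₂ hr₂p.le)
    refine ⟨toC (invS p), (invS_toC_invS hp0).symm, ?_⟩
    rw [← not_le]
    intro h
    have := ((hdt _).1 r₂ hr.le hr₂p).mpr h
    rw [invS_toC_invS hp0] at this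
    exact hp this
  have hqG : ∀ q ∈ (s.disc r₁⁻¹)ᶜ, q ≠ ((0 : ℂ) : Sphere) → ∃ y : ℂ, q = invS (y : Sphere) ∧
      r₁⁻¹ < ‖y - z‖ := by
    intro q hq hq0
    refine ⟨toC (invS q), (invS_toC_invS hq0).symm, ?_⟩
    rw [← not_le]
    intro h
    have := ((hds _).1 _ hrr.le).mpr h
    rw [invS_toC_invS hq0] at this
    exact hq this
  have hsq : ∀ x : ℂ, r₁⁻¹ < ‖x‖ → ‖2 * ε‖ < ‖x ^ 2‖ := by
    intro x hx
    rw [norm_pow]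
    exact hεr.trans (by gcongr)
  set F : Sphere → Sphere := fun p => invS ((σ * (toC (invS p) + z * σ) : ℂ) : Sphere) with hFdef
  set G : Sphere → Sphere := gluingMap ε (z : ℂ) σ with hGdef
  have hFu : ∀ u : ℂ, F (invS (u : Sphere)) = invS ((σ * (u + z * σ) : ℂ) : Sphere) := by
    intro u
    simp only [hFdef]
    rw [invS_invS, toC_coe]
  have hG0 : G ((0 : ℂ) : Sphere) = ((0 : ℂ) : Sphere) := gluingMap_zero
  have hGy : ∀ y : ℂ, G (invS (y : Sphere)) =
      invS ((σ * (rootSub ε (y - z) + z * σ) : ℂ) : Sphere) := by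
    intro y
    rw [hGdef, gluingMap_of_ne (invS_coe_ne_zero y), invS_invS, toC_coe]
  have hlin : ∀ u u' : ℂ, invS ((σ * (u + z * σ) : ℂ) : Sphere) =
      invS ((σ * (u' + z * σ) : ℂ) : Sphere) → u = u' := by
    intro u u' h
    exact add_right_cancel (mul_left_cancel₀ hσ0
      (OnePoint.coe_injective (invHomeo.injective h)))
  have hFd : MDifferentiableOn 𝓘(ℂ, ℂ) 𝓘(ℂ, ℂ) F (t.disc r₂)ᶜ := by
    intro p hp
    have hp0 : p ≠ ((0 : ℂ) : Sphere) := fun h => hp (h ▸ h0t r₂ hr₂p.le)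
    have h1 : DifferentiableAt ℂ (fun u : ℂ => σ * (u + z * σ)) (toC (invS p)) := by fun_prop
    exact ((mdifferentiableAt_invS_coe _).comp p ((mdifferentiableAt_iff_differentiableAt.mpr
      h1).comp p (mdifferentiableAt_toC_invS hp0))).mdifferentiableWithinAt
  have hGd : MDifferentiableOn 𝓘(ℂ, ℂ) 𝓘(ℂ, ℂ) G (s.disc r₁⁻¹)ᶜ := by
    intro q hq
    refine MDifferentiableAt.mdifferentiableWithinAt ?_
    by_cases hq0 : q = ((0 : ℂ) : Sphere)
    · rw [hq0]
      have h1 := (mdifferentiableAt_coe (g 0)).comp (((0 : ℂ) : Sphere))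
        (MDifferentiableAt.comp (((0 : ℂ) : Sphere)) (g := g) (f := toC)
          (mdifferentiableAt_iff_differentiableAt.mpr hga.differentiableAt)
          (mdifferentiableAt_toC h0inf))
      exact h1.congr_of_eventuallyEq hGg
    · obtain ⟨y, rfl, hy⟩ := hqG q hq hq0
      refine mdifferentiableAt_gluingMap hq0 ?_
      rw [invS_invS, toC_coe]
      exact hsq _ hy
  have hFi : Set.InjOn F (t.disc r₂)ᶜ := by
    intro p hp p' hp' h
    obtain ⟨u, rfl, -⟩ := hpF p hp
    obtain ⟨u', rfl, -⟩ := hpF p' hp'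
    rw [hFu, hFu] at h
    rw [hlin u u' h]
  have hGi : Set.InjOn G (s.disc r₁⁻¹)ᶜ := by
    intro q hq q' hq' h
    by_cases hq0 : q = ((0 : ℂ) : Sphere) <;> by_cases hq0' : q' = ((0 : ℂ) : Sphere)
    · rw [hq0, hq0']
    · obtain ⟨y', rfl, -⟩ := hqG q' hq' hq0'
      rw [hq0, hG0, hGy] at h
      exact absurd h.symm (invS_coe_ne_zero _)
    · obtain ⟨y, rfl, -⟩ := hqG q hq hq0
      rw [hq0', hG0, hGy] at h
      exact absurd h (invS_coe_ne_zero _)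
    · obtain ⟨y, rfl, hy⟩ := hqG q hq hq0
      obtain ⟨y', rfl, hy'⟩ := hqG q' hq' hq0'
      rw [hGy, hGy] at h
      have h1 := congrArg (rootAdd ε) (hlin _ _ h)
      rw [rootAdd_rootSub (hsq _ hy), rootAdd_rootSub (hsq _ hy')] at h1
      rw [sub_left_injective h1]
  have hsurj : F '' (t.disc r₂)ᶜ ∪ G '' (s.disc r₁⁻¹)ᶜ = Set.univ := by
    refine Set.eq_univ_of_forall fun p => ?_
    by_cases hp0 : p = ((0 : ℂ) : Sphere)
    · exact Or.inr ⟨_, h0s _, by rw [hG0, hp0]⟩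
    · obtain ⟨u, hu⟩ : ∃ u : ℂ, p = invS ((σ * (u + z * σ) : ℂ) : Sphere) := by
        refine ⟨toC (invS p) / σ - z * σ, ?_⟩
        rw [sub_add_cancel, mul_div_cancel₀ _ hσ0, invS_toC_invS hp0]
      by_cases hu2 : ‖u ^ 2 + 2 * ε‖ < r₂⁻¹ ^ 2
      · refine Or.inl ⟨invS (u : Sphere), fun h => ?_, by rw [hFu, hu]⟩
        exact absurd (((hdt u).1 r₂ hr.le hr₂p).mp h) (not_le.mpr hu2)
      · have hu3 : r₁⁻¹ ^ 2 < ‖u ^ 2 + 2 * ε‖ := hrr2.trans_le (not_lt.mp hu2)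
        have hu4 : ‖2 * ε‖ < ‖u ^ 2 + 2 * ε‖ := hεr.trans hu3
        refine Or.inr ⟨invS ((z + rootAdd ε u : ℂ) : Sphere), fun h => ?_, ?_⟩
        · have h1 := ((hds _).1 _ hrr.le).mp h
          rw [add_sub_cancel_left] at h1
          rw [← rootAdd_sq hu4, norm_pow] at hu3
          exact absurd h1 (not_le.mpr (lt_of_pow_lt_pow_left₀ 2 (norm_nonneg _) hu3))
        · rw [hGy, add_sub_cancel_left, rootSub_rootAdd hu4, hu]
  have hFG : ∀ p ∈ (t.disc r₂)ᶜ, ∀ q ∈ (s.disc r₁⁻¹)ᶜ, F p = G q ↔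
      p ∈ t.disc r₁ ∧ q ∈ s.disc r₂⁻¹ ∧ s.coord q = (t.coord p)⁻¹ := by
    intro p hp q hq
    obtain ⟨u, rfl, hu⟩ := hpF p hp
    by_cases hq0 : q = ((0 : ℂ) : Sphere)
    · rw [hq0, hG0, hFu]
      exact ⟨fun h => absurd h (invS_coe_ne_zero _), fun h => absurd h.2.1 (h0s _)⟩
    · obtain ⟨y, rfl, hy⟩ := hqG q hq hq0
      rw [hFu, hGy]
      constructor
      · intro h
        have h1 := hlin _ _ h
        have h2 : u ^ 2 + 2 * ε = (y - z) ^ 2 := by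
          rw [h1, rootSub_sq (hsq _ hy), sub_add_cancel]
        have h3 : invS (u : Sphere) ∈ t.disc r₁ := by
          refine ((hdt u).1 r₁ le_rfl hr₁p).mpr ?_
          rw [h2, norm_pow]
          gcongr
        have h4 : invS (y : Sphere) ∈ s.disc r₂⁻¹ := by
          refine ((hds y).1 _ le_rfl).mpr ?_
          rw [h2, norm_pow] at hu
          exact (lt_of_pow_lt_pow_left₀ 2 (inv_pos.mpr hr₂p).le hu).le
        refine ⟨h3, h4, ?_⟩
        rw [(hdt u).2 h3, (hds y).2 h4, inv_inv, h1, rootAdd_rootSub (hsq _ hy)]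
      · rintro ⟨h3, h4, h5⟩
        rw [(hdt u).2 h3, (hds y).2 h4, inv_inv] at h5
        have h6 := ((hdt u).1 r₁ le_rfl hr₁p).mp h3
        rw [h5, rootSub_rootAdd (hεr.trans_le h6)]
  -- The constant zσ in the maps is chosen for this: `rootSub` takes the value -zσ at -z.
  have hGinf : G OnePoint.infty = OnePoint.infty := by
    have h1 := hGy 0
    rw [invS_zero, zero_sub, rootSub_neg, ← hσ, neg_add_cancel, mul_zero, invS_zero] at h1
    exact h1
  have hTout : TubeMap G τ₀.inv ρ₁.inv := by
    refine ⟨by rw [hτpt, hρpt, hGinf], ?_⟩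
    rw [hτpt]
    have hc : Tendsto (fun p : Sphere => toC (invS p) - z) (𝓝 OnePoint.infty) (𝓝 (0 - z)) := by
      have := (mdifferentiableAt_toC_invS h0inf.symm).continuousAt.tendsto
      rw [invS_infty, toC_coe] at this
      exact this.sub_const _
    have ho : IsOpen {x : ℂ | ‖2 * ε‖ < ‖x ^ 2‖} := isOpen_lt continuous_const (by fun_prop)
    filter_upwards [isOpen_ne.mem_nhds h0inf.symm,
      hc.eventually_mem (ho.mem_nhds (by simpa using hεz))] with p h1 h2
    change ρ₁.coord (invS (G p)) = toC (invS p)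
    have h3 : invS (G p) = ((σ * (rootSub ε (toC (invS p) - z) + z * σ) : ℂ) : Sphere) := by
      rw [hGdef, gluingMap_of_ne h1, invS_invS]
    rw [h3, hρ₁c, toC_coe, mul_div_cancel_left₀ _ hσ0, add_sub_cancel_right, rootAdd_rootSub h2]
    ring
  have hTin : TubeMap G τ₀ ρ₀ := by
    refine ⟨by rw [hτ₀pt, hρ₀pt, hG0], ?_⟩
    rw [hτ₀pt]
    have hc : Tendsto toC (𝓝 ((0 : ℂ) : Sphere)) (𝓝 0) :=
      (mdifferentiableAt_toC h0inf).continuousAt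
    have hgc : Tendsto g (𝓝 0) (𝓝 0) := by
      have := hga.continuousAt.tendsto
      rwa [hg0] at this
    have hsub : ∀ᶠ x in 𝓝 (0 : ℂ), x ≠ 0 → ‖2 * ε‖ < ‖(x⁻¹ - (z : ℂ)) ^ 2‖ := by
      refine eventually_nhdsWithin_iff (s := {0}ᶜ).mp ?_
      have h1 : Tendsto (fun x : ℂ => ‖x⁻¹ - (z : ℂ)‖) (𝓝[≠] 0) atTop :=
        tendsto_norm_cobounded_atTop.comp
          ((tendsto_sub_const_cobounded (z : ℂ)).comp tendsto_inv₀_nhdsNE_zero)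
      exact (h1.eventually_gt_atTop r₁⁻¹).mono fun x hx => hsq _ hx
    filter_upwards [hGg, hc.eventually hg, hc.eventually hsub, hc.eventually (hgc.eventually hE)]
      with p h1 h2 h3 h4
    change ρ₀.coord (G p) = toC p
    rw [h1, hρ₀c, toC_coe]
    by_cases hx : toC p = 0
    · rw [hx, hg0, zero_div]
    · obtain ⟨h5, h6⟩ := h2 hx
      rw [h4 h5, h6, mul_inv, inv_inv, inv_mul_cancel_left₀ hσ0, add_sub_cancel_right,
        rootAdd_rootSub (h3 hx), add_sub_cancel, inv_inv]
  refine ⟨KStarSpace.mk₁ A (Units.mk0 σ hσ0) B,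
    ⟨[], [t], by simp⟩,
    ⟨[τ₀.inv, s], [τ₀], by simp [hτpt, hτ₀pt, hinf.symm, h0inf.symm, hs0']⟩,
    ⟨[ρ₁.inv], [ρ₀], by simp [hρpt, hρ₀pt, h0inf.symm]⟩,
    represents_omegaElt_iff.mpr ⟨rfl, t, rfl, htpt, Eventually.of_forall htc⟩,
    represents_pantsElt_iff.mpr ⟨⟨τ₀.inv, s, rfl, ⟨hτpt, Eventually.of_forall fun p => rfl⟩, hspt,
      Eventually.of_forall hsc⟩, τ₀, rfl, hτ₀pt, Eventually.of_forall fun p => rfl⟩,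
    represents_mk₁_iff.mpr ⟨⟨ρ₁.inv, rfl, hρpt, ?_⟩, ρ₀, rfl, hρ₀pt, ?_⟩,
    [], [], [τ₀.inv], [], t, s, rfl, rfl, rfl, rfl, r₁, r₂, hr₂p, hr, htb, hsb, by simp, ?_,
    F, G, hFd, hGd, hFi, hGi, hsurj, hFG, ?_, ?_⟩
  · rw [hρpt]
    have hc : Tendsto (fun p : Sphere => toC (invS p)) (𝓝 OnePoint.infty) (𝓝 0) := by
      have := (mdifferentiableAt_toC_invS h0inf.symm).continuousAt.tendsto
      rwa [invS_infty, toC_coe] at this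
    filter_upwards [hc.eventually hA] with p hp
    rw [hp]
    exact hρ₁c (invS p)
  · rw [hρ₀pt]
    have hc : Tendsto toC (𝓝 ((0 : ℂ) : Sphere)) (𝓝 0) :=
      (mdifferentiableAt_toC h0inf).continuousAt
    filter_upwards [hc.eventually hB] with p hp
    rw [Units.val_mk0, hp]
    exact hρ₀c p
  · simpa [hτpt, hτ₀pt] using ⟨hinfs, h0s _⟩
  · simpa using hTout
  · simpa using hTin

/-! ### Uniqueness of the sewing -/

/-- A punctured neighbourhood suffices because both functions vanish at 0. It is needed because the
formula for the incoming coordinate is stated only away from 0. -/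
lemma eq_of_seriesFun_localSeries {a : ℂ} (ha : a ≠ 0) {A A' : H}
    (h : ∀ᶠ x in 𝓝[≠] (0 : ℂ), seriesFun (localSeries a A.1) x =
      seriesFun (localSeries a A'.1) x) : A = A' := by
  have hs : ∀ A : H, IsSeries (localSeries a A.1) (seriesFun (localSeries a A.1)) := fun A => by
    rw [localSeries_eq]
    exact ((isSeries_C a).mul (AbsConv.isSeries A.2)).absConv.isSeries
  have h' : ∀ᶠ x in 𝓝 (0 : ℂ), seriesFun (localSeries a A.1) x =
      seriesFun (localSeries a A'.1) x := by
    rw [eventually_nhdsWithin_iff] at h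
    filter_upwards [h] with x hx
    by_cases hx0 : x = 0
    · rw [hx0, (hasDerivAt_seriesFun_localSeries a A).1,
        (hasDerivAt_seriesFun_localSeries a A').1]
    · exact hx hx0
  have h1 := (hs A).unique ((hs A').congr h')
  rw [localSeries_eq, localSeries_eq] at h1
  have hC : PowerSeries.C a ≠ 0 := fun h => ha (by
    simpa using congrArg (PowerSeries.coeff 0) h)
  exact Subtype.ext (expVf_X_injective (mul_left_cancel₀ hC h1))

theorem KStarSpace.IsSewing.unique {ε : ℂ} {z : ℂˣ} {Q Q' : KStarSpace 1}
    (h : KStarSpace.IsSewing 1 (omegaElt ε) (pantsElt z) Q)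
    (h' : KStarSpace.IsSewing 1 (omegaElt ε) (pantsElt z) Q') : Q = Q' := by
  obtain ⟨A, a, B, rfl⟩ := exists_eq_mk₁ Q
  obtain ⟨A', a', B', rfl⟩ := exists_eq_mk₁ Q'
  obtain ⟨h1, h2, h3⟩ := h.coordinates
  obtain ⟨h1', h2', h3'⟩ := h'.coordinates
  obtain rfl : a = a' := Units.ext (h1.trans h1'.symm)
  obtain rfl : A = A' := by
    refine eq_of_seriesFun_localSeries one_ne_zero (eventually_nhdsWithin_of_eventually_nhds ?_)
    filter_upwards [h2, h2'] with x hx hx'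
    rw [hx, hx']
  obtain rfl : B = B' := by
    refine eq_of_seriesFun_localSeries a.ne_zero ?_
    filter_upwards [h3, h3'] with x hx hx'
    rw [hx, hx']
  rfl

/-! ### The algebraic equations of the coordinates -/

/-- Squares h - z = W(Y/a - za). The relation z²a² = z² - 2ε absorbs the 2ε, so a is the only
parameter left. -/
lemma KStarSpace.IsSewing.quadratic_out {ε : ℂ} {z : ℂˣ} {A : H} {a : ℂˣ} {B : H}
    (hε : ‖2 * ε‖ < ‖(z : ℂ) ^ 2‖)
    (h : KStarSpace.IsSewing 1 (omegaElt ε) (pantsElt z) (KStarSpace.mk₁ A a B)) :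
    expVf A.1 PowerSeries.X * expVf A.1 PowerSeries.X -
        PowerSeries.C (2 * (z : ℂ)) * expVf A.1 PowerSeries.X =
      PowerSeries.C (((a : ℂ) ^ 2)⁻¹) * PowerSeries.X ^ 2 -
        PowerSeries.C (2 * (z : ℂ)) * PowerSeries.X := by
  obtain ⟨ha, hh, -⟩ := h.coordinates
  rw [localSeries_one] at hh
  have hs := AbsConv.isSeries A.2
  have ha0 := a.ne_zero
  have hz := z.ne_zero
  have ha2 : (a : ℂ) ^ 2 = 1 - 2 * ε / (z : ℂ) ^ 2 := by rw [ha, pow_two, sqrt_mul_self]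
  have ha3 : (z : ℂ) ^ 2 * (a : ℂ) ^ 2 = (z : ℂ) ^ 2 - 2 * ε := by rw [ha2]; field_simp
  have hu : ∀ Y : ℂ, (Y / a - z * a) ^ 2 + 2 * ε =
      ((a : ℂ) ^ 2)⁻¹ * (Y * Y) - 2 * z * Y + (z : ℂ) ^ 2 := by
    intro Y
    have : (Y / a - z * a) ^ 2 = ((a : ℂ) ^ 2)⁻¹ * (Y * Y) - 2 * z * Y + (z : ℂ) ^ 2 * (a : ℂ) ^ 2 := by
      field_simp
      ring
    rw [this, ha3]
    ring
  have hnear : ∀ᶠ Y in 𝓝 (0 : ℂ), ‖2 * ε‖ < ‖(Y / a - z * a) ^ 2 + 2 * ε‖ := by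
    have ho : IsOpen {Y : ℂ | ‖2 * ε‖ < ‖(Y / a - z * a) ^ 2 + 2 * ε‖} :=
      isOpen_lt continuous_const (by fun_prop)
    refine ho.mem_nhds ?_
    change ‖2 * ε‖ < ‖((0 : ℂ) / a - z * a) ^ 2 + 2 * ε‖
    rw [hu]
    simpa using hε
  have h1 := (hs.mul hs).sub ((isSeries_C (2 * (z : ℂ))).mul hs)
  have h2 := ((isSeries_C (((a : ℂ) ^ 2)⁻¹)).mul (isSeries_X.mul isSeries_X)).sub
    ((isSeries_C (2 * (z : ℂ))).mul isSeries_X)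
  rw [pow_two PowerSeries.X]
  refine h1.unique (h2.congr ?_)
  filter_upwards [hh, hnear] with Y h3 h4
  have h5 := rootAdd_sq h4
  rw [hu] at h5
  rw [h3]
  linear_combination h5

/-- Squares 1/(ag) - z = W(1/(aw) - za), where g = k/a. The terms z² cancel by z²a² = z² - 2ε, and
multiplication by a²g²w² clears the denominators. -/
lemma KStarSpace.IsSewing.quadratic_in {ε : ℂ} {z : ℂˣ} {A : H} {a : ℂˣ} {B : H}
    (h : KStarSpace.IsSewing 1 (omegaElt ε) (pantsElt z) (KStarSpace.mk₁ A a B)) :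
    PowerSeries.X ^ 2 - PowerSeries.C (2 * (z : ℂ) * a) *
        (PowerSeries.X ^ 2 * expVf B.1 PowerSeries.X) =
      expVf B.1 PowerSeries.X * expVf B.1 PowerSeries.X - PowerSeries.C (2 * (z : ℂ) * (a : ℂ) ^ 2) *
        (PowerSeries.X * (expVf B.1 PowerSeries.X * expVf B.1 PowerSeries.X)) := by
  obtain ⟨ha, -, hk⟩ := h.coordinates
  have hs := AbsConv.isSeries B.2
  have ha0 := a.ne_zero
  have hz := z.ne_zero
  have ha2 : (a : ℂ) ^ 2 = 1 - 2 * ε / (z : ℂ) ^ 2 := by rw [ha, pow_two, sqrt_mul_self]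
  have ha3 : (z : ℂ) ^ 2 * (a : ℂ) ^ 2 = (z : ℂ) ^ 2 - 2 * ε := by rw [ha2]; field_simp
  have hks : ∀ᶠ w in 𝓝 (0 : ℂ), seriesFun (localSeries (a : ℂ) B.1) w =
      a * seriesFun (expVf B.1 PowerSeries.X) w := by
    rw [localSeries_eq]
    exact ((isSeries_C (a : ℂ)).mul hs).eq_seriesFun
  have hg0 : seriesFun (expVf B.1 PowerSeries.X) 0 = 0 := by
    rw [← hs.coeff_zero, coeff_zero_expVf_X]
  have hgd := hs.hasDerivAt
  rw [coeff_one_expVf_X] at hgd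
  have hne := hgd.eventually_ne (c := 0) one_ne_zero
  have hfar : ∀ᶠ w in 𝓝[≠] (0 : ℂ), ‖2 * ε‖ < ‖(((a : ℂ) * w)⁻¹ - z * a) ^ 2 + 2 * ε‖ := by
    have h1 : Tendsto (fun w : ℂ => (a : ℂ) * w) (𝓝[≠] 0) (𝓝[≠] 0) := by
      refine tendsto_nhdsWithin_iff.mpr ⟨?_, ?_⟩
      · have : ContinuousAt (fun w : ℂ => (a : ℂ) * w) 0 := by fun_prop
        have := this.tendsto
        rw [mul_zero] at this
        exact this.mono_left nhdsWithin_le_nhds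
      · filter_upwards [self_mem_nhdsWithin] with w hw
        exact mul_ne_zero ha0 hw
    have h2 := tendsto_norm_cobounded_atTop.comp ((tendsto_sq_add_cobounded (2 * ε)).comp
      ((tendsto_sub_const_cobounded ((z : ℂ) * a)).comp (tendsto_inv₀_nhdsNE_zero.comp h1)))
    exact h2.eventually_gt_atTop ‖2 * ε‖
  have h1 := (isSeries_X.mul isSeries_X).sub ((isSeries_C (2 * (z : ℂ) * a)).mul
    ((isSeries_X.mul isSeries_X).mul hs))
  have h2 := (hs.mul hs).sub ((isSeries_C (2 * (z : ℂ) * (a : ℂ) ^ 2)).mul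
    (isSeries_X.mul (hs.mul hs)))
  rw [pow_two PowerSeries.X]
  refine h1.unique (h2.congr ?_)
  rw [eventually_nhdsWithin_iff] at hk hne hfar
  filter_upwards [hk, hne, hfar, hks] with w h3 h4 h5 h6
  by_cases hw : w = 0
  · rw [hw, hg0]; ring
  · have h7 := h3 hw
    have h8 := h4 hw
    have h9 := rootAdd_sq (h5 hw)
    rw [h6] at h7
    set r := rootAdd ε ((a * w)⁻¹ - z * a)
    generalize seriesFun (expVf B.1 PowerSeries.X) w = g at *
    have hr : r = (a * g)⁻¹ - z := by rw [h7, inv_inv]; ring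
    rw [hr] at h9
    have h10 : ((a : ℂ) * w)⁻¹ ^ 2 - 2 * z * w⁻¹ + (z : ℂ) ^ 2 = ((a * g)⁻¹ - z) ^ 2 := by
      rw [h9]
      have : (((a : ℂ) * w)⁻¹ - z * a) ^ 2 =
          ((a : ℂ) * w)⁻¹ ^ 2 - 2 * z * w⁻¹ + (z : ℂ) ^ 2 * (a : ℂ) ^ 2 := by
        field_simp
        ring
      rw [this, ha3]
      ring
    have h11 : ((a : ℂ) * w)⁻¹ ^ 2 - 2 * z * w⁻¹ = ((a : ℂ) * g)⁻¹ ^ 2 - 2 * z * (a * g)⁻¹ := by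
      linear_combination h10
    field_simp at h11
    linear_combination -h11

/-! ### The derivative of the sewn sphere -/

lemma hasDerivAt_sqrt_one_sub {z : ℂ} (hz : z ≠ 0) :
    HasDerivAt (fun ε => Complex.sqrt (1 - 2 * ε / z ^ 2)) (-(z ^ 2)⁻¹) 0 := by
  have h1 : HasDerivAt (fun ε : ℂ => 1 - 2 * ε / z ^ 2) (-(2 * 1 / z ^ 2)) 0 :=
    (((hasDerivAt_id (0 : ℂ)).const_mul 2).div_const (z ^ 2)).const_sub 1
  have h2 : HasDerivAt Complex.sqrt (1 / 2 : ℂ) (1 - 2 * 0 / z ^ 2) := by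
    simpa using hasDerivAt_sqrt_one
  have h3 := HasDerivAt.comp (0 : ℂ) h2 h1
  rwa [show (1 / 2 : ℂ) * -(2 * 1 / z ^ 2) = -(z ^ 2)⁻¹ by field_simp] at h3

/-- The derivatives of the coordinates of a family of sewn spheres. -/
theorem hasDerivAt_of_isSewing {z : ℂˣ} {A B : ℂ → H} {a : ℂ → ℂˣ}
    (h : ∀ᶠ ε in 𝓝 (0 : ℂ), KStarSpace.IsSewing 1 (omegaElt ε) (pantsElt z)
      (KStarSpace.mk₁ (A ε) (a ε) (B ε))) :
    (A 0 = 0 ∧ a 0 = 1 ∧ B 0 = 0) ∧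
    (∀ k : ℕ+, HasDerivAt (fun ε => (A ε).1 k) (-((z : ℂ) ^ (-(k : ℤ) - 2))) 0) ∧
    HasDerivAt (fun ε => (a ε : ℂ)) (-((z : ℂ) ^ (-2 : ℤ))) 0 ∧
    ∀ k : ℕ+, HasDerivAt (fun ε => (B ε).1 k) (-((z : ℂ) ^ ((k : ℤ) - 2))) 0 := by
  have hz : (z : ℂ) ≠ 0 := z.ne_zero
  have hsmall : ∀ᶠ ε in 𝓝 (0 : ℂ), ‖2 * ε‖ < ‖(z : ℂ) ^ 2‖ := by
    have ho : IsOpen {ε : ℂ | ‖2 * ε‖ < ‖(z : ℂ) ^ 2‖} :=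
      isOpen_lt (by fun_prop) continuous_const
    exact ho.mem_nhds (by simp [hz])
  have hσ := hasDerivAt_sqrt_one_sub hz
  have haσ : ∀ᶠ ε in 𝓝 (0 : ℂ), (a ε : ℂ) = Complex.sqrt (1 - 2 * ε / (z : ℂ) ^ 2) :=
    h.mono fun ε hε => hε.coordinates.1
  have ha : HasDerivAt (fun ε => (a ε : ℂ)) (-((z : ℂ) ^ 2)⁻¹) 0 := hσ.congr_of_eventuallyEq haσ
  have ha0 : (a 0 : ℂ) = 1 := by simpa using haσ.self_of_nhds
  have hout := (h.and hsmall).mono fun ε hε => hε.1.quadratic_out hε.2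
  have hin := h.mono fun ε hε => hε.quadratic_in
  have hc : ∀ A : ℂ → H, ∀ᶠ ε in 𝓝 (0 : ℂ),
      PowerSeries.coeff 0 (expVf (A ε).1 PowerSeries.X) = 0 ∧
      PowerSeries.coeff 1 (expVf (A ε).1 PowerSeries.X) = 1 := fun A =>
    Eventually.of_forall fun ε => ⟨coeff_zero_expVf_X _, coeff_one_expVf_X _⟩
  -- For a = 1 the equation factors as (f - x)(f + x - 2z) = 0, and the second factor has constant
  -- term -2z ≠ 0.
  have hAX : expVf (A 0).1 PowerSeries.X = PowerSeries.X := by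
    have h1 := hout.self_of_nhds
    rw [ha0, one_pow, inv_one, map_one, one_mul] at h1
    have h2 : (expVf (A 0).1 PowerSeries.X - PowerSeries.X) *
        (expVf (A 0).1 PowerSeries.X + PowerSeries.X - PowerSeries.C (2 * (z : ℂ))) = 0 := by
      linear_combination h1
    refine sub_eq_zero.mp ((mul_eq_zero.mp h2).resolve_right fun h3 => ?_)
    have h4 := congrArg (PowerSeries.coeff 0) h3
    rw [map_sub, map_add, coeff_zero_expVf_X] at h4
    simp [hz] at h4
  -- For a = 1 the equation factors as (f - x)(f + x - 2zxf) = 0, and the second factor has linear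
  -- coefficient 2.
  have hBX : expVf (B 0).1 PowerSeries.X = PowerSeries.X := by
    have h1 := hin.self_of_nhds
    rw [ha0, one_pow, mul_one] at h1
    have h2 : (expVf (B 0).1 PowerSeries.X - PowerSeries.X) *
        (expVf (B 0).1 PowerSeries.X + PowerSeries.X - PowerSeries.X *
          (PowerSeries.C (2 * (z : ℂ)) * expVf (B 0).1 PowerSeries.X)) = 0 := by
      linear_combination -h1
    refine sub_eq_zero.mp ((mul_eq_zero.mp h2).resolve_right fun h3 => ?_)
    have h4 := congrArg (PowerSeries.coeff (0 + 1)) h3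
    rw [map_sub, map_add, PowerSeries.coeff_succ_X_mul, PowerSeries.coeff_C_mul,
      coeff_zero_expVf_X, zero_add, coeff_one_expVf_X] at h4
    norm_num at h4
  have hH : ∀ A : H, expVf A.1 PowerSeries.X = PowerSeries.X → A = 0 := fun A hA =>
    Subtype.ext (expVf_X_injective (hA.trans expVf_zero_X.symm))
  have hA0 := hH _ hAX
  have hB0 := hH _ hBX
  have hτ : HasDerivAt (fun ε => ((a ε : ℂ) ^ 2)⁻¹) (2 * ((z : ℂ) ^ 2)⁻¹) 0 := by
    have h1 := (ha.fun_pow 2).fun_inv (by rw [ha0]; simp)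
    simpa [ha0] using h1
  refine ⟨⟨hA0, Units.ext ha0, hB0⟩, fun k => ?_, ?_, fun k => ?_⟩
  · obtain ⟨f', hf', hk⟩ := hasCoeffDerivAt_of_quadratic_out hz hτ hAX (hc A) hout k
    have h1 := HasCoeffDerivAt.hasDerivAt_of_expVf (A := fun ε => (A ε).1)
      (congrArg Subtype.val hA0) hf' k
    rw [hk] at h1
    convert h1 using 1
    rw [zpow_sub₀ hz, zpow_neg, inv_pow]
    simp only [zpow_natCast, zpow_ofNat]
    field_simp
  · rwa [zpow_neg, zpow_ofNat]
  · obtain ⟨f', hf', hk⟩ := hasCoeffDerivAt_of_quadratic_in ha ha0 hBX (hc B) hin k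
    have h1 := HasCoeffDerivAt.hasDerivAt_of_expVf (A := fun ε => (B ε).1)
      (congrArg Subtype.val hB0) hf' k
    rw [hk] at h1
    convert h1 using 1
    rw [zpow_sub₀ hz]
    simp only [zpow_natCast, zpow_ofNat]
    field_simp

/-! ### Derivatives of meromorphic functions -/

/-- The chain rule along a curve in possibly infinitely many variables. Allowing every larger index
set lets the sets of two summands be merged; the factor X_j adds j. -/
lemma exists_hasDerivAt_eval {ι : Type*} (P : MvPolynomial ι ℂ) : ∃ s₀ : Finset ι, ∀ s,
    s₀ ⊆ s → ∀ (x : ℂ → ι → ℂ) (x' : ι → ℂ) (t : ℂ),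
    (∀ i, HasDerivAt (fun t => x t i) (x' i) t) →
    HasDerivAt (fun t => MvPolynomial.eval (x t) P)
      (∑ i ∈ s, MvPolynomial.eval (x t) (MvPolynomial.pderiv i P) * x' i) t := by
  classical
  induction P using MvPolynomial.induction_on with
  | C c =>
    refine ⟨∅, fun s _ x x' t _ => ?_⟩
    simpa using hasDerivAt_const t c
  | add P Q hP hQ =>
    obtain ⟨s₁, h₁⟩ := hP
    obtain ⟨s₂, h₂⟩ := hQ
    refine ⟨s₁ ∪ s₂, fun s hs x x' t hx => ?_⟩
    simp only [map_add, add_mul, Finset.sum_add_distrib]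
    exact (h₁ s (Finset.union_subset_left hs) x x' t hx).fun_add
      (h₂ s (Finset.union_subset_right hs) x x' t hx)
  | mul_X P j hP =>
    obtain ⟨s₁, h₁⟩ := hP
    refine ⟨s₁ ∪ {j}, fun s hs x x' t hx => ?_⟩
    have h2 := (h₁ s (Finset.union_subset_left hs) x x' t hx).fun_mul (hx j)
    simp only [map_mul, MvPolynomial.eval_X]
    have hj : j ∈ s := hs (by simp)
    refine h2.congr_deriv ?_
    symm
    rw [Finset.sum_mul, ← Finset.sum_erase_add _ _ hj, ← Finset.sum_erase_add _ _ hj, add_assoc]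
    congr 1
    · refine Finset.sum_congr rfl fun i hi => ?_
      rw [MvPolynomial.pderiv_mul, MvPolynomial.pderiv_X_of_ne (Finset.ne_of_mem_erase hi).symm]
      simp only [map_add, map_mul, MvPolynomial.eval_X, map_zero]
      ring
    · rw [MvPolynomial.pderiv_mul, MvPolynomial.pderiv_X_self]
      simp only [map_add, map_mul, MvPolynomial.eval_X, map_one]
      ring

/-- The chain rule for meromorphic functions on `K*(1)` at the identity element. -/
lemma IsMero.exists_hasDerivAt {F : KStarSpace 1 → ℂ} (hF : IsMero F) :
    ∃ T₁ T₂ : Finset ℕ+, (Function.support fun k => dOut k F) ⊆ T₁ ∧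
      (Function.support fun k => dIn k F) ⊆ T₂ ∧
      ∀ (A B : ℂ → H) (a : ℂ → ℂˣ) (A' B' : ℕ+ → ℂ) (a' t : ℂ), A t = 0 → a t = 1 → B t = 0 →
        (∀ k, HasDerivAt (fun t => (A t).1 k) (A' k) t) →
        HasDerivAt (fun t => (a t : ℂ)) a' t →
        (∀ k, HasDerivAt (fun t => (B t).1 k) (B' k) t) →
        HasDerivAt (fun t => F (KStarSpace.mk₁ (A t) (a t) (B t)))
          (∑ k ∈ T₁, A' k * dOut k F + a' * dScale F + ∑ k ∈ T₂, B' k * dIn k F) t := by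
  classical
  obtain ⟨P, r, hP⟩ := hF
  obtain ⟨s₀, hs₀⟩ := exists_hasDerivAt_eval P
  -- The coordinates of the identity element; c and b are the partial derivatives and the value of
  -- the numerator there.
  set x₀ : ℕ+ ⊕ Unit ⊕ ℕ+ → ℂ := Sum.elim 0 (Sum.elim (fun _ => 1) 0) with hx₀
  set c : ℕ+ ⊕ Unit ⊕ ℕ+ → ℂ := fun i => MvPolynomial.eval x₀ (MvPolynomial.pderiv i P) with hc
  set b := MvPolynomial.eval x₀ P with hb
  have key : ∀ T₁ T₂ : Finset ℕ+, s₀ ⊆ T₁.disjSum (Finset.univ.disjSum T₂) →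
      ∀ (A B : ℂ → H) (a : ℂ → ℂˣ) (A' B' : ℕ+ → ℂ) (a' t : ℂ), A t = 0 → a t = 1 → B t = 0 →
        (∀ k, HasDerivAt (fun t => (A t).1 k) (A' k) t) →
        HasDerivAt (fun t => (a t : ℂ)) a' t →
        (∀ k, HasDerivAt (fun t => (B t).1 k) (B' k) t) →
        HasDerivAt (fun t => F (KStarSpace.mk₁ (A t) (a t) (B t)))
          (∑ k ∈ T₁, A' k * c (Sum.inl k) + a' * (c (Sum.inr (Sum.inl ())) - r * b) +
            ∑ k ∈ T₂, B' k * c (Sum.inr (Sum.inr k))) t := by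
    intro T₁ T₂ hs A B a A' B' a' t hA0 ha0 hB0 hA ha hB
    have hx : ∀ i, HasDerivAt (fun t => (fun t => Sum.elim (A t).1 (Sum.elim (fun _ : Unit =>
        (a t : ℂ)) (B t).1)) t i) (Sum.elim A' (Sum.elim (fun _ => a') B') i) t := by
      rintro (k | u | k)
      · exact hA k
      · exact ha
      · exact hB k
    have hxt : Sum.elim (A t).1 (Sum.elim (fun _ : Unit => (a t : ℂ)) (B t).1) = x₀ := by
      rw [hA0, ha0, hB0]; rfl
    have h1 := hs₀ _ hs _ _ t hx
    have h2 := (h1.fun_div (ha.fun_pow r) (pow_ne_zero r (a t).ne_zero)).congr_of_eventuallyEq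
      (f₁ := fun t => F (KStarSpace.mk₁ (A t) (a t) (B t)))
      (Eventually.of_forall fun t => hP (A t) (a t) (B t))
    refine h2.congr_deriv ?_
    rw [hxt, ha0, Finset.sum_disjSum, Finset.sum_disjSum]
    simp only [Sum.elim_inl, Sum.elim_inr, Units.val_one, one_pow, mul_one, div_one,
      Finset.univ_unique, Finset.sum_singleton, hc, hb, PUnit.default_eq_unit,
      mul_comm _ (A' _), mul_comm _ (B' _)]
    ring
  set T₁ := s₀.toLeft with hT₁
  set T₂ := s₀.toRight.toRight with hT₂
  have hsub : s₀ ⊆ T₁.disjSum (Finset.univ.disjSum T₂) := by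
    rintro (k | u | k) hi <;> simp [hT₁, hT₂, hi]
  have hz : ∀ t : ℂ, HasDerivAt (fun _ : ℂ => (((1 : ℂˣ) : ℂ))) 0 t := fun t => hasDerivAt_const _ _
  have hsingle : ∀ k j : ℕ+, HasDerivAt (fun t => (H.single k t).1 j)
      ((Pi.single k 1 : ℕ+ → ℂ) j) 0 := by
    intro k j
    change HasDerivAt (fun t => (Pi.single k t : ℕ+ → ℂ) j) _ 0
    by_cases hj : j = k
    · subst hj
      simpa using hasDerivAt_id' (0 : ℂ)
    · simpa [Pi.single_eq_of_ne hj] using hasDerivAt_const (0 : ℂ) (0 : ℂ)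
  have hs0 : ∀ k, H.single k 0 = 0 := fun k => Subtype.ext (Pi.single_zero k)
  have hzero : ∀ (t : ℂ) (j : ℕ+), HasDerivAt (fun _ : ℂ => (0 : H).1 j) 0 t :=
    fun t j => hasDerivAt_const _ _
  -- Applying `key` to the coordinate lines through the identity element identifies its coefficients
  -- with the partial derivatives of F and shows that they vanish outside T₁ and T₂.
  have hout : ∀ k, dOut k F = if k ∈ T₁ then c (Sum.inl k) else 0 := by
    intro k
    have := key T₁ T₂ hsub (fun t => H.single k t) (fun _ => 0) (fun _ => 1) (Pi.single k 1)
      (fun _ => 0) 0 0 (hs0 k) rfl rfl (hsingle k) (hz 0) (hzero 0)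
    rw [dOut, this.deriv]
    simp [Pi.single_apply]
  have hin : ∀ k, dIn k F = if k ∈ T₂ then c (Sum.inr (Sum.inr k)) else 0 := by
    intro k
    have := key T₁ T₂ hsub (fun _ => 0) (fun t => H.single k t) (fun _ => 1) (fun _ => 0)
      (Pi.single k 1) 0 0 rfl rfl (hs0 k) (hzero 0) (hz 0) (hsingle k)
    rw [dIn, this.deriv]
    simp [Pi.single_apply]
  have hscale : dScale F = c (Sum.inr (Sum.inl ())) - r * b := by
    -- The dummy value of `toUnit` at 0 is harmless, as the derivative is taken at 1.
    have h1 : HasDerivAt (fun t : ℂ => (toUnit t : ℂ)) 1 1 := by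
      refine (hasDerivAt_id (1 : ℂ)).congr_of_eventuallyEq ?_
      filter_upwards [isOpen_ne.mem_nhds (one_ne_zero (α := ℂ))] with t ht
      have : t ≠ 0 := ht
      simp [toUnit, this]
    have := key T₁ T₂ hsub (fun _ => 0) (fun _ => 0) toUnit (fun _ => 0) (fun _ => 0) 1 1 rfl
      (Units.ext (by simp [toUnit])) rfl (hzero 1) h1 (hzero 1)
    rw [dScale, this.deriv]
    simp
  refine ⟨T₁, T₂, fun k hk => ?_, fun k hk => ?_, ?_⟩
  · by_contra h
    exact hk ((hout k).trans (if_neg h))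
  · by_contra h
    exact hk ((hin k).trans (if_neg h))
  · intro A B a A' B' a' t h1 h2 h3 h4 h5 h6
    refine (key T₁ T₂ hsub A B a A' B' a' t h1 h2 h3 h4 h5 h6).congr_deriv ?_
    rw [hscale]
    have e1 : ∑ k ∈ T₁, A' k * dOut k F = ∑ k ∈ T₁, A' k * c (Sum.inl k) :=
      Finset.sum_congr rfl fun k hk => by rw [hout, if_pos hk]
    have e2 : ∑ k ∈ T₂, B' k * dIn k F = ∑ k ∈ T₂, B' k * c (Sum.inr (Sum.inr k)) :=
      Finset.sum_congr rfl fun k hk => by rw [hin, if_pos hk]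
    rw [e1, e2]

end VOC

end

/-! ### The derivative of a meromorphic function along the sewing. -/

theorem lemmaL (z : ℂˣ) :
    (∀ᶠ ε : ℂ in nhds 0, ∃! Q : KStarSpace 1, KStarSpace.IsSewing 1 (omegaElt ε) (pantsElt z) Q) ∧
    ∀ F : KStarSpace 1 → ℂ, IsMero F →
      DifferentiableAt ℂ
        (fun ε : ℂ => F (KStarSpace.sew 1 (omegaElt ε) (pantsElt z))) 0 ∧
      (Function.support fun k : ℕ+ => dOut k F).Finite ∧
      (Function.support fun k : ℕ+ => dIn k F).Finite ∧
      LI z F =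
        (∑ᶠ k : ℕ+, -(z : ℂ) ^ (-(k : ℤ) - 2) * dOut k F)
          - (z : ℂ) ^ (-2 : ℤ) * dScale F
          + (∑ᶠ k : ℕ+, -(z : ℂ) ^ ((k : ℤ) - 2) * dIn k F) := by
  have hex : ∀ᶠ ε : ℂ in nhds 0, ∃ Q : KStarSpace 1,
      KStarSpace.IsSewing 1 (omegaElt ε) (pantsElt z) Q := by
    have ho : IsOpen {ε : ℂ | 8 * ‖2 * ε‖ < ‖(z : ℂ)‖ ^ 2} :=
      isOpen_lt (by fun_prop) continuous_const
    exact Filter.Eventually.mono (ho.mem_nhds (by simp)) fun ε hε => exists_isSewing hε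
  refine ⟨hex.mono fun ε ⟨Q, hQ⟩ => ⟨Q, hQ, fun Q' hQ' => hQ'.unique hQ⟩, fun F hF => ?_⟩
  -- Where a sewing exists, the element selected by `sew` is one. Its arbitrary values elsewhere do
  -- not affect derivatives at 0.
  have hsew : ∀ᶠ ε : ℂ in nhds 0, KStarSpace.IsSewing 1 (omegaElt ε) (pantsElt z)
      (KStarSpace.sew 1 (omegaElt ε) (pantsElt z) : KStarSpace 1) :=
    hex.mono fun ε hε => Classical.epsilon_spec hε
  choose A a B hQ using fun ε : ℂ =>
    exists_eq_mk₁ (KStarSpace.sew 1 (omegaElt ε) (pantsElt z) : KStarSpace 1)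
  simp only [hQ] at hsew
  obtain ⟨⟨hA0, ha0, hB0⟩, hA, ha, hB⟩ := hasDerivAt_of_isSewing hsew
  obtain ⟨T₁, T₂, hT₁, hT₂, hD⟩ := hF.exists_hasDerivAt
  have h := hD A B a _ _ _ 0 hA0 ha0 hB0 hA ha hB
  simp only [← hQ] at h
  refine ⟨h.differentiableAt, T₁.finite_toSet.subset hT₁, T₂.finite_toSet.subset hT₂, ?_⟩
  rw [LI, h.deriv, finsum_eq_sum_of_support_subset (s := T₁),
    finsum_eq_sum_of_support_subset (s := T₂)]
  · ring
  · exact (Function.support_mul_subset_right _ _).trans hT₂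
  · exact (Function.support_mul_subset_right _ _).trans hT₁
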